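/- Let $(Y_\varepsilon)_{\varepsilon>0}$ be real random variables on a probability space. For $u\in\mathbb R$ put $\Lambda_\varepsilon(u)=\varepsilon\log\mathbb E[e^{uY_\varepsilon/\varepsilon}]$, let $\mathcal D_\varepsilon=\{u\in\mathbb R:\mathbb E[e^{uY_\varepsilon/\varepsilon}]<\infty\}$, and for complex $w$ with $\mathrm{Re}\,w\in\mathcal D_\varepsilon$ put $\mathrm{Re}\,\Lambda_\varepsilon(w)=\varepsilon\log|\mathbb E[e^{wY_\varepsilon/\varepsilon}]|\in[-\infty,\infty)$. Suppose that the set-theoretic limit $\mathcal D_0=\lim_{\varepsilon\downarrow0}\mathcal D_\varepsilon$ exists, i.e. $\bigcup_{\varepsilon>0}\bigcap_{0<s\le\varepsilon}\mathcal D_s=\bigcap_{\varepsilon>0}\bigcup_{0<s\le\varepsilon}\mathcal D_s=:\mathcal D_0$; let $\mathcal D_0^o$ be its interior. Assume that there are functions $\Lambda_0,\Lambda_1,\Lambda_2$ such that: (i) for each $u\in\mathcal D_0^o$, $\Lambda_\varepsilon(u)=\Lambda_0(u)+\Lambda_1(u)\varepsilon+\Lambda_2(u)\varepsilon^2+O(\varepsilon^3)$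 as $\varepsilon\downarrow0$; (ii) for some $\varepsilon_0>0$, $(\varepsilon,u)\mapsto\Lambda_\varepsilon(u)$ is finite and $C^\infty$ on $(0,\varepsilon_0)\times\mathcal D_0^o$; (iii) $0\in\mathcal D_0^o$; (iv) $\Lambda_0$ is strictly convex and essentially smooth on $\mathcal D_0^o$, i.e. differentiable there with $|\Lambda_0'(u_n)|\to\infty$ whenever $u_n\in\mathcal D_0^o$ converges to a boundary point of $\mathcal D_0^o$; (v) there is a real function, written $w\mapsto\mathrm{Re}\,\Lambda_0(w)$, on $S=\{w\in\mathbb C:\mathrm{Re}\,w\in\mathcal D_0^o\setminus\{0\}\}$ such that (a) $\mathrm{Re}\,\Lambda_\varepsilon(w)=\mathrm{Re}\,\Lambda_0(w)+O(\varepsilon)$ as $\varepsilon\downarrow0$, locally uniformly in $w\in S$ (in particular $\mathbb E[e^{wY_\varepsilon/\varepsilon}]\neq0$ for small $\varepsilon$, locally uniformly in $w\in S$); and for each fixed $p_r\in\mathcal D_0^o\setminus\{0\}$: (b) $p\mapsto\mathrm{Re}\,\Lambda_0(p_r+ip)$ has a unique maximum on $\mathbb R$, at $p=0$, and is bounded away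 from this maximum as $|p|\to\infty$; (c) there are $\varepsilon_1,p^*>0$ and $M\in\mathbb R$ with $\mathrm{Re}\,\Lambda_\varepsilon(p_r+ip)-\mathrm{Re}\,\Lambda_0(p_r+ip)\le M\varepsilon$ for all $|p|\ge p^*$ and $0<\varepsilon\le\varepsilon_1$. Let $f:(0,\infty)\to[0,\infty)$ satisfy $\varepsilon f(\varepsilon)=c+O(\varepsilon)$ as $\varepsilon\downarrow0$, where $c\ge0$ and $c\in\mathcal D_0^o$. Let $k\in\Lambda_0'(\mathcal D_0^o)$, let $u=u^*(k)$ be the (unique) point of $\mathcal D_0^o$ with $\Lambda_0'(u)=k$, and suppose $k\notin\{\Lambda_0'(0),\Lambda_0'(c)\}$. Put $\Lambda^*(k)=\sup_{v\in\mathcal D_0^o}\{vk-\Lambda_0(v)\}$. Then, as $\varepsilon\downarrow0$, $$e^{-\Lambda^*(k)/\varepsilon+kf(\varepsilon)+\Lambda_1}\,\bar A_c(k,\varepsilon)\,\bigl[A_c(k,\varepsilon)+O(\varepsilon^2)\bigr]=\begin{cases}\mathbb E\bigl(e^{Y_\varepsilon f(\varepsilon)}-e^{kf(\varepsilon)}\bigr)^+,&k>\Lambda_0'(c),\\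 \mathbb E\bigl(e^{kf(\varepsilon)}-e^{Y_\varepsilon f(\varepsilon)}\bigr)^+,&k<\Lambda_0'(0),\\ -\mathbb E\bigl(e^{Y_\varepsilon f(\varepsilon)}\wedge e^{kf(\varepsilon)}\bigr),&\Lambda_0'(0)<k<\Lambda_0'(c),\end{cases}$$ the expectations being finite for small $\varepsilon$. Here, writing $\Lambda_i=\Lambda_i(u)$ and $\Lambda_{i,l}=\Lambda_i^{(l)}(u)$ with $u=u^*(k)$, $$\bar A_c(k,\varepsilon)=\frac{c\sqrt\varepsilon\,1_{\{c>0\}}+\varepsilon^{3/2}f(\varepsilon)1_{\{c=0\}}}{u(u-c)\sqrt{2\pi\Lambda_{0,2}}},\qquad A_c(k,\varepsilon)=1+\Upsilon(c,k)\varepsilon+\frac{u(\varepsilon f(\varepsilon)-c)}{(u-c)c}1_{\{c>0\}}+\frac{\varepsilon f(\varepsilon)}{u}1_{\{c=0\}},$$ $$\Upsilon(c,k)=\Lambda_2-\frac{5\Lambda_{0,3}^2}{24\Lambda_{0,2}^3}+\frac{4\Lambda_{1,1}\Lambda_{0,3}+\Lambda_{0,4}}{8\Lambda_{0,2}^2}-\frac{\Lambda_{1,1}^2+\Lambda_{1,2}}{2\Lambda_{0,2}}-\frac{\Lambda_{0,3}}{2u\Lambda_{0,2}^2}-\frac{\Lambda_{0,3}}{2(u-c)\Lambda_{0,2}^2}-\frac{\Lambda_{1,1}(c-2u)+3}{u(u-c)\Lambda_{0,2}}-\frac{c^2}{u^2(u-c)^2\Lambda_{0,2}}.$$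 -/

import Mathlib

open MeasureTheory ProbabilityTheory Filter Topology Asymptotics Set

noncomputable section

namespace OptionAsymp

variable {Ω : Type*} [MeasurableSpace Ω]

/-- The effective domain `D_ε`: those real `u` with `E[exp (u Y_ε / ε)] < ∞`. -/
def dom (P : Measure Ω) (Y : ℝ → Ω → ℝ) (ε : ℝ) : Set ℝ :=
  {u : ℝ | Integrable (fun ω => Real.exp (u / ε * Y ε ω)) P}

/-- The renormalised logarithmic moment generating function
`Λ_ε(u) = ε log E[exp (u Y_ε / ε)]`, meaningful for `u ∈ dom P Y ε`. -/
def lmgf (P : Measure Ω) (Y : ℝ → Ω → ℝ) (ε u : ℝ) : ℝ :=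
  ε * Real.log (∫ ω, Real.exp (u / ε * Y ε ω) ∂P)

/-- The complex moment generating function `E[exp (w Y_ε / ε)]`. -/
def cmgf (P : Measure Ω) (Y : ℝ → Ω → ℝ) (ε : ℝ) (w : ℂ) : ℂ :=
  ∫ ω, Complex.exp (w / (ε : ℂ) * (Y ε ω : ℂ)) ∂P

/-- `Re Λ_ε(w) = ε log |E[exp (w Y_ε / ε)]|` for complex `w`; the real part of the logarithm does
not depend on the branch. Meaningful where `cmgf P Y ε w ≠ 0`. -/
def reLmgf (P : Measure Ω) (Y : ℝ → Ω → ℝ) (ε : ℝ) (w : ℂ) : ℝ :=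
  ε * Real.log ‖cmgf P Y ε w‖

/-- `D = lim_{ε ↓ 0} D_ε`: the set-theoretic lower and upper limits exist and both equal `D`. -/
structure IsLimitDom (P : Measure Ω) (Y : ℝ → Ω → ℝ) (D : Set ℝ) : Prop where
  liminf_eq : D = ⋃ ε ∈ Ioi (0 : ℝ), ⋂ s ∈ Ioc 0 ε, dom P Y s
  limsup_eq : D = ⋂ ε ∈ Ioi (0 : ℝ), ⋃ s ∈ Ioc 0 ε, dom P Y s

/-- `h` is essentially smooth on the open set `U`. -/
structure EssentiallySmooth (h : ℝ → ℝ) (U : Set ℝ) : Prop where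
  nonempty : U.Nonempty
  differentiable : DifferentiableOn ℝ h U
  steep : ∀ x : ℕ → ℝ, (∀ n, x n ∈ U) → ∀ a ∈ frontier U, Tendsto x atTop (𝓝 a) →
    Tendsto (fun n => |deriv h (x n)|) atTop atTop

/-- Tail error control. `L w` stands for `Re Λ₀(w)`; condition `limit` determines it, as the limit
of `Re Λ_ε(w)`, at every `w` that occurs below. -/
structure TailControl (P : Measure Ω) (Y : ℝ → Ω → ℝ) (D : Set ℝ) (L : ℂ → ℝ) : Prop where
  /-- `Re Λ_ε(w) = Re Λ₀(w) + O(ε)`, locally uniformly in `w`. -/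
  limit : ∀ w : ℂ, w.re ∈ interior D \ {0} →
    (∀ᶠ q : ℝ × ℂ in 𝓝[>] 0 ×ˢ 𝓝 w, cmgf P Y q.1 q.2 ≠ 0) ∧
    (fun q : ℝ × ℂ => reLmgf P Y q.1 q.2 - L q.2) =O[𝓝[>] 0 ×ˢ 𝓝 w] (fun q => q.1)
  /-- On each vertical line `Re Λ₀` has its unique maximum on the real axis. -/
  unique_max : ∀ r ∈ interior D \ {0}, ∀ p : ℝ, p ≠ 0 → L ⟨r, p⟩ < L ⟨r, 0⟩
  /-- `Re Λ₀` stays away from this maximum at infinity. -/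
  away : ∀ r ∈ interior D \ {0}, ∃ δ > 0, ∃ R : ℝ, ∀ p : ℝ, R ≤ |p| → L ⟨r, p⟩ ≤ L ⟨r, 0⟩ - δ
  /-- `Re (Λ_ε - Λ₀) ≤ M ε` uniformly far out; where `cmgf` vanishes, `Re Λ_ε = -∞`. -/
  upper : ∀ r ∈ interior D \ {0}, ∃ ε₁ > 0, ∃ p₀ > 0, ∃ M : ℝ,
    ∀ p : ℝ, p₀ ≤ |p| → ∀ ε ∈ Ioc 0 ε₁,
      cmgf P Y ε ⟨r, p⟩ ≠ 0 → reLmgf P Y ε ⟨r, p⟩ - L ⟨r, p⟩ ≤ M * ε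

/-- The standing assumption on the family `(Y_ε)`, with limiting domain `D` and expansion
coefficients `Λ₀, Λ₁, Λ₂`. -/
structure Assumptions (P : Measure Ω) (Y : ℝ → Ω → ℝ) (D : Set ℝ) (Λ₀ Λ₁ Λ₂ : ℝ → ℝ) : Prop where
  limit_dom : IsLimitDom P Y D
  expansion : ∀ u ∈ interior D,
    (fun ε => lmgf P Y ε u - (Λ₀ u + Λ₁ u * ε + Λ₂ u * ε ^ 2)) =O[𝓝[>] 0] (fun ε : ℝ => ε ^ 3)
  smooth : ∃ ε₀ > 0, (∀ ε ∈ Ioo 0 ε₀, interior D ⊆ dom P Y ε) ∧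
    ContDiffOn ℝ ((⊤ : ℕ∞) : WithTop ℕ∞) (fun q : ℝ × ℝ => lmgf P Y q.1 q.2) (Ioo 0 ε₀ ×ˢ interior D)
  zero_mem : (0 : ℝ) ∈ interior D
  strictConvex : StrictConvexOn ℝ (interior D) Λ₀
  essentiallySmooth : EssentiallySmooth Λ₀ (interior D)
  tail : ∃ L : ℂ → ℝ, TailControl P Y D L

/-- The Fenchel-Legendre transform `Λ*` of `Λ₀`. -/
def legendre (D : Set ℝ) (Λ₀ : ℝ → ℝ) (k : ℝ) : ℝ :=
  sSup ((fun u => u * k - Λ₀ u) '' interior D)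

/-- The coefficient `Υ(b, k)`, written as a function of the saddlepoint `u = u*(k)`. -/
def upsilon (Λ₀ Λ₁ Λ₂ : ℝ → ℝ) (b u : ℝ) : ℝ :=
  let Λ02 := iteratedDeriv 2 Λ₀ u
  let Λ03 := iteratedDeriv 3 Λ₀ u
  let Λ04 := iteratedDeriv 4 Λ₀ u
  let Λ11 := deriv Λ₁ u
  let Λ12 := iteratedDeriv 2 Λ₁ u
  Λ₂ u - 5 * Λ03 ^ 2 / (24 * Λ02 ^ 3) + (4 * Λ11 * Λ03 + Λ04) / (8 * Λ02 ^ 2)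
    - (Λ11 ^ 2 + Λ12) / (2 * Λ02)
    - Λ03 / (2 * u * Λ02 ^ 2) - Λ03 / (2 * (u - b) * Λ02 ^ 2)
    - (Λ11 * (b - 2 * u) + 3) / (u * (u - b) * Λ02)
    - b ^ 2 / (u ^ 2 * (u - b) ^ 2 * Λ02)

/-- `Ā_b(k, ε)`, with `u = u*(k)`. -/
def coeffBar (Λ₀ f : ℝ → ℝ) (b u ε : ℝ) : ℝ :=
  (if 0 < b then b * √ε else ε ^ (3 / 2 : ℝ) * f ε)
    / (u * (u - b) * √(2 * Real.pi * iteratedDeriv 2 Λ₀ u))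

/-- `A_b(k, ε)`, with `u = u*(k)`. -/
def coeff (Λ₀ Λ₁ Λ₂ f : ℝ → ℝ) (b u ε : ℝ) : ℝ :=
  1 + upsilon Λ₀ Λ₁ Λ₂ b u * ε +
    (if 0 < b then u * (ε * f ε - b) / ((u - b) * b) else ε * f ε / u)

/-- `E[X_ε] = exp(-Λ*(k)/ε + k f(ε) + Λ₁) Ā_c(k, ε) [A_c(k, ε) + O(ε²)]` as `ε ↓ 0`, with finite
expectation, where `u = u*(k)`. -/
def HasExpansion (P : Measure Ω) (X : ℝ → Ω → ℝ) (D : Set ℝ) (Λ₀ Λ₁ Λ₂ f : ℝ → ℝ)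
    (c k u : ℝ) : Prop :=
  (∀ᶠ ε in 𝓝[>] (0 : ℝ), Integrable (X ε) P) ∧
  ∃ R : ℝ → ℝ, R =O[𝓝[>] 0] (fun ε : ℝ => ε ^ 2) ∧
    ∀ᶠ ε in 𝓝[>] (0 : ℝ),
      Real.exp (-legendre D Λ₀ k / ε + k * f ε + Λ₁ u) * coeffBar Λ₀ f c u ε
        * (coeff Λ₀ Λ₁ Λ₂ f c u ε + R ε) = ∫ ω, X ε ω ∂P

end OptionAsymp

end

namespace OptionAsymp

/-! Put b = ε f(ε) and X = (Y_ε − k)/ε. After division by e^{k f(ε)} the three payoffs are g(X) with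
g(x) = (e^{bx} − 1)^+, (1 − e^{bx})^+ or −min(e^{bx}, 1). In each case e^{-ux} g(x) has Fourier
transform b / ((u + ip)(u − b + ip)) at angular frequency p; only the position of u relative to the
poles 0 and b tells them apart. Fourier inversion and Fubini (`expectation_payoff`) turn all three
expectations into the same integral of the complex moment generating function along Re w = u. With u
the saddlepoint, Laplace's method on the scale p = √ε t yields the expansion
(`LocalExpansion.integral_expansion`).

Laplace's method needs Λ_ε = F₀ + ε F₁ + O(ε²) uniformly on a complex disc around u, with F₀ and F₁
holomorphic, whereas the expansion is assumed only pointwise on the real axis. Borel–Carathéodory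
and the locally uniform control of real parts first give F₀ and a bounded holomorphic family (Λ_ε −
F₀)/ε. A combination of this family at ε, ε/2, ε/4 cancels the unknown coefficients and is O(ε²) at
each real point. By continuity of measure the bound is uniform on a subset of more than half the
measure of an interval, and a Remez inequality (`norm_le_of_small_on_large_set`) carries it to a
complex disc at the price of a factor ε^{-1/2}. The remaining exponent 3/2 exceeds 1, which suffices
to sum over dyadic scales (`exists_uniform_expansion`). Uniformity is needed only up to order ε: Λ₂
contributes through its value at u alone.

Strict convexity does not exclude Λ₀''(u) = 0. But |E e^{wZ}| ≤ E e^{Re(w) Z} makes Re F₀ maximal on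
the real axis along vertical lines, which rules out a leading term of order three or more
(`LocalExpansion.second_deriv_pos`). Away from the real axis, the tail hypotheses and compactness
make the integrand exponentially small (`TailControl.exists_bound`). Since the expectation is real,
only the real part of the integrand matters; the terms of odd order in √ε drop out of it, so the
error after the ε-term is of order ε². The Gaussian average of that term is Υ − Λ₂. -/

/-! ### A Remez inequality, and its use on sets of large measure. -/

/-- Greedy choice: the least point of `K` is a node, and discarding the stretch of length `d` after
it costs measure at most `d`, so the induction hypothesis applies to what is left. -/
lemma exists_separated_nodes (d : ℝ) (hd : 0 < d) (N : ℕ) :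
    ∀ K : Set ℝ, IsClosed K → BddBelow K → ENNReal.ofReal (N * d) < volume K →
      ∃ x : ℕ → ℝ, (∀ i ≤ N, x i ∈ K) ∧ ∀ i < N, x i + d ≤ x (i + 1) := by
  induction N with
  | zero =>
    intro K _ _ hK
    have hne : K.Nonempty := by
      rw [nonempty_iff_ne_empty]; rintro rfl; simp at hK
    obtain ⟨y, hy⟩ := hne
    exact ⟨fun _ => y, fun _ _ => hy, fun i hi => absurd hi (by omega)⟩
  | succ N ih =>
    intro K hc hb hK
    have hne : K.Nonempty := by
      rw [nonempty_iff_ne_empty]; rintro rfl; simp at hK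
    have hmem : sInf K ∈ K := hc.csInf_mem hne hb
    have hsub : K ⊆ Ico (sInf K) (sInf K + d) ∪ (K ∩ Ici (sInf K + d)) := by
      intro y hy
      have h1 := csInf_le hb hy
      rcases lt_or_ge y (sInf K + d) with h | h
      · exact Or.inl ⟨h1, h⟩
      · exact Or.inr ⟨hy, h⟩
    have hvol : volume K ≤ ENNReal.ofReal d + volume (K ∩ Ici (sInf K + d)) := by
      refine (measure_mono hsub).trans ((measure_union_le _ _).trans ?_)
      simp
    have hlt : ENNReal.ofReal (N * d) < volume (K ∩ Ici (sInf K + d)) := by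
      have h2 : ENNReal.ofReal ((N + 1 : ℕ) * d) = ENNReal.ofReal d + ENNReal.ofReal (N * d) := by
        rw [← ENNReal.ofReal_add hd.le (by positivity)]; congr 1; push_cast; ring
      rw [h2] at hK
      exact lt_of_add_lt_add_left (hK.trans_le hvol)
    obtain ⟨x, hx, hs⟩ := ih _ (hc.inter isClosed_Ici) (hb.mono inter_subset_left) hlt
    refine ⟨fun n => Nat.casesOn n (sInf K) x, ?_, ?_⟩
    · rintro (_ | i) hi
      · exact hmem
      · exact (hx i (by omega)).1
    · rintro (_ | i) hi
      · exact (hx 0 (by omega)).2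
      · exact hs i (by omega)

lemma sub_le_of_separated {d : ℝ} {N : ℕ} {x : ℕ → ℝ} (h : ∀ i < N, x i + d ≤ x (i + 1))
    {i j : ℕ} (hij : i ≤ j) (hj : j ≤ N) : ((j : ℝ) - i) * d ≤ x j - x i := by
  induction j, hij using Nat.le_induction with
  | base => simp
  | succ j hij ih =>
    have := ih (by omega)
    have h2 := h j (by omega)
    push_cast
    linarith

lemma prod_range_sub_eq_factorial (j : ℕ) : ∏ i ∈ Finset.range j, ((j : ℝ) - i) = j.factorial := by
  rw [← Finset.prod_range_reflect, ← Finset.prod_range_add_one_eq_factorial]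
  push_cast
  refine Finset.prod_congr rfl fun i hi => ?_
  have := Finset.mem_range.1 hi
  rw [Nat.cast_sub (by omega), Nat.cast_sub (by omega)]
  push_cast; ring

/-- These products are the denominators of the Lagrange basis. Node `i` is at distance at least |j −
i| d from node `j`, which gives d^N j! (N − j)!, and a binomial coefficient is at most 2^N. -/
lemma prod_separated_ge {d : ℝ} (hd : 0 < d) {N : ℕ} {x : ℕ → ℝ}
    (h : ∀ i < N, x i + d ≤ x (i + 1)) {j : ℕ} (hj : j ≤ N) :
    d ^ N * (N.factorial / 2 ^ N) ≤ ∏ i ∈ (Finset.range (N + 1)).erase j, |x j - x i| := by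
  have hsplit : (Finset.range (N + 1)).erase j = Finset.range j ∪ Finset.Ico (j + 1) (N + 1) := by
    ext i; simp; omega
  have hdisj : Disjoint (Finset.range j) (Finset.Ico (j + 1) (N + 1)) := by
    rw [Finset.disjoint_left]; intro i; simp; omega
  rw [hsplit, Finset.prod_union hdisj]
  have h1 : d ^ j * j.factorial ≤ ∏ i ∈ Finset.range j, |x j - x i| := by
    rw [← prod_range_sub_eq_factorial]
    calc _ = ∏ i ∈ Finset.range j, (((j : ℝ) - i) * d) := by
          rw [Finset.prod_mul_distrib, Finset.prod_const, Finset.card_range]; ring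
      _ ≤ _ := by
          refine Finset.prod_le_prod (fun i hi => ?_) fun i hi => ?_
          · have : (i : ℝ) ≤ j := by exact_mod_cast (Finset.mem_range.1 hi).le
            exact mul_nonneg (by linarith) hd.le
          · exact (sub_le_of_separated h (Finset.mem_range.1 hi).le hj).trans (le_abs_self _)
  have h2 : d ^ (N - j) * (N - j).factorial ≤ ∏ i ∈ Finset.Ico (j + 1) (N + 1), |x j - x i| := by
    rw [Finset.prod_Ico_eq_prod_range, ← Finset.prod_range_add_one_eq_factorial]
    have hN : N + 1 - (j + 1) = N - j := by omega
    rw [hN]; push_cast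
    calc _ = ∏ i ∈ Finset.range (N - j), (((i : ℝ) + 1) * d) := by
          rw [Finset.prod_mul_distrib, Finset.prod_const, Finset.card_range]; ring
      _ ≤ _ := by
          refine Finset.prod_le_prod (fun i hi => by positivity) fun i hi => ?_
          have hi' := Finset.mem_range.1 hi
          have := sub_le_of_separated h (i := j) (j := j + 1 + i) (by omega) (by omega)
          rw [abs_sub_comm]
          refine le_trans ?_ (this.trans (le_abs_self _))
          push_cast
          apply le_of_eq; ring
  have hch : (N.factorial : ℝ) / 2 ^ N ≤ j.factorial * (N - j).factorial := by
    rw [div_le_iff₀ (by positivity)]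
    have := Nat.choose_mul_factorial_mul_factorial hj
    have h3 : N.choose j ≤ 2 ^ N := Nat.choose_le_two_pow N j
    have h4 : (N.factorial : ℝ) = N.choose j * (j.factorial * (N - j).factorial) := by
      exact_mod_cast (by rw [← mul_assoc]; exact this.symm)
    rw [h4, mul_comm]
    gcongr
    exact_mod_cast h3
  calc d ^ N * (N.factorial / 2 ^ N) ≤ d ^ N * (j.factorial * (N - j).factorial) := by gcongr
    _ = (d ^ j * j.factorial) * (d ^ (N - j) * (N - j).factorial) := by
        have : d ^ N = d ^ j * d ^ (N - j) := by rw [← pow_add]; congr 1; omega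
        rw [this]; ring
    _ ≤ _ := by gcongr

/-- One term of the series of exp(N + 1), together with e < 3. It lets the factorial of
`prod_separated_ge` compensate the spacing r / (N + 1), leaving only a geometric loss. -/
lemma pow_le_exp_mul_factorial (N : ℕ) : ((N : ℝ) + 1) ^ N ≤ 3 ^ (N + 1) * N.factorial := by
  have h := Real.pow_div_factorial_le_exp ((N : ℝ) + 1) (by positivity) (N + 1)
  rw [div_le_iff₀ (by positivity)] at h
  have h3 : Real.exp ((N : ℝ) + 1) ≤ 3 ^ (N + 1) := by
    have : Real.exp ((N : ℝ) + 1) = Real.exp 1 ^ (N + 1) := by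
      rw [← Real.exp_nat_mul]; push_cast; ring_nf
    rw [this]
    gcongr
    linarith [Real.exp_one_lt_d9]
  have h4 : ((N : ℝ) + 1) ^ N * (N + 1) ≤ (3 ^ (N + 1) * N.factorial) * (N + 1) := by
    calc ((N : ℝ) + 1) ^ N * (N + 1) = ((N : ℝ) + 1) ^ (N + 1) := by ring
      _ ≤ Real.exp (N + 1) * (N + 1).factorial := h
      _ ≤ 3 ^ (N + 1) * (N + 1).factorial := by gcongr
      _ = _ := by rw [Nat.factorial_succ]; push_cast; ring
  exact le_of_mul_le_mul_right h4 (by positivity)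

/-- Division of a holomorphic function by finitely many of its zeros. -/
lemma exists_eq_prod_mul {U : Set ℂ} (hU : IsOpen U) (s : Finset ℂ) :
    ∀ f : ℂ → ℂ, DifferentiableOn ℂ f U → (∀ a ∈ s, a ∈ U ∧ f a = 0) →
      ∃ Q : ℂ → ℂ, DifferentiableOn ℂ Q U ∧ ∀ z, f z = (∏ a ∈ s, (z - a)) * Q z := by
  classical
  induction s using Finset.induction_on with
  | empty => intro f hf _; exact ⟨f, hf, fun z => by simp⟩
  | insert a s has ih =>
    intro f hf h0
    have ha := h0 a (Finset.mem_insert_self a s)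
    have hd : DifferentiableOn ℂ (dslope f a) U :=
      (Complex.differentiableOn_dslope (hU.mem_nhds ha.1)).2 hf
    have hfac : ∀ z, f z = (z - a) * dslope f a z := fun z => by
      have := sub_smul_dslope f a z
      rw [ha.2, sub_zero, smul_eq_mul] at this
      exact this.symm
    obtain ⟨Q, hQ, h⟩ := ih (dslope f a) hd (fun b hb => by
      have hb' := h0 b (Finset.mem_insert_of_mem hb)
      refine ⟨hb'.1, ?_⟩
      have h1 := hfac b
      rw [hb'.2] at h1
      have hne : b - a ≠ 0 := sub_ne_zero.2 (by rintro rfl; exact has hb)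
      exact (mul_eq_zero.1 h1.symm).resolve_left hne)
    exact ⟨Q, hQ, fun z => by rw [hfac, h, Finset.prod_insert has, mul_assoc]⟩

/-- A Remez type inequality for bounded holomorphic functions. -/
lemma norm_le_of_small_on_large_set {f : ℂ → ℂ} {u ρ r R C η : ℝ} {K : Set ℝ} (hr : 0 < r)
    (hR : 3 * r ≤ R) (hRρ : R < ρ) (hC : 0 ≤ C) (hη : 0 ≤ η)
    (hf : DifferentiableOn ℂ f (Metric.ball (u : ℂ) ρ))
    (hfC : ∀ z ∈ Metric.ball (u : ℂ) ρ, ‖f z‖ ≤ C)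
    (hK : IsClosed K) (hKs : K ⊆ Icc (u - r) (u + r)) (hvol : ENNReal.ofReal r < volume K)
    (hfK : ∀ x ∈ K, ‖f x‖ ≤ η) (N : ℕ) {z : ℂ} (hz : ‖z - u‖ ≤ r) :
    ‖f z‖ ≤ 6 * η * 48 ^ N + C * (2 * r / (R - r)) ^ (N + 1) := by
  classical
  -- With this spacing N d ≤ r stays below the measure of `K`, so N + 1 nodes exist.
  set d : ℝ := r / (N + 1) with hd
  have hd0 : 0 < d := by positivity
  have hNd : (N : ℝ) * d ≤ r := by
    rw [hd, mul_div_assoc', div_le_iff₀ (by positivity)]; nlinarith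
  obtain ⟨x, hxK, hxs⟩ := exists_separated_nodes d hd0 N K hK
    (bddBelow_Icc.mono hKs) ((ENNReal.ofReal_le_ofReal hNd).trans_lt hvol)
  set S := Finset.range (N + 1) with hS
  set v : ℕ → ℂ := fun i => (x i : ℂ) with hv
  have hlt : ∀ i j, i < j → j ≤ N → x i < x j := fun i j hij hj => by
    have := sub_le_of_separated hxs hij.le hj
    have h2 : (0 : ℝ) < (j : ℝ) - i := by
      have : (i : ℝ) < j := by exact_mod_cast hij
      linarith
    nlinarith [mul_pos h2 hd0]
  have hinj : Set.InjOn v S := by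
    intro i hi j hj hij
    have hi' : i ≤ N := by simpa [hS, Nat.lt_succ_iff] using hi
    have hj' : j ≤ N := by simpa [hS, Nat.lt_succ_iff] using hj
    have hx : x i = x j := Complex.ofReal_injective hij
    rcases lt_trichotomy i j with h | h | h
    · exact absurd hx (hlt i j h hj').ne
    · exact h
    · exact absurd hx (hlt j i h hi').ne'
  have hvr : ∀ i ∈ S, ‖v i - u‖ ≤ r := fun i hi => by
    have hi' : i ≤ N := by simpa [hS, Nat.lt_succ_iff] using hi
    have := hKs (hxK i hi')
    rw [hv]
    simp only
    rw [← Complex.ofReal_sub, Complex.norm_real, Real.norm_eq_abs, abs_le]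
    exact ⟨by linarith [this.1], by linarith [this.2]⟩
  set p : Polynomial ℂ := Lagrange.interpolate S v (fun i => f (v i)) with hp
  have hfv : ∀ i ∈ S, ‖f (v i)‖ ≤ η := fun i hi =>
    hfK _ (hxK i (by simpa [hS, Nat.lt_succ_iff] using hi))
  -- Lagrange's formula: small data give a small polynomial, up to geometric growth in N. It is used
  -- with T = R on the large circle and with T = r at `z`.
  have hpb : ∀ (T : ℝ) (w : ℂ), r ≤ T → ‖w - u‖ ≤ T →
      ‖p.eval w‖ ≤ 3 * (N + 1) * η * (6 * (T + r) / r) ^ N := by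
    intro T w hT hw
    rw [hp, Lagrange.interpolate_apply, Polynomial.eval_finsetSum]
    refine (norm_sum_le _ _).trans ?_
    have hterm : ∀ j ∈ S, ‖(Polynomial.C (f (v j)) * Lagrange.basis S v j).eval w‖
        ≤ η * (3 * (6 * (T + r) / r) ^ N) := by
      intro j hj
      have hj' : j ≤ N := by simpa [hS, Nat.lt_succ_iff] using hj
      rw [Polynomial.eval_mul, Polynomial.eval_C, norm_mul]
      refine mul_le_mul (hfv j hj) ?_ (norm_nonneg _) hη
      rw [Lagrange.basis, Polynomial.eval_prod, norm_prod]
      have hb : ∀ i ∈ S.erase j, ‖(Lagrange.basisDivisor (v j) (v i)).eval w‖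
          = ‖w - v i‖ / |x j - x i| := by
        intro i _
        rw [Lagrange.basisDivisor]
        simp only [Polynomial.eval_mul, Polynomial.eval_C, Polynomial.eval_sub, Polynomial.eval_X,
          norm_mul, norm_inv, hv]
        rw [← Complex.ofReal_sub, Complex.norm_real, Real.norm_eq_abs]
        ring
      rw [Finset.prod_congr rfl hb, Finset.prod_div_distrib]
      have hnum : ∏ i ∈ S.erase j, ‖w - v i‖ ≤ (T + r) ^ N := by
        have : (S.erase j).card = N := by rw [Finset.card_erase_of_mem hj, hS]; simp
        calc _ ≤ ∏ _i ∈ S.erase j, (T + r) := by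
              refine Finset.prod_le_prod (fun i _ => norm_nonneg _) fun i hi => ?_
              calc ‖w - v i‖ = ‖(w - u) - (v i - u)‖ := by congr 1; ring
                _ ≤ ‖w - u‖ + ‖v i - u‖ := norm_sub_le _ _
                _ ≤ T + r := add_le_add hw (hvr i (Finset.mem_of_mem_erase hi))
          _ = _ := by rw [Finset.prod_const, this]
      have hden := prod_separated_ge hd0 hxs hj'
      have hden2 : r ^ N / (3 * 6 ^ N) ≤ d ^ N * (N.factorial / 2 ^ N) := by
        have h1 := pow_le_exp_mul_factorial N
        rw [hd, div_pow, div_mul_div_comm, div_le_div_iff₀ (by positivity) (by positivity)]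
        have h6 : (6 : ℝ) ^ N = 3 ^ N * 2 ^ N := by rw [← mul_pow]; norm_num
        calc r ^ N * (((N : ℝ) + 1) ^ N * 2 ^ N)
            ≤ r ^ N * ((3 ^ (N + 1) * N.factorial) * 2 ^ N) := by gcongr
          _ = _ := by rw [h6]; ring
      calc _ ≤ (T + r) ^ N / (r ^ N / (3 * 6 ^ N)) := by
            have : 0 < T + r := by linarith
            exact div_le_div₀ (by positivity) hnum (by positivity) (hden2.trans hden)
        _ = 3 * (6 * (T + r) / r) ^ N := by
            rw [div_pow, mul_pow]; field_simp
    calc _ ≤ ∑ _j ∈ S, η * (3 * (6 * (T + r) / r) ^ N) := Finset.sum_le_sum hterm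
      _ = _ := by rw [Finset.sum_const, hS, Finset.card_range]; simp; ring
  set g : ℂ → ℂ := fun w => f w - p.eval w with hg
  have hgd : DifferentiableOn ℂ g (Metric.ball (u : ℂ) ρ) :=
    hf.sub p.differentiable.differentiableOn
  have hball : ∀ w : ℂ, ‖w - u‖ ≤ R → w ∈ Metric.ball (u : ℂ) ρ := fun w hw => by
    rw [Metric.mem_ball, dist_eq_norm]; linarith
  -- The interpolation error vanishes at all nodes, so it is the node polynomial times a holomorphic
  -- `Q`. The maximum principle bounds `Q` from the circle of radius R, where the node polynomial is
  -- at least (R − r)^(N+1); near `u` it is at most (2r)^(N+1), and this ratio is the gain.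
  obtain ⟨Q, hQd, hQ⟩ := exists_eq_prod_mul Metric.isOpen_ball (S.image v) g hgd (by
    intro a ha
    obtain ⟨i, hi, rfl⟩ := Finset.mem_image.1 ha
    refine ⟨hball _ (by linarith [hvr i hi]), ?_⟩
    simp only [hg, hp]
    rw [Lagrange.eval_interpolate_at_node _ hinj hi, sub_self])
  have hprod : ∀ w : ℂ, ∏ a ∈ S.image v, (w - a) = ∏ i ∈ S, (w - v i) := fun w =>
    Finset.prod_image hinj
  have hR0 : 0 < R - r := by linarith
  set B : ℝ := (C + 3 * (N + 1) * η * (6 * (R + r) / r) ^ N) / (R - r) ^ (N + 1) with hB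
  have hQb : ∀ w ∈ closure (Metric.ball (u : ℂ) R), ‖Q w‖ ≤ B := by
    intro w hw
    refine Complex.norm_le_of_forall_mem_frontier_norm_le Metric.isBounded_ball ?_ ?_ hw
    · refine DifferentiableOn.diffContOnCl ?_
      rw [closure_ball _ (by linarith : R ≠ 0)]
      exact hQd.mono fun y hy => hball y (by rwa [Metric.mem_closedBall, dist_eq_norm] at hy)
    · intro y hy
      rw [frontier_ball _ (by linarith : R ≠ 0), mem_sphere_iff_norm] at hy
      have hgy : ‖g y‖ ≤ C + 3 * (N + 1) * η * (6 * (R + r) / r) ^ N :=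
        (norm_sub_le _ _).trans (add_le_add (hfC y (hball y hy.le))
          (hpb R y (by linarith) hy.le))
      have hlow : (R - r) ^ (N + 1) ≤ ∏ i ∈ S, ‖y - v i‖ := by
        calc (R - r) ^ (N + 1) = ∏ _i ∈ S, (R - r) := by
              rw [Finset.prod_const, hS, Finset.card_range]
          _ ≤ _ := by
              refine Finset.prod_le_prod (fun _ _ => hR0.le) fun i hi => ?_
              have h1 : ‖y - u‖ ≤ ‖y - v i‖ + ‖v i - u‖ := by
                have : y - u = (y - v i) + (v i - u) := by ring
                rw [this]; exact norm_add_le _ _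
              linarith [hvr i hi]
      rw [hQ, hprod, norm_mul, norm_prod] at hgy
      rw [hB, le_div_iff₀ (by positivity), mul_comm]
      exact (mul_le_mul_of_nonneg_right hlow (norm_nonneg _)).trans hgy
  have hB0 : 0 ≤ B := by
    rw [hB]
    have : 0 ≤ R + r := by linarith
    positivity
  have hzQ : ‖g z‖ ≤ (2 * r) ^ (N + 1) * B := by
    rw [hQ, hprod, norm_mul, norm_prod]
    refine mul_le_mul ?_ (hQb z ?_) (norm_nonneg _) (by positivity)
    · calc ∏ i ∈ S, ‖z - v i‖ ≤ ∏ _i ∈ S, (2 * r) := by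
            refine Finset.prod_le_prod (fun i _ => norm_nonneg _) fun i hi => ?_
            calc ‖z - v i‖ = ‖(z - u) - (v i - u)‖ := by congr 1; ring
              _ ≤ ‖z - u‖ + ‖v i - u‖ := norm_sub_le _ _
              _ ≤ 2 * r := by linarith [hvr i hi]
        _ = _ := by rw [Finset.prod_const, hS, Finset.card_range]
    · rw [closure_ball _ (by linarith : R ≠ 0), Metric.mem_closedBall, dist_eq_norm]; linarith
  have h2N : (N : ℝ) + 1 ≤ 2 ^ N := by exact_mod_cast Nat.lt_two_pow_self
  have hsplit : f z = p.eval z + g z := by simp [hg]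
  have hp1 := hpb r z le_rfl hz
  have e1 : 6 * (r + r) / r = 12 := by field_simp; norm_num
  rw [e1] at hp1
  have hq : 2 * r / (R - r) ≤ 1 := by rw [div_le_one hR0]; linarith
  -- The part of `B` due to the data grows like (12 (R + r)/(R − r))^N, at most 24^N since R ≥ 3r.
  -- The factor N + 1 ≤ 2^N then turns 24 into 48.
  have e2 : (2 * r) ^ (N + 1) * B = C * (2 * r / (R - r)) ^ (N + 1)
      + 3 * (N + 1) * η * ((2 * r / (R - r)) * (12 * (R + r) / (R - r)) ^ N) := by
    rw [hB]; simp only [div_pow, mul_pow, pow_succ]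
    have : (12 : ℝ) ^ N = 2 ^ N * 6 ^ N := by rw [← mul_pow]; norm_num
    rw [this]; field_simp
  have e3 : 12 * (R + r) / (R - r) ≤ 24 := by rw [div_le_iff₀ hR0]; linarith
  have e4 : (2 * r / (R - r)) * (12 * (R + r) / (R - r)) ^ N ≤ 24 ^ N := by
    have h0 : 0 ≤ 12 * (R + r) / (R - r) := by
      have : 0 ≤ R + r := by linarith
      positivity
    calc _ ≤ 1 * (24 : ℝ) ^ N := by gcongr
      _ = _ := one_mul _
  have e5 : (12 : ℝ) ^ N ≤ 24 ^ N := by gcongr; norm_num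
  calc ‖f z‖ ≤ ‖p.eval z‖ + ‖g z‖ := by rw [hsplit]; exact norm_add_le _ _
    _ ≤ 3 * (N + 1) * η * 12 ^ N + (2 * r) ^ (N + 1) * B := add_le_add hp1 hzQ
    _ ≤ 3 * (N + 1) * η * 24 ^ N + (C * (2 * r / (R - r)) ^ (N + 1)
          + 3 * (N + 1) * η * 24 ^ N) := by rw [e2]; gcongr
    _ = 6 * η * ((N + 1) * 24 ^ N) + C * (2 * r / (R - r)) ^ (N + 1) := by ring
    _ ≤ 6 * η * (2 ^ N * 24 ^ N) + C * (2 * r / (R - r)) ^ (N + 1) := by gcongr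
    _ = _ := by rw [← mul_pow]; norm_num

/-- Pointwise smallness of order `ε ^ 2` on a real interval, for a bounded family of holomorphic
functions, forces locally uniform smallness of order `ε ^ (3/2)` in the complex plane. -/
lemma exists_uniform_bound_of_pointwise {E : ℝ → ℂ → ℂ} {u ρ ε₀ C : ℝ} (hρ : 0 < ρ) (hε₀ : 0 < ε₀)
    (hC : 0 ≤ C) (hE : ∀ ε ∈ Ioo 0 ε₀, DifferentiableOn ℂ (E ε) (Metric.ball (u : ℂ) ρ))
    (hEC : ∀ ε ∈ Ioo 0 ε₀, ∀ z ∈ Metric.ball (u : ℂ) ρ, ‖E ε z‖ ≤ C)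
    (hpt : ∀ x : ℝ, |x - u| < ρ → ∃ M : ℝ, ∃ ε₁ > 0, ∀ ε ∈ Ioo 0 ε₁, ‖E ε x‖ ≤ M * ε ^ 2) :
    ∃ r > 0, ∃ C' ≥ 0, ∃ ε₁ > 0, ∀ ε ∈ Ioo 0 ε₁, ∀ z ∈ Metric.closedBall (u : ℂ) r,
      ‖E ε z‖ ≤ C' * (ε * √ε) := by
  set R : ℝ := ρ / 2 with hR
  -- The ratio is tuned to the factor 48^N of the Remez bound: when 48^N is about ε^(-1/2), q^(N+1)
  -- is at most ε^(3/2).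
  set q : ℝ := (48 ^ 3)⁻¹ with hq
  set r : ℝ := R * q / 4 with hr
  have hq0 : 0 < q := by positivity
  have hq1 : q ≤ 1 := by rw [hq]; norm_num
  have hR0 : 0 < R := by positivity
  have hr0 : 0 < r := by positivity
  have hrR : 4 * r ≤ R := by rw [hr]; nlinarith
  have hrq : 2 * r / (R - r) ≤ q := by
    rw [div_le_iff₀ (by linarith)]
    have : 4 * r = R * q := by rw [hr]; ring
    nlinarith
  -- The points where the pointwise bound already holds with constant `n` for all ε below 1/(n + 1).
  -- These closed sets increase to the whole interval.
  set K : ℕ → Set ℝ := fun n => Icc (u - r) (u + r) ∩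
    ⋂ ε ∈ Ioo (0 : ℝ) (min ε₀ (1 / (n + 1))), {x : ℝ | x ∈ Icc (u - r) (u + r) → ‖E ε x‖ ≤ n * ε ^ 2}
    with hK
  -- The extra index 0 contributes the interval itself; every other member is cut out of the
  -- interval by a function continuous there, hence closed.
  have hKeq : ∀ n, K n = ⋂ ε ∈ Ioo (0 : ℝ) (min ε₀ (1 / ((n : ℝ) + 1))) ∪ {0},
      Icc (u - r) (u + r) ∩ {x : ℝ | ε ≠ 0 → ‖E ε x‖ ≤ n * ε ^ 2} := by
    intro n
    ext x
    simp only [hK, mem_inter_iff, mem_iInter, mem_ofPred_eq, mem_union, mem_singleton_iff]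
    constructor
    · rintro ⟨h1, h2⟩ ε hε
      refine ⟨h1, fun hne => ?_⟩
      rcases hε with hε | hε
      · exact h2 ε hε h1
      · exact absurd hε hne
    · intro h
      have h1 := (h 0 (Or.inr rfl)).1
      exact ⟨h1, fun ε hε _ => (h ε (Or.inl hε)).2 hε.1.ne'⟩
  have hmemball : ∀ x ∈ Icc (u - r) (u + r), (x : ℂ) ∈ Metric.ball (u : ℂ) ρ := by
    intro x hx
    rw [Metric.mem_ball, Complex.dist_eq, ← Complex.ofReal_sub, Complex.norm_real,
      Real.norm_eq_abs, abs_lt]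
    constructor <;> linarith [hx.1, hx.2]
  have hKclosed : ∀ n, IsClosed (K n) := by
    intro n
    rw [hKeq]
    refine isClosed_biInter fun ε hε => ?_
    by_cases h0 : ε = 0
    · simp [h0, isClosed_Icc]
    · have hε' : ε ∈ Ioo (0 : ℝ) ε₀ := by
        rcases hε with hε | hε
        · exact ⟨hε.1, hε.2.trans_le (min_le_left _ _)⟩
        · exact absurd hε h0
      have hcont : ContinuousOn (fun x : ℝ => ‖E ε x‖) (Icc (u - r) (u + r)) :=
        ((hE ε hε').continuousOn.comp Complex.continuous_ofReal.continuousOn hmemball).norm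
      have := hcont.preimage_isClosed_of_isClosed isClosed_Icc (isClosed_Iic (a := n * ε ^ 2))
      simpa [h0, preimage, Iic] using this
  have hKmono : Monotone K := by
    intro m n hmn x hx
    have hmn' : (m : ℝ) ≤ n := by exact_mod_cast hmn
    simp only [hK, mem_inter_iff, mem_iInter, mem_ofPred_eq] at hx ⊢
    refine ⟨hx.1, fun ε hε h => (hx.2 ε ⟨hε.1, hε.2.trans_le ?_⟩ h).trans (by gcongr)⟩
    exact min_le_min le_rfl (one_div_le_one_div_of_le (by positivity) (by linarith))
  have hKunion : ⋃ n, K n = Icc (u - r) (u + r) := by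
    ext x
    constructor
    · intro hx
      obtain ⟨n, hn⟩ := mem_iUnion.1 hx
      exact hn.1
    · intro hx
      obtain ⟨M, ε₁, hε₁, hM⟩ := hpt x (by
        rw [abs_lt]; constructor <;> linarith [hx.1, hx.2])
      obtain ⟨n, hn⟩ := exists_nat_ge (max M (1 / ε₁))
      refine mem_iUnion.2 ⟨n, hx, ?_⟩
      simp only [mem_iInter, mem_ofPred_eq]
      intro ε hε _
      have h1 : ε < ε₁ := by
        refine hε.2.trans_le ((min_le_right _ _).trans ?_)
        rw [div_le_iff₀ (by positivity)]
        have := (le_max_right _ _).trans hn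
        rw [div_le_iff₀ hε₁] at this
        nlinarith
      refine (hM ε ⟨hε.1, h1⟩).trans ?_
      have := (le_max_left M (1 / ε₁)).trans hn
      gcongr
  -- Continuity from below: some `K n` has measure above r, half the length of the interval, as the
  -- Remez bound requires.
  have htend := tendsto_measure_iUnion_atTop (μ := volume) hKmono
  rw [hKunion, Real.volume_Icc] at htend
  have hlt : ENNReal.ofReal r < ENNReal.ofReal (u + r - (u - r)) :=
    (ENNReal.ofReal_lt_ofReal_iff (by linarith)).2 (by linarith)
  obtain ⟨n, hn⟩ := (htend.eventually (lt_mem_nhds hlt)).exists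
  refine ⟨r, hr0, 6 * n + C, by positivity, min (min ε₀ (1 / (n + 1))) 1, by positivity, ?_⟩
  intro ε hε z hz
  have hεa : ε ∈ Ioo (0 : ℝ) (min ε₀ (1 / (n + 1))) := ⟨hε.1, hε.2.trans_le (min_le_left _ _)⟩
  have hε0 : ε ∈ Ioo (0 : ℝ) ε₀ := ⟨hε.1, hεa.2.trans_le (min_le_left _ _)⟩
  have hε1 : ε < 1 := hε.2.trans_le (min_le_right _ _)
  have hs0 : 0 < √ε := Real.sqrt_pos.2 hε.1
  have hss : √ε * √ε = ε := Real.mul_self_sqrt hε.1.le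
  have hs1 : √ε ≤ 1 := Real.sqrt_le_one.2 hε1.le
  -- The integer with 48^N ≤ ε^(-1/2) < 48^(N+1) balances the two terms of the Remez bound.
  obtain ⟨N, hN1, hN2⟩ := exists_nat_pow_near (x := 1 / √ε) (y := (48 : ℝ))
    (by rw [le_div_iff₀ hs0]; linarith) (by norm_num)
  rw [le_div_iff₀ hs0] at hN1
  rw [div_lt_iff₀ hs0] at hN2
  have hmain := norm_le_of_small_on_large_set (η := n * ε ^ 2) (K := K n) hr0
    (by linarith : 3 * r ≤ R) (by linarith : R < ρ) hC (by positivity)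
    (hE ε hε0) (hEC ε hε0) (hKclosed n) inter_subset_left hn (fun x hx => by
      have := hx.2
      simp only [mem_iInter, mem_ofPred_eq] at this
      exact this ε hεa hx.1) N (z := z) (by rwa [Metric.mem_closedBall, dist_eq_norm] at hz)
  have h1 : (ε ^ 2 : ℝ) * 48 ^ N ≤ ε * √ε := by
    have : (ε ^ 2 : ℝ) * 48 ^ N = (ε * √ε) * (48 ^ N * √ε) := by
      calc (ε ^ 2 : ℝ) * 48 ^ N = ε * ε * 48 ^ N := by ring
        _ = ε * (√ε * √ε) * 48 ^ N := by rw [hss]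
        _ = _ := by ring
    rw [this]
    have := hε.1.le
    exact mul_le_of_le_one_right (by positivity) hN1
  have h2 : (2 * r / (R - r)) ^ (N + 1) ≤ ε * √ε := by
    have h3 : q ^ (N + 1) = ((48 ^ (N + 1))⁻¹ : ℝ) ^ 3 := by
      rw [hq, inv_pow, inv_pow, ← pow_mul, ← pow_mul, mul_comm]
    have h4 : ((48 ^ (N + 1))⁻¹ : ℝ) ≤ √ε := by
      rw [inv_le_iff_one_le_mul₀ (by positivity)]
      linarith
    have h5 : 0 ≤ 2 * r / (R - r) := div_nonneg (by linarith) (by linarith)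
    calc _ ≤ q ^ (N + 1) := by gcongr
      _ ≤ √ε ^ 3 := by rw [h3]; gcongr
      _ = _ := by rw [← hss]; simp [pow_succ]
  calc ‖E ε z‖ ≤ 6 * (n * ε ^ 2) * 48 ^ N + C * (2 * r / (R - r)) ^ (N + 1) := hmain
    _ = 6 * n * (ε ^ 2 * 48 ^ N) + C * (2 * r / (R - r)) ^ (N + 1) := by ring
    _ ≤ 6 * n * (ε * √ε) + C * (ε * √ε) := by gcongr
    _ = _ := by ring

/-! ### Holomorphic functions that are real on the real axis. -/

lemma ofReal_mem_ball {x u ρ : ℝ} : (x : ℂ) ∈ Metric.ball (u : ℂ) ρ ↔ |x - u| < ρ := by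
  rw [Metric.mem_ball, Complex.dist_eq, ← Complex.ofReal_sub, Complex.norm_real, Real.norm_eq_abs]

lemma eventually_abs_sub_lt {x u ρ : ℝ} (hx : |x - u| < ρ) : ∀ᶠ y in 𝓝 x, |y - u| < ρ :=
  (continuous_abs.comp (continuous_sub_right u)).continuousAt.eventually_lt_const hx

lemma deriv_ofReal_of_real {F : ℂ → ℂ} {g : ℝ → ℝ} {u ρ : ℝ}
    (hF : DifferentiableOn ℂ F (Metric.ball (u : ℂ) ρ))
    (hg : ∀ x : ℝ, |x - u| < ρ → F x = g x) {x : ℝ} (hx : |x - u| < ρ) :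
    DifferentiableAt ℝ g x ∧ deriv F x = (deriv g x : ℝ) := by
  have hd : HasDerivAt F (deriv F x) x :=
    (hF.differentiableAt (Metric.isOpen_ball.mem_nhds (ofReal_mem_ball.2 hx))).hasDerivAt
  have hev : (fun y : ℝ => (g y : ℂ)) =ᶠ[𝓝 x] fun y : ℝ => F y := by
    filter_upwards [eventually_abs_sub_lt hx] with y hy
    exact (hg y hy).symm
  have h1 : HasDerivAt g (deriv F x).re x := by
    refine hd.real_of_complex.congr_of_eventuallyEq ?_
    filter_upwards [hev] with y hy
    rw [← hy, Complex.ofReal_re]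
  have h2 : HasDerivAt (fun y : ℝ => (g y : ℂ)) (deriv F x) x :=
    hd.comp_ofReal.congr_of_eventuallyEq hev
  refine ⟨h1.differentiableAt, ?_⟩
  rw [h1.deriv]
  exact h2.unique h1.ofReal_comp

lemma iteratedDeriv_ofReal_of_real {u ρ : ℝ} (n : ℕ) :
    ∀ (F : ℂ → ℂ) (g : ℝ → ℝ), DifferentiableOn ℂ F (Metric.ball (u : ℂ) ρ) →
      (∀ x : ℝ, |x - u| < ρ → F x = g x) → ∀ x : ℝ, |x - u| < ρ →
      iteratedDeriv n F x = (iteratedDeriv n g x : ℝ) := by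
  induction n with
  | zero => intro F g _ hg x hx; simpa using hg x hx
  | succ n ih =>
    intro F g hF hg x hx
    rw [iteratedDeriv_succ', iteratedDeriv_succ']
    exact ih _ _ (hF.deriv Metric.isOpen_ball) (fun y hy => (deriv_ofReal_of_real hF hg hy).2) x hx

/-- Cauchy's estimate on radius ρ/2 bounds the n-th Taylor term by C (2‖z‖/ρ)^n. For ‖z‖ ≤ ρ/4 the
ratio is at most 1/2, whence the factor 2 for the tail. -/
lemma norm_sub_taylor_le {F : ℂ → ℂ} {c : ℂ} {ρ C : ℝ} (hρ : 0 < ρ)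
    (hF : DifferentiableOn ℂ F (Metric.ball c ρ)) (hC : ∀ z ∈ Metric.ball c ρ, ‖F z‖ ≤ C)
    (N : ℕ) {z : ℂ} (hz : ‖z‖ ≤ ρ / 4) :
    ‖F (c + z) - ∑ n ∈ Finset.range N, iteratedDeriv n F c / n.factorial * z ^ n‖
      ≤ 2 * C * (2 / ρ) ^ N * ‖z‖ ^ N := by
  have hC0 : 0 ≤ C := (norm_nonneg _).trans (hC c (Metric.mem_ball_self hρ))
  have hmem : c + z ∈ Metric.ball c ρ := by
    rw [Metric.mem_ball, dist_eq_norm]; simp; linarith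
  have hsum : HasSum (fun n : ℕ => iteratedDeriv n F c / n.factorial * z ^ n) (F (c + z)) := by
    have := Complex.hasSum_taylorSeries_on_ball hF hmem
    simp only [add_sub_cancel_left, smul_eq_mul] at this
    refine this.congr_fun fun n => ?_
    rw [div_eq_mul_inv]; ring
  have hcauchy : ∀ n, ‖iteratedDeriv n F c‖ ≤ n.factorial * C / (ρ / 2) ^ n := fun n => by
    have hsub : Metric.closedBall c (ρ / 2) ⊆ Metric.ball c ρ :=
      Metric.closedBall_subset_ball (by linarith)
    refine Complex.norm_iteratedDeriv_le_of_forall_mem_sphere_norm_le n (by positivity) ?_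
      fun w hw => hC w (hsub (Metric.sphere_subset_closedBall hw))
    refine DifferentiableOn.diffContOnCl ?_
    rw [closure_ball _ (by positivity)]
    exact hF.mono hsub
  set t : ℝ := 2 * ‖z‖ / ρ with ht
  have ht0 : 0 ≤ t := by positivity
  have ht1 : t ≤ 1 / 2 := by rw [ht, div_le_iff₀ hρ]; linarith
  have hterm : ∀ n, ‖iteratedDeriv n F c / n.factorial * z ^ n‖ ≤ C * t ^ n := fun n => by
    rw [norm_mul, norm_div, norm_pow, Complex.norm_natCast]
    have hf : (0 : ℝ) < n.factorial := by positivity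
    calc _ ≤ (n.factorial * C / (ρ / 2) ^ n) / n.factorial * ‖z‖ ^ n := by
          gcongr; exact hcauchy n
      _ = C * t ^ n := by rw [ht, div_pow, div_pow, mul_pow]; field_simp
  have hgeo : HasSum (fun n => C * t ^ (n + N)) (C * t ^ N * (1 - t)⁻¹) := by
    refine ((hasSum_geometric_of_lt_one ht0 (by linarith)).mul_left (C * t ^ N)).congr_fun
      fun n => ?_
    ring
  refine (((hasSum_nat_add_iff' N).2 hsum).norm_le_of_bounded hgeo fun n => hterm (n + N)).trans ?_
  have hinv : (1 - t)⁻¹ ≤ 2 := by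
    rw [inv_le_comm₀ (by linarith) (by norm_num)]; linarith
  calc C * t ^ N * (1 - t)⁻¹ ≤ C * t ^ N * 2 := by gcongr
    _ = _ := by rw [ht, div_pow, div_pow, mul_pow]; ring

/-- Real points accumulate at the centre, so the identity theorem applies. It serves to identify
limits taken along different sequences of ε. -/
lemma eqOn_ball_of_eq_real {F G : ℂ → ℂ} {u ρ : ℝ} (hρ : 0 < ρ)
    (hF : DifferentiableOn ℂ F (Metric.ball (u : ℂ) ρ))
    (hG : DifferentiableOn ℂ G (Metric.ball (u : ℂ) ρ))
    (h : ∀ x : ℝ, |x - u| < ρ → F x = G x) : EqOn F G (Metric.ball (u : ℂ) ρ) := by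
  refine (hF.analyticOnNhd Metric.isOpen_ball).eqOn_of_preconnected_of_frequently_eq
    (hG.analyticOnNhd Metric.isOpen_ball) (convex_ball _ _).isPreconnected
    (Metric.mem_ball_self hρ) ?_
  have ht : Tendsto (fun x : ℝ => (x : ℂ)) (𝓝[≠] u) (𝓝[≠] (u : ℂ)) := by
    refine tendsto_nhdsWithin_iff.2 ⟨Complex.continuous_ofReal.continuousAt.mono_left
      nhdsWithin_le_nhds, ?_⟩
    filter_upwards [self_mem_nhdsWithin] with x hx
    simpa using hx
  have hev : ∀ᶠ x : ℝ in 𝓝[≠] u, F x = G x := by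
    filter_upwards [nhdsWithin_le_nhds (eventually_abs_sub_lt (x := u) (u := u) (by simpa))]
      with x hx using h x hx
  exact ht.frequently hev.frequently

/-! ### From pointwise real expansions to uniform complex ones. -/

/-- A family of holomorphic functions that is Cauchy along `ε, ε/2, ε/4, …` at rate `ε` and
converges on the real axis converges at rate `ε` to a holomorphic function. -/
lemma exists_limit_of_dyadic {G : ℝ → ℂ → ℂ} {g : ℝ → ℝ} {u ρ ε₀ B : ℝ} (hρ : 0 < ρ)
    (hε₀ : 0 < ε₀) (hG : ∀ ε ∈ Ioo 0 ε₀, DifferentiableOn ℂ (G ε) (Metric.ball (u : ℂ) ρ))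
    (hB : ∀ ε ∈ Ioo 0 ε₀, ∀ z ∈ Metric.ball (u : ℂ) ρ, ‖G ε z - G (ε / 2) z‖ ≤ B * ε)
    (hlim : ∀ x : ℝ, |x - u| < ρ → Tendsto (fun ε => G ε x) (𝓝[>] 0) (𝓝 (g x : ℂ))) :
    ∃ F : ℂ → ℂ, DifferentiableOn ℂ F (Metric.ball (u : ℂ) ρ) ∧
      (∀ x : ℝ, |x - u| < ρ → F x = g x) ∧
      ∀ ε ∈ Ioo 0 ε₀, ∀ z ∈ Metric.ball (u : ℂ) ρ, ‖G ε z - F z‖ ≤ 2 * B * ε := by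
  have hpow : ∀ ε ∈ Ioo (0 : ℝ) ε₀, ∀ n : ℕ, ε / 2 ^ n ∈ Ioo (0 : ℝ) ε₀ := fun ε hε n =>
    ⟨div_pos hε.1 (by positivity),
      (div_le_self hε.1.le (one_le_pow₀ (by norm_num))).trans_lt hε.2⟩
  have hstep : ∀ ε ∈ Ioo (0 : ℝ) ε₀, ∀ z ∈ Metric.ball (u : ℂ) ρ, ∀ n : ℕ,
      dist (G (ε / 2 ^ n) z) (G (ε / 2 ^ (n + 1)) z) ≤ 2 * B * ε / 2 / 2 ^ n := by
    intro ε hε z hz n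
    have := hB _ (hpow ε hε n) z hz
    rw [dist_eq_norm, pow_succ, ← div_div]
    refine this.trans (le_of_eq ?_)
    field_simp
  have hseq : ∀ ε ∈ Ioo (0 : ℝ) ε₀, ∃ F : ℂ → ℂ, DifferentiableOn ℂ F (Metric.ball (u : ℂ) ρ) ∧
      (∀ x : ℝ, |x - u| < ρ → F x = g x) ∧
      ∀ z ∈ Metric.ball (u : ℂ) ρ, ‖G ε z - F z‖ ≤ 2 * B * ε := by
    intro ε hε
    have hex : ∀ z : ℂ, ∃ a, z ∈ Metric.ball (u : ℂ) ρ →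
        Tendsto (fun n : ℕ => G (ε / 2 ^ n) z) atTop (𝓝 a) := fun z => by
      by_cases hz : z ∈ Metric.ball (u : ℂ) ρ
      · obtain ⟨a, ha⟩ := cauchySeq_tendsto_of_complete
          (cauchySeq_of_le_geometric_two (hstep ε hε z hz))
        exact ⟨a, fun _ => ha⟩
      · exact ⟨0, fun h => absurd h hz⟩
    choose F hF using hex
    have hdist : ∀ z ∈ Metric.ball (u : ℂ) ρ, ∀ n : ℕ,
        dist (G (ε / 2 ^ n) z) (F z) ≤ 2 * B * ε / 2 ^ n := fun z hz n =>
      dist_le_of_le_geometric_two_of_tendsto (hstep ε hε z hz) (hF z hz) n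
    refine ⟨F, ?_, ?_, ?_⟩
    · have hu : TendstoUniformlyOn (fun n : ℕ => G (ε / 2 ^ n)) F atTop
          (Metric.ball (u : ℂ) ρ) := by
        rw [Metric.tendstoUniformlyOn_iff]
        intro η hη
        have : Tendsto (fun n : ℕ => 2 * B * ε / 2 ^ n) atTop (𝓝 0) :=
          tendsto_const_nhds.div_atTop (tendsto_pow_atTop_atTop_of_one_lt (by norm_num))
        filter_upwards [this.eventually_lt_const hη] with n hn z hz
        rw [dist_comm]
        exact (hdist z hz n).trans_lt hn
      exact hu.tendstoLocallyUniformlyOn.differentiableOn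
        (Eventually.of_forall fun n => hG _ (hpow ε hε n)) Metric.isOpen_ball
    · intro x hx
      have h0 : Tendsto (fun n : ℕ => ε / 2 ^ n) atTop (𝓝[>] 0) := by
        refine tendsto_nhdsWithin_iff.2 ⟨tendsto_const_nhds.div_atTop
          (tendsto_pow_atTop_atTop_of_one_lt (by norm_num)), ?_⟩
        exact Eventually.of_forall fun n => (hpow ε hε n).1
      exact tendsto_nhds_unique (hF x (ofReal_mem_ball.2 hx)) ((hlim x hx).comp h0)
    · intro z hz
      simpa [dist_eq_norm] using hdist z hz 0
  obtain ⟨F, hF1, hF2, -⟩ := hseq (ε₀ / 2) ⟨by positivity, by linarith⟩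
  refine ⟨F, hF1, hF2, fun ε hε z hz => ?_⟩
  -- The limit along ε/2^n might depend on ε, but each such limit equals `g` on the real axis, so
  -- all are the same holomorphic function.
  obtain ⟨F', h1, h2, h3⟩ := hseq ε hε
  have : F z = F' z := eqOn_ball_of_eq_real hρ hF1 h1
    (fun x hx => (hF2 x hx).trans (h2 x hx).symm) hz
  rw [this]
  exact h3 z hz

/-- If `a (2 ε) - 2 a ε = O(ε ^ (3/2))` and `a` is bounded, then `a ε = O(ε)`. -/
lemma linear_bound_of_dyadic {a : ℝ → ℂ} {δ C A : ℝ} (hδ : 0 < δ) (hA : 0 ≤ A)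
    (hC : ∀ ε ∈ Ioo 0 δ, ‖a ε‖ ≤ C)
    (ha : ∀ ε ∈ Ioo 0 δ, ‖a ε - 2 * a (ε / 2)‖ ≤ A * (ε * √ε)) :
    ∀ ε ∈ Ioo 0 δ, ‖a ε‖ ≤ (2 * C / δ + 4 * A * √δ) * ε := by
  have hC0 : 0 ≤ C := (norm_nonneg _).trans (hC (δ / 2) ⟨by positivity, by linarith⟩)
  set B : ℝ := 2 * C / δ + 4 * A * √δ with hB
  have hbase : ∀ ε ∈ Ioo 0 δ, δ ≤ 2 * ε → ‖a ε‖ ≤ ε * (B - 4 * A * √ε) := by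
    intro ε hε h
    have h1 : √ε ≤ √δ := Real.sqrt_le_sqrt hε.2.le
    have h2 : 2 * C / δ ≤ B - 4 * A * √ε := by rw [hB]; nlinarith
    calc ‖a ε‖ ≤ C := hC ε hε
      _ = (δ / 2) * (2 * C / δ) := by field_simp
      _ ≤ ε * (B - 4 * A * √ε) := by
          have : 0 ≤ 2 * C / δ := by positivity
          have := hε.1
          gcongr
          linarith
  -- The induction carries the stronger bound ε (B − 4A√ε). Its negative term absorbs the error
  -- added at each halving, because 3√2 ≥ 4.
  have hind : ∀ n : ℕ, ∀ ε ∈ Ioo 0 δ, δ ≤ 2 ^ (n + 1) * ε → ‖a ε‖ ≤ ε * (B - 4 * A * √ε) := by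
    intro n
    induction n with
    | zero => intro ε hε h; exact hbase ε hε (by simpa using h)
    | succ n ih =>
      intro ε hε h
      rcases le_or_gt δ (2 * ε) with h2 | h2
      · exact hbase ε hε h2
      · have hε2 : 2 * ε ∈ Ioo 0 δ := ⟨by linarith [hε.1], h2⟩
        have h3 := ih (2 * ε) hε2 (by rw [pow_succ] at h; linarith)
        have h4 := ha (2 * ε) hε2
        have e : 2 * ε / 2 = ε := by ring
        rw [e] at h4
        have h5 : ‖2 * a ε‖ ≤ ‖a (2 * ε)‖ + ‖a (2 * ε) - 2 * a ε‖ := by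
          have : 2 * a ε = a (2 * ε) - (a (2 * ε) - 2 * a ε) := by ring
          conv_lhs => rw [this]
          exact norm_sub_le _ _
        rw [norm_mul] at h5
        simp only [Complex.norm_ofNat] at h5
        have h6 : 4 * √ε ≤ 3 * √(2 * ε) := by
          have : 4 * √ε = √(16 * ε) := by
            rw [Real.sqrt_mul (by norm_num), show (16 : ℝ) = 4 ^ 2 by norm_num,
              Real.sqrt_sq (by norm_num)]
          have h9 : 3 * √(2 * ε) = √(9 * (2 * ε)) := by
            rw [Real.sqrt_mul (by norm_num : (0 : ℝ) ≤ 9), show (9 : ℝ) = 3 ^ 2 by norm_num,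
              Real.sqrt_sq (by norm_num)]
          rw [this, h9]
          exact Real.sqrt_le_sqrt (by linarith [hε.1])
        have h7 : ε * (A * (4 * √ε)) ≤ ε * (A * (3 * √(2 * ε))) := by
          have := hε.1.le
          gcongr
        nlinarith
  intro ε hε
  obtain ⟨n, hn⟩ := pow_unbounded_of_one_lt (δ / ε) (by norm_num : (1 : ℝ) < 2)
  rw [div_lt_iff₀ hε.1] at hn
  have := hind n ε hε (by rw [pow_succ]; nlinarith [hε.1, pow_pos (by norm_num : (0 : ℝ) < 2) n])
  have h8 : 0 ≤ ε * (4 * A * √ε) := by have := hε.1.le; positivity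
  linarith

/-- A pointwise expansion to third order on the real axis upgrades to a uniform second order
expansion with holomorphic coefficients. -/
lemma exists_uniform_expansion {F : ℝ → ℂ → ℂ} {Λ₀ Λ₁ Λ₂ : ℝ → ℝ} {u ρ ε₀ C : ℝ} (hρ : 0 < ρ)
    (hε₀ : 0 < ε₀) (hF : ∀ ε ∈ Ioo 0 ε₀, DifferentiableOn ℂ (F ε) (Metric.ball (u : ℂ) ρ))
    (hC : 0 ≤ C)
    (hFC : ∀ ε ∈ Ioo 0 ε₀, ∀ ε' ∈ Ioo 0 ε₀, ∀ z ∈ Metric.ball (u : ℂ) ρ,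
      ‖F ε z - F ε' z‖ ≤ C * (ε + ε'))
    (hexp : ∀ x : ℝ, |x - u| < ρ → ∃ M : ℝ, ∃ ε₁ > 0, ∀ ε ∈ Ioo 0 ε₁,
      ‖F ε x - (Λ₀ x + Λ₁ x * ε + Λ₂ x * ε ^ 2)‖ ≤ M * ε ^ 3) :
    ∃ r > 0, r ≤ ρ ∧ ∃ F₀ F₁ : ℂ → ℂ, ∃ B ≥ 0, ∃ ε₁ > 0, ε₁ ≤ ε₀ ∧
      DifferentiableOn ℂ F₀ (Metric.ball (u : ℂ) r) ∧
      DifferentiableOn ℂ F₁ (Metric.ball (u : ℂ) r) ∧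
      (∀ x : ℝ, |x - u| < r → F₀ x = Λ₀ x) ∧ (∀ x : ℝ, |x - u| < r → F₁ x = Λ₁ x) ∧
      ∀ ε ∈ Ioo 0 ε₁, ∀ z ∈ Metric.ball (u : ℂ) r, ‖F ε z - F₀ z - ε * F₁ z‖ ≤ B * ε ^ 2 := by
  have hcont : ∀ a b c : ℝ, Tendsto (fun ε : ℝ => ((a + b * ε + c * ε ^ 2 : ℝ) : ℂ)) (𝓝[>] 0)
      (𝓝 (a : ℂ)) := by
    intro a b c
    have : Continuous fun ε : ℝ => ((a + b * ε + c * ε ^ 2 : ℝ) : ℂ) := by fun_prop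
    have h := this.tendsto 0
    simp only [mul_zero, add_zero, ne_eq, OfNat.ofNat_ne_zero, not_false_eq_true, zero_pow] at h
    exact h.mono_left nhdsWithin_le_nhds
  have hhalf : ∀ {a ε : ℝ}, ε ∈ Ioo 0 a → ε / 2 ∈ Ioo 0 a := fun h =>
    ⟨by linarith [h.1], by linarith [h.1, h.2]⟩
  have hev : ∀ {a : ℝ}, 0 < a → ∀ᶠ ε : ℝ in 𝓝[>] 0, ε ∈ Ioo 0 a := fun ha =>
    Ioo_mem_nhdsGT ha
  obtain ⟨F₀, hF₀, hF₀r, hF₀b⟩ := exists_limit_of_dyadic (g := Λ₀) (B := 2 * C) hρ hε₀ hF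
    (fun ε hε z hz => (hFC ε hε _ (hhalf hε) z hz).trans (by nlinarith [hε.1]))
    (fun x hx => by
      obtain ⟨M, ε₁, hε₁, hM⟩ := hexp x hx
      have h1 : Tendsto (fun ε : ℝ => F ε x - ((Λ₀ x + Λ₁ x * ε + Λ₂ x * ε ^ 2 : ℝ) : ℂ)) (𝓝[>] 0)
          (𝓝 0) := by
        refine squeeze_zero_norm' (a := fun ε : ℝ => M * ε ^ 3) ?_ ?_
        · filter_upwards [hev hε₁] with ε hε
          simpa using hM ε hε
        · have : Continuous fun ε : ℝ => M * ε ^ 3 := by fun_prop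
          have h := this.tendsto 0
          simp only [ne_eq, OfNat.ofNat_ne_zero, not_false_eq_true, zero_pow, mul_zero] at h
          exact h.mono_left nhdsWithin_le_nhds
      simpa using h1.add (hcont (Λ₀ x) (Λ₁ x) (Λ₂ x)))
  set G : ℝ → ℂ → ℂ := fun ε z => (F ε z - F₀ z) / ε with hG
  have hGd : ∀ ε ∈ Ioo 0 ε₀, DifferentiableOn ℂ (G ε) (Metric.ball (u : ℂ) ρ) := fun ε hε =>
    ((hF ε hε).sub hF₀).div_const _
  have hGb : ∀ ε ∈ Ioo 0 ε₀, ∀ z ∈ Metric.ball (u : ℂ) ρ, ‖G ε z‖ ≤ 4 * C := by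
    intro ε hε z hz
    rw [hG]
    simp only [norm_div, Complex.norm_real, Real.norm_eq_abs, abs_of_pos hε.1]
    rw [div_le_iff₀ hε.1]
    exact (hF₀b ε hε z hz).trans (by linarith)
  have hGx : ∀ x : ℝ, |x - u| < ρ → ∃ M : ℝ, ∃ ε₁ > 0, ∀ ε ∈ Ioo 0 ε₁,
      ‖G ε x - (Λ₁ x + Λ₂ x * ε)‖ ≤ M * ε ^ 2 := by
    intro x hx
    obtain ⟨M, ε₁, hε₁, hM⟩ := hexp x hx
    refine ⟨M, ε₁, hε₁, fun ε hε => ?_⟩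
    have hne : (ε : ℂ) ≠ 0 := by exact_mod_cast hε.1.ne'
    have e : G ε x - (Λ₁ x + Λ₂ x * ε)
        = (F ε x - (Λ₀ x + Λ₁ x * ε + Λ₂ x * ε ^ 2)) / ε := by
      simp only [hG]; rw [hF₀r x hx]; field_simp; ring
    rw [e, norm_div, Complex.norm_real, Real.norm_eq_abs, abs_of_pos hε.1, div_le_iff₀ hε.1]
    exact (hM ε hε).trans (le_of_eq (by ring))
  -- The weights 1, −3, 2 annihilate constants and, as 1 − 3/2 + 2/4 = 0, also terms linear in ε.
  -- Thus Λ₁ and Λ₂, for which no regularity in x is assumed, drop out.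
  set E : ℝ → ℂ → ℂ := fun ε z => G ε z - 3 * G (ε / 2) z + 2 * G (ε / 2 / 2) z with hE
  obtain ⟨r, hr, A, hA, ε₁, hε₁, hEA⟩ := exists_uniform_bound_of_pointwise (E := E)
    (C := 4 * C + 3 * (4 * C) + 2 * (4 * C)) hρ hε₀ (by positivity)
    (fun ε hε => ((hGd ε hε).sub ((hGd _ (hhalf hε)).const_mul 3)).add
      ((hGd _ (hhalf (hhalf hε))).const_mul 2))
    (fun ε hε z hz => by
      refine (norm_add_le _ _).trans (add_le_add ((norm_sub_le _ _).trans (add_le_add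
        (hGb ε hε z hz) ?_)) ?_)
      · rw [norm_mul]; simpa using hGb _ (hhalf hε) z hz
      · rw [norm_mul]; simpa using hGb _ (hhalf (hhalf hε)) z hz)
    (fun x hx => by
      obtain ⟨M, ε₁, hε₁, hM⟩ := hGx x hx
      refine ⟨M + 3 * (M / 4) + 2 * (M / 16), ε₁, hε₁, fun ε hε => ?_⟩
      have e : E ε x = (G ε x - (Λ₁ x + Λ₂ x * ε))
          - 3 * (G (ε / 2) x - (Λ₁ x + Λ₂ x * (ε / 2 : ℝ)))
          + 2 * (G (ε / 2 / 2) x - (Λ₁ x + Λ₂ x * (ε / 2 / 2 : ℝ))) := by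
        simp only [hE]; push_cast; ring
      have h1 := hM ε hε
      have h2 := hM _ (hhalf hε)
      have h3 := hM _ (hhalf (hhalf hε))
      rw [e]
      calc _ ≤ M * ε ^ 2 + 3 * (M * (ε / 2) ^ 2) + 2 * (M * (ε / 2 / 2) ^ 2) := by
            refine (norm_add_le _ _).trans (add_le_add ((norm_sub_le _ _).trans (add_le_add
              h1 ?_)) ?_)
            · rw [norm_mul]; simpa using h2
            · rw [norm_mul]; simpa using h3
        _ = _ := by ring)
  set δ := min ε₁ ε₀ with hδ
  have hδ0 : 0 < δ := lt_min hε₁ hε₀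
  have hδ1 : ∀ {ε : ℝ}, ε ∈ Ioo 0 δ → ε ∈ Ioo 0 ε₁ := fun h => ⟨h.1, h.2.trans_le (min_le_left _ _)⟩
  have hδ2 : ∀ {ε : ℝ}, ε ∈ Ioo 0 δ → ε ∈ Ioo 0 ε₀ :=
    fun h => ⟨h.1, h.2.trans_le (min_le_right _ _)⟩
  set r' := min r ρ with hr'
  have hr'0 : 0 < r' := lt_min hr hρ
  have hsub : Metric.ball (u : ℂ) r' ⊆ Metric.ball (u : ℂ) ρ :=
    Metric.ball_subset_ball (min_le_right _ _)
  have hsub2 : Metric.ball (u : ℂ) r' ⊆ Metric.closedBall (u : ℂ) r :=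
    (Metric.ball_subset_ball (min_le_left _ _)).trans Metric.ball_subset_closedBall
  -- The constant of `linear_bound_of_dyadic` for a ε = G ε − G (ε/2): this is bounded by 8C, and a
  -- ε − 2 a (ε/2) is exactly `E ε`.
  set B : ℝ := 2 * (8 * C) / δ + 4 * A * √δ with hBdef
  have hB0 : 0 ≤ B := by positivity
  obtain ⟨F₁, hF₁, hF₁r, hF₁b⟩ := exists_limit_of_dyadic (G := G) (g := Λ₁) (B := B) hr'0 hδ0
    (fun ε hε => (hGd ε (hδ2 hε)).mono hsub)
    (fun ε hε z hz => by
      refine linear_bound_of_dyadic (a := fun ε => G ε z - G (ε / 2) z) hδ0 hA ?_ ?_ ε hε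
      · intro ε hε
        refine (norm_sub_le _ _).trans ?_
        linarith [hGb ε (hδ2 hε) z (hsub hz), hGb _ (hhalf (hδ2 hε)) z (hsub hz)]
      · intro ε hε
        have := hEA ε (hδ1 hε) z (hsub2 hz)
        convert this using 2
        simp only [hE]; ring)
    (fun x hx => by
      obtain ⟨M, ε₁, hε₁, hM⟩ := hGx x (hx.trans_le (min_le_right _ _))
      have h1 : Tendsto (fun ε : ℝ => G ε x - ((Λ₁ x + Λ₂ x * ε + 0 * ε ^ 2 : ℝ) : ℂ)) (𝓝[>] 0)
          (𝓝 0) := by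
        refine squeeze_zero_norm' (a := fun ε : ℝ => M * ε ^ 2) ?_ ?_
        · filter_upwards [hev hε₁] with ε hε
          simpa using hM ε hε
        · have : Continuous fun ε : ℝ => M * ε ^ 2 := by fun_prop
          have h := this.tendsto 0
          simp only [ne_eq, OfNat.ofNat_ne_zero, not_false_eq_true, zero_pow, mul_zero] at h
          exact h.mono_left nhdsWithin_le_nhds
      simpa using h1.add (hcont (Λ₁ x) (Λ₂ x) 0))
  refine ⟨r', hr'0, min_le_right _ _, F₀, F₁, 2 * B, by positivity, δ, hδ0, min_le_right _ _,
    hF₀.mono hsub, hF₁, fun x hx => hF₀r x (hx.trans_le (min_le_right _ _)), hF₁r, ?_⟩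
  intro ε hε z hz
  have hne : (ε : ℂ) ≠ 0 := by exact_mod_cast hε.1.ne'
  have e : F ε z - F₀ z - ε * F₁ z = ε * (G ε z - F₁ z) := by simp only [hG]; field_simp
  rw [e, norm_mul, Complex.norm_real, Real.norm_eq_abs, abs_of_pos hε.1]
  calc _ ≤ ε * (2 * B * ε) := by
        have := hε.1.le
        gcongr
        exact hF₁b ε hε z hz
    _ = _ := by ring

/-! ### The complex moment generating function and its local logarithm. -/

lemma mem_dom_iff {Ω : Type*} [MeasurableSpace Ω] {P : Measure Ω} {Y : ℝ → Ω → ℝ} {ε x : ℝ} :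
    x ∈ dom P Y ε ↔ x / ε ∈ integrableExpSet (Y ε) P := Iff.rfl

lemma cmgf_ofReal {Ω : Type*} [MeasurableSpace Ω] (P : Measure Ω) (Y : ℝ → Ω → ℝ) (ε x : ℝ) :
    cmgf P Y ε x = ((∫ ω, Real.exp (x / ε * Y ε ω) ∂P : ℝ) : ℂ) := by
  rw [cmgf, ← integral_complex_ofReal]
  congr 1; ext ω; push_cast; rfl

lemma mgf_pos_of_mem_dom {Ω : Type*} [MeasurableSpace Ω] {P : Measure Ω} [IsProbabilityMeasure P]
    {Y : ℝ → Ω → ℝ} {ε x : ℝ} (hx : x ∈ dom P Y ε) : 0 < ∫ ω, Real.exp (x / ε * Y ε ω) ∂P :=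
  integral_exp_pos hx

lemma norm_cmgf_le {Ω : Type*} [MeasurableSpace Ω] (P : Measure Ω) (Y : ℝ → Ω → ℝ) (ε : ℝ)
    (w : ℂ) : ‖cmgf P Y ε w‖ ≤ ∫ ω, Real.exp (w.re / ε * Y ε ω) ∂P := by
  rw [cmgf]
  refine (norm_integral_le_integral_norm _).trans (le_of_eq ?_)
  congr 1; ext ω
  rw [Complex.norm_exp]
  congr 1
  rw [Complex.re_mul_ofReal, Complex.div_ofReal_re]

lemma hasDerivAt_cmgf {Ω : Type*} [MeasurableSpace Ω] {P : Measure Ω} {Y : ℝ → Ω → ℝ} {ε : ℝ}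
    (hε : 0 < ε) {U : Set ℝ} (hU : IsOpen U) (hUd : U ⊆ dom P Y ε) {w : ℂ} (hw : w.re ∈ U) :
    DifferentiableAt ℂ (cmgf P Y ε) w := by
  have hmem : (w / ε).re ∈ interior (integrableExpSet (Y ε) P) := by
    rw [Complex.div_ofReal_re, mem_interior]
    refine ⟨(fun y => y * ε) ⁻¹' U, fun y hy => ?_, hU.preimage (continuous_mul_const ε), ?_⟩
    · have := mem_dom_iff.1 (hUd hy)
      rwa [mul_div_cancel_right₀ _ hε.ne'] at this
    · simpa [div_mul_cancel₀ _ hε.ne'] using hw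
  have h1 := (hasDerivAt_complexMGF hmem).differentiableAt
  exact DifferentiableAt.fun_comp' (f := fun w : ℂ => w / (ε : ℂ)) w h1
    (differentiableAt_id.div_const _)

/-- A holomorphic logarithm on a ball centred on the real axis that is real on the real axis. -/
lemma exists_log_on_ball {m : ℂ → ℂ} {u ρ : ℝ} (hρ : 0 < ρ)
    (hm : DifferentiableOn ℂ m (Metric.ball (u : ℂ) ρ))
    (h0 : ∀ z ∈ Metric.ball (u : ℂ) ρ, m z ≠ 0) {g : ℝ → ℝ}
    (hg : ∀ x : ℝ, |x - u| < ρ → m x = g x) (hg0 : ∀ x : ℝ, |x - u| < ρ → 0 < g x) :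
    ∃ l : ℂ → ℂ, DifferentiableOn ℂ l (Metric.ball (u : ℂ) ρ) ∧
      (∀ z ∈ Metric.ball (u : ℂ) ρ, Complex.exp (l z) = m z) ∧
      ∀ x : ℝ, |x - u| < ρ → l x = Real.log (g x) := by
  have hball := Metric.isOpen_ball (x := (u : ℂ)) (ε := ρ)
  have hu : |u - u| < ρ := by simpa
  -- A primitive of m'/m on the ball, normalised at the centre by the real logarithm.
  obtain ⟨l, hlu, hl⟩ := (((hm.deriv hball).div hm h0).isExactOn_ball).with_val_at u
    (Real.log (g u) : ℂ)
  have hmd : ∀ z ∈ Metric.ball (u : ℂ) ρ, HasDerivAt m (deriv m z) z := fun z hz =>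
    (hm.differentiableAt (hball.mem_nhds hz)).hasDerivAt
  have hexp : ∀ z ∈ Metric.ball (u : ℂ) ρ, Complex.exp (l z) = m z := by
    intro z hz
    have hq : ∀ w ∈ Metric.ball (u : ℂ) ρ,
        HasDerivAt (fun w => Complex.exp (-l w) * m w) 0 w := by
      intro w hw
      have := ((hl w hw).neg.cexp).mul (hmd w hw)
      refine this.congr_deriv ?_
      simp only [Pi.div_apply, Pi.neg_apply]
      field_simp [h0 w hw]
      ring
    have hconst := hball.is_const_of_deriv_eq_zero (convex_ball _ _).isPreconnected
      (fun w hw => (hq w hw).differentiableAt.differentiableWithinAt)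
      (fun w hw => (hq w hw).deriv) hz (Metric.mem_ball_self hρ)
    have h1 : Complex.exp (-l u) * m u = 1 := by
      rw [hlu, hg u hu, ← Complex.ofReal_neg, ← Complex.ofReal_exp, Real.exp_neg,
        Real.exp_log (hg0 u hu), ← Complex.ofReal_mul, inv_mul_cancel₀ (hg0 u hu).ne',
        Complex.ofReal_one]
    rw [h1, Complex.exp_neg, inv_mul_eq_one₀ (Complex.exp_ne_zero _)] at hconst
    exact hconst
  refine ⟨l, fun z hz => (hl z hz).differentiableAt.differentiableWithinAt, hexp, fun x hx => ?_⟩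
  -- The real part of −I l is the imaginary part of `l`. Its derivative along the real axis vanishes
  -- because m'/m is real there.
  have him : ∀ y : ℝ, |y - u| < ρ → HasDerivAt (fun y : ℝ => (-Complex.I * l y).re) 0 y := by
    intro y hy
    have h1 := ((hl y (ofReal_mem_ball.2 hy)).const_mul (-Complex.I)).real_of_complex
    refine h1.congr_deriv ?_
    rw [Pi.div_apply, (deriv_ofReal_of_real hm hg hy).2, hg y hy, ← Complex.ofReal_div]
    simp
  have hc := (Metric.isOpen_ball (x := u) (ε := ρ)).is_const_of_deriv_eq_zero
      (convex_ball _ _).isPreconnected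
      (fun w hw => (him w (by rwa [Metric.mem_ball, Real.dist_eq] at hw)).differentiableAt.differentiableWithinAt)
      (fun w hw => (him w (by rwa [Metric.mem_ball, Real.dist_eq] at hw)).deriv) (show x ∈ Metric.ball u ρ by rwa [Metric.mem_ball, Real.dist_eq]) (Metric.mem_ball_self hρ)
  have him0 : (l x).im = 0 := by
    simpa [hlu] using hc
  have hre : (l x).re = Real.log (g x) := by
    have h2 := hexp x (ofReal_mem_ball.2 hx)
    rw [hg x hx] at h2
    have h3 := congrArg (fun z => Real.log ‖z‖) h2
    simp only [Complex.norm_exp, Real.log_exp, Complex.norm_real, Real.norm_eq_abs,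
      abs_of_pos (hg0 x hx)] at h3
    exact h3
  exact Complex.ext (by simpa using hre) (by simpa using him0)

/-- Borel–Carathéodory: with t = ‖z − c‖ < ρ/2 the factors t/(ρ − t) and (ρ + t)/(ρ − t) are at most
1 and 3, which gives 2M + 3M. -/
lemma norm_le_of_re_le_ball {f : ℂ → ℂ} {c : ℂ} {ρ M : ℝ} (hρ : 0 < ρ) (hM : 0 < M)
    (hf : DifferentiableOn ℂ f (Metric.ball c ρ)) (hre : ∀ z ∈ Metric.ball c ρ, (f z).re ≤ M)
    (hc : ‖f c‖ ≤ M) : ∀ z ∈ Metric.ball c (ρ / 2), ‖f z‖ ≤ 5 * M := by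
  intro z hz
  rw [Metric.mem_ball, dist_eq_norm] at hz
  have hmaps : MapsTo (fun w => c + w) (Metric.ball 0 ρ) (Metric.ball c ρ) := fun w hw => by
    simpa [Metric.mem_ball, dist_eq_norm] using hw
  have h := Complex.borelCaratheodory (f := fun w => f (c + w)) (z := z - c) hM
    (hf.comp (differentiableOn_id.const_add c) hmaps) (fun w hw => hre _ (hmaps hw)) hρ
    (by rw [mem_ball_zero_iff]; linarith)
  simp only [add_sub_cancel, add_zero] at h
  refine h.trans ?_
  have hd : 0 < ρ - ‖z - c‖ := by linarith
  have hz0 := norm_nonneg (z - c)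
  rw [← add_div, div_le_iff₀ hd]
  have : ‖f c‖ * (ρ + ‖z - c‖) ≤ M * (ρ + ‖z - c‖) := by gcongr
  nlinarith

lemma eventually_prod_nhdsGT {p : ℝ × ℂ → Prop} {w : ℂ} (h : ∀ᶠ q in 𝓝[>] (0 : ℝ) ×ˢ 𝓝 w, p q) :
    ∃ ε₀ > 0, ∃ ρ > 0, ∀ ε ∈ Ioo 0 ε₀, ∀ z ∈ Metric.ball w ρ, p (ε, z) := by
  obtain ⟨pa, ha, pb, hb, hp⟩ := eventually_prod_iff.1 h
  obtain ⟨ε₀, hε₀, h1⟩ := mem_nhdsGT_iff_exists_Ioo_subset.1 ha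
  obtain ⟨ρ, hρ, h2⟩ := Metric.mem_nhds_iff.1 hb
  exact ⟨ε₀, hε₀, ρ, hρ, fun ε hε z hz => hp (h1 hε) (h2 hz)⟩

/-- Local expansion of a holomorphic branch of `ε log E[exp (w Y_ε / ε)]`. -/
structure LocalExpansion {Ω : Type*} [MeasurableSpace Ω] (P : Measure Ω) (Y : ℝ → Ω → ℝ)
    (D : Set ℝ) (Λ₀ Λ₁ : ℝ → ℝ) (u r B ε₁ : ℝ) (F : ℝ → ℂ → ℂ) (F₀ F₁ : ℂ → ℂ) : Prop where
  r_pos : 0 < r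
  B_nonneg : 0 ≤ B
  ε_pos : 0 < ε₁
  sub_dom : ∀ ε ∈ Ioo 0 ε₁, interior D ⊆ dom P Y ε
  mem_int : ∀ z ∈ Metric.ball (u : ℂ) r, z.re ∈ interior D
  diff : ∀ ε ∈ Ioo 0 ε₁, DifferentiableOn ℂ (F ε) (Metric.ball (u : ℂ) r)
  exp_eq : ∀ ε ∈ Ioo 0 ε₁, ∀ z ∈ Metric.ball (u : ℂ) r, Complex.exp (F ε z / ε) = cmgf P Y ε z
  real : ∀ ε ∈ Ioo 0 ε₁, ∀ x : ℝ, |x - u| < r → F ε x = lmgf P Y ε x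
  diff₀ : DifferentiableOn ℂ F₀ (Metric.ball (u : ℂ) r)
  diff₁ : DifferentiableOn ℂ F₁ (Metric.ball (u : ℂ) r)
  real₀ : ∀ x : ℝ, |x - u| < r → F₀ x = Λ₀ x
  real₁ : ∀ x : ℝ, |x - u| < r → F₁ x = Λ₁ x
  bound : ∀ ε ∈ Ioo 0 ε₁, ∀ z ∈ Metric.ball (u : ℂ) r, ‖F ε z - F₀ z - ε * F₁ z‖ ≤ B * ε ^ 2

/-- `F ε` is ε times a holomorphic logarithm, so its real part is `reLmgf`, within O(ε) of `L`.
Differences of two members eliminate `L`, about which no holomorphy is known; Borel–Carathéodory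
bounds them by O(ε + ε'), and `exists_uniform_expansion` concludes. The point 0 is excluded because
the complex hypotheses exclude the imaginary axis. -/
lemma exists_localExpansion {Ω : Type*} [MeasurableSpace Ω] {P : Measure Ω}
    [IsProbabilityMeasure P] {Y : ℝ → Ω → ℝ} {D : Set ℝ} {Λ₀ Λ₁ Λ₂ : ℝ → ℝ}
    (hA : Assumptions P Y D Λ₀ Λ₁ Λ₂) {u : ℝ} (hu : u ∈ interior D) (hu0 : u ≠ 0) :
    ∃ r B ε₁ F F₀ F₁, LocalExpansion P Y D Λ₀ Λ₁ u r B ε₁ F F₀ F₁ := by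
  obtain ⟨L, hL⟩ := hA.tail
  obtain ⟨ε₀, hε₀, hdom, -⟩ := hA.smooth
  obtain ⟨hne, hO⟩ := hL.limit (u : ℂ) (by simpa using ⟨hu, hu0⟩)
  obtain ⟨C, hC, hO⟩ := hO.exists_pos
  obtain ⟨ε₂, hε₂, ρ₂, hρ₂, h2⟩ := eventually_prod_nhdsGT (hne.and hO.bound)
  obtain ⟨ρ₁, hρ₁, hsub⟩ := Metric.isOpen_iff.1 isOpen_interior u hu
  set ρ := min ρ₁ ρ₂ with hρdef
  have hρ : 0 < ρ := lt_min hρ₁ hρ₂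
  set δ := min ε₀ ε₂ with hδdef
  have hδ : 0 < δ := lt_min hε₀ hε₂
  have hδ0 : ∀ {ε : ℝ}, ε ∈ Ioo 0 δ → ε ∈ Ioo 0 ε₀ :=
    fun h => ⟨h.1, h.2.trans_le (min_le_left _ _)⟩
  have hδ2 : ∀ {ε : ℝ}, ε ∈ Ioo 0 δ → ε ∈ Ioo 0 ε₂ :=
    fun h => ⟨h.1, h.2.trans_le (min_le_right _ _)⟩
  have hint : ∀ z ∈ Metric.ball (u : ℂ) ρ, z.re ∈ interior D := by
    intro z hz
    refine hsub ?_
    rw [Metric.mem_ball, Real.dist_eq]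
    rw [Metric.mem_ball, dist_eq_norm] at hz
    have := Complex.abs_re_le_norm (z - u)
    simp only [Complex.sub_re, Complex.ofReal_re] at this
    exact this.trans_lt (hz.trans_le (min_le_left _ _))
  have hnz : ∀ ε ∈ Ioo 0 δ, ∀ z ∈ Metric.ball (u : ℂ) ρ, cmgf P Y ε z ≠ 0 ∧
      |reLmgf P Y ε z - L z| ≤ C * ε := by
    intro ε hε z hz
    have := h2 ε (hδ2 hε) z (Metric.ball_subset_ball (min_le_right _ _) hz)
    simpa [Real.norm_eq_abs, abs_of_pos hε.1] using this
  have hlog : ∀ ε : ℝ, ∃ F : ℂ → ℂ, ε ∈ Ioo 0 δ → DifferentiableOn ℂ F (Metric.ball (u : ℂ) ρ) ∧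
      (∀ z ∈ Metric.ball (u : ℂ) ρ, Complex.exp (F z / ε) = cmgf P Y ε z) ∧
      ∀ x : ℝ, |x - u| < ρ → F x = lmgf P Y ε x := by
    intro ε
    by_cases hε : ε ∈ Ioo 0 δ
    · obtain ⟨l, hl1, hl2, hl3⟩ := exists_log_on_ball (m := cmgf P Y ε) (u := u) hρ
        (fun z hz => (hasDerivAt_cmgf hε.1 isOpen_interior (hdom ε (hδ0 hε))
          (hint z hz)).differentiableWithinAt) (fun z hz => (hnz ε hε z hz).1)
        (g := fun x => ∫ ω, Real.exp (x / ε * Y ε ω) ∂P) (fun x _ => cmgf_ofReal P Y ε x)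
        (fun x hx => mgf_pos_of_mem_dom (hdom ε (hδ0 hε)
          (by simpa using hint x (ofReal_mem_ball.2 hx))))
      have hne : (ε : ℂ) ≠ 0 := by exact_mod_cast hε.1.ne'
      refine ⟨fun z => ε * l z, fun _ => ⟨hl1.const_mul _, fun z hz => ?_, fun x hx => ?_⟩⟩
      · rw [← hl2 z hz]; congr 1; field_simp
      · simp only [hl3 x hx, lmgf]; push_cast; rfl
    · exact ⟨0, fun h => absurd h hε⟩
  choose F hF using hlog
  have hreF : ∀ ε ∈ Ioo 0 δ, ∀ z ∈ Metric.ball (u : ℂ) ρ, (F ε z).re = reLmgf P Y ε z := by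
    intro ε hε z hz
    rw [reLmgf, ← (hF ε hε).2.1 z hz, Complex.norm_exp, Real.log_exp, Complex.div_ofReal_re]
    have := hε.1.ne'
    field_simp
  have hdiffre : ∀ ε ∈ Ioo 0 δ, ∀ ε' ∈ Ioo 0 δ, ∀ z ∈ Metric.ball (u : ℂ) ρ,
      |(F ε z - F ε' z).re| ≤ C * (ε + ε') := by
    intro ε hε ε' hε' z hz
    rw [Complex.sub_re, hreF ε hε z hz, hreF ε' hε' z hz]
    have h1 := abs_le.1 (hnz ε hε z hz).2
    have h2 := abs_le.1 (hnz ε' hε' z hz).2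
    rw [abs_le]
    constructor <;> linarith [h1.1, h1.2, h2.1, h2.2]
  have hρ2 : Metric.ball (u : ℂ) (ρ / 2) ⊆ Metric.ball (u : ℂ) ρ :=
    Metric.ball_subset_ball (by linarith)
  have huρ : |u - u| < ρ := by simpa
  obtain ⟨r, hr, hrρ, F₀, F₁, B, hB, ε₁, hε₁, hε₁δ, h1, h2, h3, h4, h5⟩ :=
    exists_uniform_expansion (F := F) (Λ₀ := Λ₀) (Λ₁ := Λ₁) (Λ₂ := Λ₂) (u := u) (ρ := ρ / 2)
    (ε₀ := δ) (C := 5 * C) (by positivity) hδ (fun ε hε => (hF ε hε).1.mono hρ2) (by positivity)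
    (fun ε hε ε' hε' z hz => by
      have hpos : 0 < C * (ε + ε') := mul_pos hC (add_pos hε.1 hε'.1)
      have := norm_le_of_re_le_ball (f := fun z => F ε z - F ε' z) hρ hpos
        ((hF ε hε).1.sub (hF ε' hε').1)
        (fun w hw => (abs_le.1 (hdiffre ε hε ε' hε' w hw)).2) (by
          have h6 := hdiffre ε hε ε' hε' u (Metric.mem_ball_self hρ)
          rw [(hF ε hε).2.2 u huρ, (hF ε' hε').2.2 u huρ, ← Complex.ofReal_sub] at h6 ⊢
          rw [Complex.norm_real, Real.norm_eq_abs]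
          simpa using h6) z hz
      linarith)
    (fun x hx => by
      have hx' : |x - u| < ρ := by linarith
      have hxD : x ∈ interior D := by simpa using hint x (ofReal_mem_ball.2 hx')
      obtain ⟨M, hM⟩ := (hA.expansion x hxD).bound
      obtain ⟨ε₃, hε₃, h6⟩ := mem_nhdsGT_iff_exists_Ioo_subset.1 hM
      refine ⟨M, min ε₃ δ, lt_min hε₃ hδ, fun ε hε => ?_⟩
      have h7 := h6 ⟨hε.1, hε.2.trans_le (min_le_left _ _)⟩
      simp only [mem_ofPred_eq] at h7
      rw [(hF ε ⟨hε.1, hε.2.trans_le (min_le_right _ _)⟩).2.2 x hx']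
      rw [Real.norm_eq_abs, Real.norm_eq_abs, abs_of_pos (pow_pos hε.1 3)] at h7
      calc _ = ‖((lmgf P Y ε x - (Λ₀ x + Λ₁ x * ε + Λ₂ x * ε ^ 2) : ℝ) : ℂ)‖ := by
            congr 1; push_cast; ring
        _ ≤ _ := by rw [Complex.norm_real, Real.norm_eq_abs]; exact h7)
  have hrsub : Metric.ball (u : ℂ) r ⊆ Metric.ball (u : ℂ) ρ :=
    Metric.ball_subset_ball (by linarith)
  have hε₁' : ∀ {ε : ℝ}, ε ∈ Ioo 0 ε₁ → ε ∈ Ioo 0 δ := fun h => ⟨h.1, h.2.trans_le hε₁δ⟩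
  exact ⟨r, B, ε₁, F, F₀, F₁, hr, hB, hε₁, fun ε hε => hdom ε (hδ0 (hε₁' hε)),
    fun z hz => hint z (hrsub hz), fun ε hε => (hF ε (hε₁' hε)).1.mono hrsub,
    fun ε hε z hz => (hF ε (hε₁' hε)).2.1 z (hrsub hz),
    fun ε hε x hx => (hF ε (hε₁' hε)).2.2 x (by linarith), h1, h2, h3, h4, h5⟩

/-! ### Positivity of the second derivative of Λ₀. -/

lemma abs_cos_lt_one {x : ℝ} (h0 : 0 < x) (h1 : x < Real.pi) : |Real.cos x| < 1 := by
  have hs := Real.sin_pos_of_pos_of_lt_pi h0 h1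
  rw [abs_lt]
  constructor <;> nlinarith [Real.sin_sq_add_cos_sq x]

/-- Testing with e = exp(2πi/n) and e = exp(πi/n), where e^n is 1 and −1 while |Re e| < 1, gives Re
a ≤ 0 and Re a ≥ 0. An n-th root of the conjugate of `a` then gives |a|² ≤ 0. For n = 2 the first
test is void, as cos π = −1: quadratic terms are permitted. -/
lemma eq_zero_of_re_pow_mul_le {a : ℂ} {n : ℕ} (hn : 3 ≤ n)
    (h : ∀ e : ℂ, (e ^ n * a).re ≤ e.re ^ n * a.re) : a = 0 := by
  have hn0 : (0 : ℝ) < n := by exact_mod_cast (by omega : 0 < n)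
  have hpi := Real.pi_pos
  have key : ∀ x : ℝ, 0 < x → x < Real.pi → |Real.cos x ^ n| < 1 := fun x h0 h1 => by
    rw [abs_pow]
    exact pow_lt_one₀ (abs_nonneg _) (abs_cos_lt_one h0 h1) (by omega)
  have hexp : ∀ x : ℝ, (Complex.exp (x * Complex.I)) ^ n = Complex.exp ((n * x : ℝ) * Complex.I) :=
    fun x => by rw [← Complex.exp_nat_mul]; push_cast; ring_nf
  have h1 := h (Complex.exp ((2 * Real.pi / n : ℝ) * Complex.I))
  rw [hexp, Complex.exp_ofReal_mul_I_re, mul_div_cancel₀ _ hn0.ne'] at h1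
  have h2 := h (Complex.exp ((Real.pi / n : ℝ) * Complex.I))
  rw [hexp, Complex.exp_ofReal_mul_I_re, mul_div_cancel₀ _ hn0.ne', Complex.exp_pi_mul_I] at h2
  have h3 : Complex.exp ((2 * Real.pi : ℝ) * Complex.I) = 1 := by
    push_cast; exact Complex.exp_two_pi_mul_I
  rw [h3, one_mul] at h1
  have k1 := abs_lt.1 (key (2 * Real.pi / n) (by positivity) (by
    rw [div_lt_iff₀ hn0]
    have : (3 : ℝ) ≤ n := by exact_mod_cast hn
    nlinarith))
  have k2 := abs_lt.1 (key (Real.pi / n) (by positivity) (by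
    rw [div_lt_iff₀ hn0]
    have : (3 : ℝ) ≤ n := by exact_mod_cast hn
    nlinarith))
  simp only [neg_mul, one_mul, Complex.neg_re] at h2
  have hre : a.re = 0 := by
    refine le_antisymm ?_ ?_ <;> by_contra hlt <;> push Not at hlt
    · nlinarith [k1.2]
    · nlinarith [k2.1]
  obtain ⟨e, he⟩ := IsAlgClosed.exists_pow_nat_eq ((starRingEnd ℂ) a) (by omega : 0 < n)
  have h4 := h e
  rw [he, hre, mul_zero, mul_comm, Complex.mul_conj, Complex.ofReal_re] at h4
  exact Complex.normSq_eq_zero.1 (le_antisymm h4 (Complex.normSq_nonneg a))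

/-- If `Re h` is maximal on the real axis along vertical lines near `0`, then `h` cannot vanish to
finite order three or more at `0`. -/
lemma eventually_zero_of_re_le {h : ℂ → ℂ} (han : AnalyticAt ℂ h 0)
    (hre : ∀ᶠ z in 𝓝 (0 : ℂ), (h z).re ≤ (h (z.re : ℂ)).re) {C : ℝ}
    (hC : ∀ᶠ z in 𝓝 (0 : ℂ), ‖h z‖ ≤ C * ‖z‖ ^ 3) : ∀ᶠ z in 𝓝 (0 : ℂ), h z = 0 := by
  by_contra hne
  obtain ⟨n, g, hg, hg0, hgh⟩ := han.exists_eventuallyEq_pow_smul_nonzero_iff.2 hne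
  simp only [sub_zero, smul_eq_mul] at hgh
  have hlim : ∀ e : ℂ, Tendsto (fun t : ℝ => (t : ℂ) * e) (𝓝[>] 0) (𝓝 0) := fun e => by
    have : Continuous fun t : ℝ => (t : ℂ) * e := by fun_prop
    have h := this.tendsto 0
    simp only [Complex.ofReal_zero, zero_mul] at h
    exact h.mono_left nhdsWithin_le_nhds
  rcases lt_or_ge n 3 with hn | hn
  · have h1 := (hlim 1).eventually (hgh.and hC)
    have h2 : Tendsto (fun t : ℝ => ‖g ((t : ℂ) * 1)‖) (𝓝[>] 0) (𝓝 ‖g 0‖) :=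
      (hg.continuousAt.tendsto.comp (hlim 1)).norm
    have h3 : Tendsto (fun t : ℝ => C * t ^ (3 - n)) (𝓝[>] 0) (𝓝 0) := by
      have : Continuous fun t : ℝ => C * t ^ (3 - n) := by fun_prop
      have h := this.tendsto 0
      rw [zero_pow (by omega), mul_zero] at h
      exact h.mono_left nhdsWithin_le_nhds
    have h4 : ‖g 0‖ ≤ 0 := by
      refine le_of_tendsto_of_tendsto h2 h3 ?_
      filter_upwards [h1, self_mem_nhdsWithin] with t ht ht0
      have ht0' : (0 : ℝ) < t := ht0
      obtain ⟨e1, e2⟩ := ht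
      rw [e1, norm_mul, norm_pow] at e2
      have e3 : ‖(t : ℂ) * 1‖ = t := by simp [abs_of_pos ht0']
      rw [e3] at e2
      have e4 : t ^ 3 = t ^ n * t ^ (3 - n) := by rw [← pow_add]; congr 1; omega
      rw [e4] at e2
      have e5 : 0 < t ^ n := by positivity
      nlinarith
    exact hg0 (norm_le_zero_iff.1 h4)
  -- Along the ray t e, the inequality divided by t^n tends to the one for the leading coefficient
  -- `g 0`.
  · refine hg0 (eq_zero_of_re_pow_mul_le hn fun e => ?_)
    have h1 := (hlim e).eventually (hgh.and hre)
    have h2 := (hlim (e.re : ℂ)).eventually hgh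
    have l1 : Tendsto (fun t : ℝ => (e ^ n * g ((t : ℂ) * e)).re) (𝓝[>] 0) (𝓝 (e ^ n * g 0).re) :=
      Complex.continuous_re.continuousAt.tendsto.comp
        (tendsto_const_nhds.mul (hg.continuousAt.tendsto.comp (hlim e)))
    have l2 : Tendsto (fun t : ℝ => e.re ^ n * (g ((t : ℂ) * (e.re : ℂ))).re) (𝓝[>] 0)
        (𝓝 (e.re ^ n * (g 0).re)) :=
      tendsto_const_nhds.mul (Complex.continuous_re.continuousAt.tendsto.comp
        (hg.continuousAt.tendsto.comp (hlim (e.re : ℂ))))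
    refine le_of_tendsto_of_tendsto l1 l2 ?_
    filter_upwards [h1, h2, self_mem_nhdsWithin] with t ht ht2 ht0
    have ht0' : (0 : ℝ) < t := ht0
    obtain ⟨e1, e2⟩ := ht
    have e3 : ((((t : ℂ) * e).re : ℝ) : ℂ) = (t : ℂ) * (e.re : ℂ) := by simp
    rw [e3, e1, ht2] at e2
    have e4 : (((t : ℂ) * e) ^ n * g ((t : ℂ) * e)).re = t ^ n * (e ^ n * g ((t : ℂ) * e)).re := by
      rw [mul_pow, mul_assoc, ← Complex.ofReal_pow, Complex.re_ofReal_mul]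
    have e5 : (((t : ℂ) * (e.re : ℂ)) ^ n * g ((t : ℂ) * (e.re : ℂ))).re
        = t ^ n * (e.re ^ n * (g ((t : ℂ) * (e.re : ℂ))).re) := by
      rw [mul_pow, mul_assoc, ← Complex.ofReal_pow, Complex.re_ofReal_mul, ← Complex.ofReal_pow,
        Complex.re_ofReal_mul]
    rw [e4, e5] at e2
    exact le_of_mul_le_mul_left e2 (by positivity)

lemma exists_bound_on_half_ball {F : ℂ → ℂ} {c : ℂ} {r : ℝ} (hr : 0 < r)
    (hF : DifferentiableOn ℂ F (Metric.ball c r)) :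
    ∃ C, 0 ≤ C ∧ ∀ z ∈ Metric.ball c (r / 2), ‖F z‖ ≤ C := by
  obtain ⟨C, hC⟩ := (isCompact_closedBall c (r / 2)).exists_bound_of_continuousOn
    (hF.continuousOn.mono (Metric.closedBall_subset_ball (by linarith)))
  exact ⟨C, (norm_nonneg _).trans (hC c (Metric.mem_closedBall_self (by linarith))),
    fun z hz => hC z (Metric.ball_subset_closedBall hz)⟩

lemma LocalExpansion.tendsto {Ω : Type*} [MeasurableSpace Ω] {P : Measure Ω} {Y : ℝ → Ω → ℝ}
    {D : Set ℝ} {Λ₀ Λ₁ : ℝ → ℝ} {u r B ε₁ : ℝ} {F : ℝ → ℂ → ℂ} {F₀ F₁ : ℂ → ℂ}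
    (h : LocalExpansion P Y D Λ₀ Λ₁ u r B ε₁ F F₀ F₁) {z : ℂ} (hz : z ∈ Metric.ball (u : ℂ) r) :
    Tendsto (fun ε => F ε z) (𝓝[>] 0) (𝓝 (F₀ z)) := by
  rw [tendsto_iff_norm_sub_tendsto_zero]
  refine squeeze_zero' (Eventually.of_forall fun _ => norm_nonneg _)
    (g := fun ε : ℝ => ε * ‖F₁ z‖ + B * ε ^ 2) ?_ ?_
  · filter_upwards [Ioo_mem_nhdsGT h.ε_pos] with ε hε
    have h1 := h.bound ε hε z hz
    have h2 : F ε z - F₀ z = (ε * F₁ z) + (F ε z - F₀ z - ε * F₁ z) := by ring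
    rw [h2]
    refine (norm_add_le _ _).trans (add_le_add (le_of_eq ?_) h1)
    rw [norm_mul, Complex.norm_real, Real.norm_eq_abs, abs_of_pos hε.1]
  · have : Continuous fun ε : ℝ => ε * ‖F₁ z‖ + B * ε ^ 2 := by fun_prop
    have h := this.tendsto 0
    simp only [zero_mul, ne_eq, OfNat.ofNat_ne_zero, not_false_eq_true, zero_pow, mul_zero,
      add_zero] at h
    exact h.mono_left nhdsWithin_le_nhds

/-- The limit ε → 0 of the inequality |E exp(wY/ε)| ≤ E exp(Re(w) Y/ε), after taking ε log. -/
lemma LocalExpansion.re_le {Ω : Type*} [MeasurableSpace Ω] {P : Measure Ω}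
    [IsProbabilityMeasure P] {Y : ℝ → Ω → ℝ}
    {D : Set ℝ} {Λ₀ Λ₁ : ℝ → ℝ} {u r B ε₁ : ℝ} {F : ℝ → ℂ → ℂ} {F₀ F₁ : ℂ → ℂ}
    (h : LocalExpansion P Y D Λ₀ Λ₁ u r B ε₁ F F₀ F₁) {z : ℂ} (hz : z ∈ Metric.ball (u : ℂ) r) :
    (F₀ z).re ≤ (F₀ (z.re : ℂ)).re := by
  have hz' : |z.re - u| < r := by
    rw [Metric.mem_ball, dist_eq_norm] at hz
    have := Complex.abs_re_le_norm (z - u)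
    simp only [Complex.sub_re, Complex.ofReal_re] at this
    exact this.trans_lt hz
  have hz'' := ofReal_mem_ball.2 hz'
  refine le_of_tendsto_of_tendsto (Complex.continuous_re.continuousAt.tendsto.comp (h.tendsto hz))
    (Complex.continuous_re.continuousAt.tendsto.comp (h.tendsto hz'')) ?_
  filter_upwards [Ioo_mem_nhdsGT h.ε_pos] with ε hε
  simp only [Function.comp]
  have hpos := mgf_pos_of_mem_dom (P := P) (Y := Y) (h.sub_dom ε hε (h.mem_int z hz))
  rw [h.real ε hε _ hz', Complex.ofReal_re, lmgf]
  have h1 := norm_cmgf_le P Y ε z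
  rw [← h.exp_eq ε hε z hz, Complex.norm_exp, Complex.div_ofReal_re,
    ← Real.le_log_iff_exp_le hpos, div_le_iff₀ hε.1] at h1
  linarith

/-- The second derivative of `Λ₀` is positive at nonzero points. -/
lemma LocalExpansion.second_deriv_pos {Ω : Type*} [MeasurableSpace Ω] {P : Measure Ω}
    [IsProbabilityMeasure P] {Y : ℝ → Ω → ℝ}
    {D : Set ℝ} {Λ₀ Λ₁ : ℝ → ℝ} {u r B ε₁ : ℝ} {F : ℝ → ℂ → ℂ} {F₀ F₁ : ℂ → ℂ}
    (h : LocalExpansion P Y D Λ₀ Λ₁ u r B ε₁ F F₀ F₁) (hconv : StrictConvexOn ℝ (interior D) Λ₀) :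
    0 < iteratedDeriv 2 Λ₀ u := by
  have hr := h.r_pos
  have huu : |u - u| < r := by simpa
  set σ := iteratedDeriv 2 Λ₀ u with hσ
  set k := deriv Λ₀ u with hk
  obtain ⟨C, hC0, hC⟩ := exists_bound_on_half_ball hr h.diff₀
  have hsub : Metric.ball (u : ℂ) (r / 2) ⊆ Metric.ball (u : ℂ) r :=
    Metric.ball_subset_ball (by linarith)
  have htay : ∀ z : ℂ, ‖z‖ ≤ r / 2 / 4 →
      ‖F₀ (u + z) - (Λ₀ u + k * z + σ / 2 * z ^ 2)‖ ≤ 2 * C * (2 / (r / 2)) ^ 3 * ‖z‖ ^ 3 := by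
    intro z hz
    have := norm_sub_taylor_le (by positivity) (h.diff₀.mono hsub) hC 3 hz
    simp only [Finset.sum_range_succ, Finset.sum_range_zero,
      iteratedDeriv_ofReal_of_real _ F₀ Λ₀ h.diff₀ h.real₀ u huu] at this
    simpa [iteratedDeriv_one, Nat.factorial] using this
  set C' := 2 * C * (2 / (r / 2)) ^ 3 with hC'
  have hsmall : ∀ᶠ z in 𝓝 (0 : ℂ), ‖z‖ ≤ r / 2 / 4 := by
    have := Metric.closedBall_mem_nhds (0 : ℂ) (by positivity : 0 < r / 2 / 4)
    filter_upwards [this] with z hz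
    simpa using hz
  have hmemz : ∀ z : ℂ, ‖z‖ ≤ r / 2 / 4 → (u : ℂ) + z ∈ Metric.ball (u : ℂ) r := fun z hz => by
    rw [Metric.mem_ball, dist_eq_norm, add_sub_cancel_left]; linarith
  have hrez : ∀ z : ℂ, ‖z‖ ≤ r / 2 / 4 → (F₀ (u + z)).re ≤ (F₀ (u + (z.re : ℂ))).re := fun z hz => by
    have := h.re_le (hmemz z hz)
    simpa using this
  -- For σ < 0, Re F₀(u + it) ≈ Λ₀(u) − σ t²/2 would exceed the value on the real axis.
  have hnn : 0 ≤ σ := by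
    by_contra hlt
    push Not at hlt
    have hlim : Tendsto (fun t : ℝ => -σ / 2 - C' * t) (𝓝[>] 0) (𝓝 (-σ / 2)) := by
      have : Continuous fun t : ℝ => -σ / 2 - C' * t := by fun_prop
      have h := this.tendsto 0
      simp only [mul_zero, sub_zero] at h
      exact h.mono_left nhdsWithin_le_nhds
    obtain ⟨t, ⟨ht1, ht2⟩⟩ := ((hlim.eventually_const_lt (by linarith : (0 : ℝ) < -σ / 2)).and
      (Ioo_mem_nhdsGT (by positivity : 0 < r / 2 / 4))).exists
    have hnorm : ‖(t : ℂ) * Complex.I‖ = t := by simp [abs_of_pos ht2.1]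
    have hle : ‖(t : ℂ) * Complex.I‖ ≤ r / 2 / 4 := by rw [hnorm]; exact ht2.2.le
    have h1 := htay _ hle
    have h2 := hrez _ hle
    rw [hnorm] at h1
    have h3 := (abs_le.1 ((Complex.abs_re_le_norm _).trans h1)).1
    have hI : ((t : ℂ) * Complex.I) ^ 2 = ((-t ^ 2 : ℝ) : ℂ) := by
      rw [mul_pow, Complex.I_sq]; push_cast; ring
    have e : (F₀ (u + t * Complex.I) - (Λ₀ u + k * (t * Complex.I) + σ / 2 * (t * Complex.I) ^ 2)).re
        = (F₀ (u + t * Complex.I)).re - Λ₀ u + σ / 2 * t ^ 2 := by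
      rw [hI]
      have : (σ : ℂ) / 2 * ((-t ^ 2 : ℝ) : ℂ) = ((σ / 2 * (-t ^ 2) : ℝ) : ℂ) := by push_cast; ring
      rw [this]
      simp only [Complex.sub_re, Complex.add_re, Complex.ofReal_re, Complex.re_ofReal_mul,
        Complex.I_re]
      ring
    rw [e] at h3
    have h4 : (F₀ (u + (((t : ℂ) * Complex.I).re : ℂ))).re = Λ₀ u := by
      simp [h.real₀ u huu]
    rw [h4] at h2
    nlinarith [pow_pos ht2.1 2, pow_pos ht2.1 3]
  refine lt_of_le_of_ne hnn fun h0 => ?_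
  -- If σ = 0, then F₀ minus its tangent vanishes to order three at `u`, hence identically nearby.
  -- Then Λ₀ is affine there, against strict convexity at a midpoint.
  have hzero := eventually_zero_of_re_le (h := fun z => F₀ (u + z) - Λ₀ u - k * z) (C := C') ?_ ?_ ?_
  · obtain ⟨ρ₁, hρ₁, hρ⟩ := Metric.eventually_nhds_iff.1 (hzero.and hsmall)
    set t := ρ₁ / 2 with ht
    have ht0 : 0 < t := by positivity
    have hpt : ∀ s : ℝ, |s| ≤ t → u + s ∈ interior D ∧ Λ₀ (u + s) = Λ₀ u + k * s := by
      intro s hs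
      have h1 := hρ (y := (s : ℂ)) (by simp; linarith)
      have hball := hmemz _ h1.2
      have h2 : |u + s - u| < r := by
        rw [← ofReal_mem_ball]; push_cast; exact hball
      refine ⟨by simpa using h.mem_int _ hball, ?_⟩
      have h3 := h1.1
      have h4 := h.real₀ (u + s) h2
      push_cast at h4
      rw [h4, sub_sub, sub_eq_zero] at h3
      exact_mod_cast h3
    have a1 := hpt t (by rw [abs_of_pos ht0])
    have a2 := hpt (-t) (by rw [abs_neg, abs_of_pos ht0])
    have h5 := hconv.2 a1.1 a2.1 (by intro heq; linarith) (by norm_num : (0 : ℝ) < 1 / 2)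
      (by norm_num : (0 : ℝ) < 1 / 2) (by norm_num)
    rw [a1.2, a2.2] at h5
    simp only [smul_eq_mul] at h5
    have e : (1 : ℝ) / 2 * (u + t) + 1 / 2 * (u + -t) = u := by ring
    rw [e] at h5
    linarith
  · have h1 : AnalyticAt ℂ F₀ (u + 0) := by
      rw [add_zero]
      exact h.diff₀.analyticAt (Metric.isOpen_ball.mem_nhds (Metric.mem_ball_self hr))
    have h2 : AnalyticAt ℂ (fun z : ℂ => (u : ℂ) + z) 0 := by fun_prop
    have h3 : AnalyticAt ℂ (fun z : ℂ => F₀ (u + z)) 0 := AnalyticAt.fun_comp h1 h2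
    have h4 : AnalyticAt ℂ (fun z : ℂ => (k : ℂ) * z) 0 := by fun_prop
    exact (h3.sub analyticAt_const).sub h4
  · filter_upwards [hsmall] with z hz
    have := hrez z hz
    simp only [Complex.sub_re, Complex.re_ofReal_mul, Complex.ofReal_re]
    linarith
  · filter_upwards [hsmall] with z hz
    have := htay z hz
    rw [← h0] at this
    convert this using 2
    push_cast; ring

/-! ### Payoffs as contour integrals of exponentials. -/

open FourierTransform in
lemma fourier_apply (f : ℝ → ℂ) (ξ : ℝ) :
    𝓕 f ξ = ∫ x : ℝ, Complex.exp (-((2 * Real.pi * ξ : ℝ) * Complex.I) * x) * f x := by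
  rw [Real.fourier_eq']
  congr 1; ext x
  simp only [smul_eq_mul, RCLike.inner_apply, conj_trivial]
  congr 2; push_cast; ring

open FourierTransform in
lemma fourierInv_apply (f : ℝ → ℂ) (x : ℝ) :
    𝓕⁻ f x = ∫ ξ : ℝ, Complex.exp ((2 * Real.pi * ξ : ℝ) * Complex.I * x) * f ξ := by
  rw [Real.fourierInv_eq']
  congr 1; ext ξ
  simp only [smul_eq_mul, RCLike.inner_apply, conj_trivial]
  congr 2; push_cast; ring

/-- The exponential `exp (-z x)` on the half line where it decays, with the sign that makes its
integral equal to `1 / z`. -/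
noncomputable def oneSidedExp (z : ℂ) (x : ℝ) : ℂ :=
  if 0 < z.re then (Ioi (0 : ℝ)).indicator (fun x : ℝ => Complex.exp (-z * x)) x
  else -(Iic (0 : ℝ)).indicator (fun x : ℝ => Complex.exp (-z * x)) x

lemma integrable_oneSidedExp {z : ℂ} (hz : z.re ≠ 0) : Integrable (oneSidedExp z) := by
  rcases lt_or_gt_of_ne hz with h | h
  · have : oneSidedExp z = fun x => -(Iic (0 : ℝ)).indicator (fun x : ℝ => Complex.exp (-z * x)) x := by
      ext x; rw [oneSidedExp, if_neg (not_lt.2 h.le)]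
    rw [this]
    exact ((integrableOn_exp_mul_complex_Iic (a := -z) (by simpa) 0).integrable_indicator
      measurableSet_Iic).neg
  · have : oneSidedExp z = (Ioi (0 : ℝ)).indicator (fun x : ℝ => Complex.exp (-z * x)) := by
      ext x; rw [oneSidedExp, if_pos h]
    rw [this]
    exact (integrableOn_exp_mul_complex_Ioi (a := -z) (by simpa) 0).integrable_indicator
      measurableSet_Ioi

lemma integral_oneSidedExp {z : ℂ} (hz : z.re ≠ 0) : ∫ x, oneSidedExp z x = 1 / z := by
  rcases lt_or_gt_of_ne hz with h | h
  · have : oneSidedExp z = fun x => -(Iic (0 : ℝ)).indicator (fun x : ℝ => Complex.exp (-z * x)) x := by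
      ext x; rw [oneSidedExp, if_neg (not_lt.2 h.le)]
    rw [this, integral_neg, integral_indicator measurableSet_Iic,
      integral_exp_mul_complex_Iic (by simpa)]
    simp [div_neg]
  · have : oneSidedExp z = (Ioi (0 : ℝ)).indicator (fun x : ℝ => Complex.exp (-z * x)) := by
      ext x; rw [oneSidedExp, if_pos h]
    rw [this, integral_indicator measurableSet_Ioi, integral_exp_mul_complex_Ioi (by simpa)]
    simp [neg_div_neg_eq]

/-- Modulation moves the exponent vertically, so the Fourier transform of `oneSidedExp a` at angular
frequency p is 1/(a + ip), whatever the sign of a. -/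
lemma exp_mul_oneSidedExp (a p x : ℝ) :
    Complex.exp (-(p * Complex.I) * x) * oneSidedExp a x = oneSidedExp (a + p * Complex.I) x := by
  have he : Complex.exp (-(p * Complex.I) * x) * Complex.exp (-(a : ℂ) * x)
      = Complex.exp (-(a + p * Complex.I) * x) := by rw [← Complex.exp_add]; ring_nf
  have hre : ((a : ℂ) + p * Complex.I).re = a := by simp
  simp only [oneSidedExp, hre, Complex.ofReal_re]
  split_ifs
  · by_cases hx : x ∈ Ioi (0 : ℝ)
    · simp only [indicator_of_mem hx, he]
    · simp only [indicator_of_notMem hx, mul_zero]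
  · by_cases hx : x ∈ Iic (0 : ℝ)
    · simp only [indicator_of_mem hx, mul_neg, he]
    · simp only [indicator_of_notMem hx, mul_zero, neg_zero]

lemma add_mul_I_ne_zero {u : ℝ} (hu : u ≠ 0) (p : ℝ) : (u : ℂ) + p * Complex.I ≠ 0 := fun h => by
  have := congrArg Complex.re h
  simp at this
  exact hu this

lemma norm_sq_add_mul_I (u p : ℝ) : ‖(u : ℂ) + p * Complex.I‖ ^ 2 = u ^ 2 + p ^ 2 := by
  rw [← Complex.normSq_eq_norm_sq, Complex.normSq_add_mul_I]

/-- The contour kernel `1 / (w (w - b))` on the line `Re w = u`, with `v = u - b`. -/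
noncomputable def kernel (u v p : ℝ) : ℂ := ((u + p * Complex.I) * (v + p * Complex.I))⁻¹

lemma norm_kernel_le {u v m : ℝ} (hm0 : 0 < m) (hm1 : m ≤ 1) (hu : m ≤ u ^ 2) (hv : m ≤ v ^ 2)
    (p : ℝ) : ‖kernel u v p‖ ≤ m⁻¹ * (1 + p ^ 2)⁻¹ := by
  rw [kernel, norm_inv, ← mul_inv]
  refine inv_anti₀ (by positivity) ?_
  refine le_of_sq_le_sq ?_ (norm_nonneg _)
  rw [norm_mul, mul_pow ‖_‖, norm_sq_add_mul_I, norm_sq_add_mul_I, sq]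
  have h1 : m * (1 + p ^ 2) ≤ u ^ 2 + p ^ 2 := by nlinarith [sq_nonneg p]
  have h2 : m * (1 + p ^ 2) ≤ v ^ 2 + p ^ 2 := by nlinarith [sq_nonneg p]
  gcongr

lemma continuous_kernel {u v : ℝ} (hu : u ≠ 0) (hv : v ≠ 0) : Continuous (kernel u v) := by
  unfold kernel
  refine Continuous.inv₀ (by fun_prop) fun p => mul_ne_zero (add_mul_I_ne_zero hu p)
    (add_mul_I_ne_zero hv p)

lemma integrable_kernel {u v : ℝ} (hu : u ≠ 0) (hv : v ≠ 0) : Integrable (kernel u v) := by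
  have hu2 : 0 < u ^ 2 := by positivity
  have hv2 : 0 < v ^ 2 := by positivity
  refine Integrable.mono' (integrable_inv_one_add_sq.const_mul (min 1 (min (u ^ 2) (v ^ 2)))⁻¹)
    (continuous_kernel hu hv).aestronglyMeasurable (Eventually.of_forall fun p => ?_)
  exact norm_kernel_le (by positivity) (min_le_left _ _)
    ((min_le_right _ _).trans (min_le_left _ _)) ((min_le_right _ _).trans (min_le_right _ _)) p

open FourierTransform in
/-- A payoff as a contour integral of exponentials. -/
lemma payoff_eq_integral {b u : ℝ} (hu : u ≠ 0) (hv : u - b ≠ 0) {g : ℝ → ℝ} (hg : Continuous g)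
    (hgx : ∀ x : ℝ, x ≠ 0 → (Real.exp (-u * x) * g x : ℝ)
      = oneSidedExp (u - b : ℝ) x - oneSidedExp u x) (x : ℝ) :
    (g x : ℂ) = b / (2 * Real.pi) *
      ∫ p : ℝ, Complex.exp ((u + p * Complex.I) * x) * kernel u (u - b) p := by
  set h : ℝ → ℂ := fun x => ((Real.exp (-u * x) * g x : ℝ) : ℂ) with hh
  have hcont : Continuous h := by fun_prop
  have hae : h =ᵐ[volume] fun x => oneSidedExp (u - b : ℝ) x - oneSidedExp u x := by
    have : ∀ᵐ x : ℝ, x ≠ 0 := by simp [ae_iff]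
    filter_upwards [this] with x hx using hgx x hx
  have hint : Integrable h := by
    refine Integrable.congr ?_ hae.symm
    exact (integrable_oneSidedExp (by simpa using hv)).sub (integrable_oneSidedExp (by simpa))
  -- This is 1/(u − b + ip) − 1/(u + ip) = b/((u + ip)(u − b + ip)); the frequency is p = 2πξ in the
  -- normalisation of `𝓕`.
  have hF : ∀ ξ : ℝ, 𝓕 h ξ = b * kernel u (u - b) (2 * Real.pi * ξ) := by
    intro ξ
    set p := 2 * Real.pi * ξ with hp
    have e1 : 𝓕 h ξ = ∫ x, (oneSidedExp ((u - b : ℝ) + p * Complex.I) x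
        - oneSidedExp (u + p * Complex.I) x) := by
      rw [fourier_apply]
      refine integral_congr_ae ?_
      filter_upwards [hae] with x hx
      rw [hx, mul_sub, exp_mul_oneSidedExp, exp_mul_oneSidedExp]
    rw [e1, integral_sub (integrable_oneSidedExp (by simpa using hv))
      (integrable_oneSidedExp (by simpa)), integral_oneSidedExp (by simpa using hv),
      integral_oneSidedExp (by simpa), kernel]
    have h1 := add_mul_I_ne_zero hu p
    have h2 := add_mul_I_ne_zero hv p
    field_simp
    push_cast
    ring
  have hFeq : 𝓕 h = fun ξ => (b : ℂ) * kernel u (u - b) (2 * Real.pi * ξ) := funext hF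
  have hFint : Integrable (𝓕 h) := by
    rw [hFeq]
    exact ((integrable_kernel hu hv).comp_mul_left' (by positivity : 2 * Real.pi ≠ 0)).const_mul _
  have hinv := congrFun (hcont.fourierInv_fourier_eq hint hFint) x
  rw [fourierInv_apply, hFeq] at hinv
  have hsub := Measure.integral_comp_mul_left (fun p : ℝ => Complex.exp (p * Complex.I * x) *
    (b * kernel u (u - b) p)) (2 * Real.pi)
  have hpi := Real.pi_pos
  rw [hsub, abs_of_pos (by positivity : 0 < (2 * Real.pi)⁻¹)] at hinv
  have hgx' : (g x : ℂ) = Complex.exp (u * x) * h x := by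
    simp only [hh]
    push_cast
    rw [← mul_assoc, ← Complex.exp_add]
    simp
  rw [hgx', ← hinv, Complex.real_smul, ← integral_const_mul, ← integral_const_mul,
    ← integral_const_mul]
  congr 1; ext p
  rw [add_mul, Complex.exp_add]
  push_cast
  field_simp

lemma norm_exp_add_mul_I_mul (u p x : ℝ) :
    ‖Complex.exp ((u + p * Complex.I) * x)‖ = Real.exp (u * x) := by
  rw [Complex.norm_exp, Complex.re_mul_ofReal]
  simp

/-- The kernel is absolutely integrable, so the contour formula itself dominates the payoff by a
multiple of exp(ux). Integrability of the payoff follows from that of the exponential. -/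
lemma payoff_le_exp {b u : ℝ} {g : ℝ → ℝ}
    (hg : ∀ x : ℝ, (g x : ℂ) = b / (2 * Real.pi) *
      ∫ p : ℝ, Complex.exp ((u + p * Complex.I) * x) * kernel u (u - b) p) (x : ℝ) :
    ‖g x‖ ≤ ‖(b : ℂ) / (2 * Real.pi)‖ * (∫ p, ‖kernel u (u - b) p‖) * Real.exp (u * x) := by
  rw [← Complex.norm_real, hg, norm_mul, mul_assoc]
  refine mul_le_mul_of_nonneg_left ((norm_integral_le_integral_norm _).trans (le_of_eq ?_))
    (norm_nonneg _)
  rw [← integral_mul_const]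
  congr 1; ext p
  rw [norm_mul, norm_exp_add_mul_I_mul, mul_comm]

/-- The expectation of a payoff as a contour integral of the moment generating function. -/
lemma expectation_payoff {Ω : Type*} [MeasurableSpace Ω] {P : Measure Ω} [IsProbabilityMeasure P]
    {X : Ω → ℝ} (hX : AEMeasurable X P) {b u : ℝ} (hu : u ≠ 0) (hv : u - b ≠ 0) {g : ℝ → ℝ}
    (hgc : Continuous g)
    (hgx : ∀ x : ℝ, x ≠ 0 → (Real.exp (-u * x) * g x : ℝ)
      = oneSidedExp (u - b : ℝ) x - oneSidedExp u x)
    (hint : Integrable (fun ω => Real.exp (u * X ω)) P) :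
    Integrable (fun ω => g (X ω)) P ∧
    ((∫ ω, g (X ω) ∂P : ℝ) : ℂ) = b / (2 * Real.pi) *
      ∫ p : ℝ, (∫ ω, Complex.exp ((u + p * Complex.I) * X ω) ∂P) * kernel u (u - b) p := by
  have hg := payoff_eq_integral hu hv hgc hgx
  refine ⟨?_, ?_⟩
  · refine Integrable.mono' (hint.const_mul (‖(b : ℂ) / (2 * Real.pi)‖ *
      (∫ p, ‖kernel u (u - b) p‖))) (hgc.measurable.comp_aemeasurable hX).aestronglyMeasurable
      (Eventually.of_forall fun ω => payoff_le_exp hg (X ω))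
  · rw [← integral_complex_ofReal]
    simp_rw [hg]
    rw [integral_const_mul]
    congr 1
    rw [integral_integral_swap]
    · congr 1; ext p
      rw [integral_mul_const]
    -- For Fubini, the joint integrand is an integrable product times a factor of modulus one.
    · have h1 : Integrable (fun q : Ω × ℝ => ((Real.exp (u * X q.1) : ℝ) : ℂ) *
          kernel u (u - b) q.2) (P.prod volume) :=
        hint.ofReal.mul_prod (integrable_kernel hu hv)
      have h2 : AEMeasurable (fun q : Ω × ℝ => Complex.exp (q.2 * Complex.I * X q.1))
          (P.prod volume) := by
        have := hX.comp_fst (ν := (volume : Measure ℝ))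
        refine Complex.measurable_exp.comp_aemeasurable ?_
        refine AEMeasurable.mul ?_ (Complex.measurable_ofReal.comp_aemeasurable this)
        exact ((Complex.measurable_ofReal.comp measurable_snd).mul_const _).aemeasurable
      have h3 := h1.bdd_mul (c := 1) h2.aestronglyMeasurable (Eventually.of_forall fun q => by
        have := norm_exp_add_mul_I_mul 0 q.2 (X q.1)
        simp only [Complex.ofReal_zero, zero_add, zero_mul, Real.exp_zero] at this
        exact this.le)
      refine h3.congr (Eventually.of_forall fun q => ?_)
      simp only [Function.uncurry]
      rw [← mul_assoc]
      congr 1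
      push_cast
      rw [← Complex.exp_add]
      ring_nf

lemma oneSidedExp_pos {a : ℝ} (ha : 0 < a) (x : ℝ) :
    oneSidedExp a x = ((if 0 < x then Real.exp (-a * x) else 0 : ℝ) : ℂ) := by
  rw [oneSidedExp, if_pos (by simpa)]
  by_cases hx : 0 < x
  · rw [indicator_of_mem (mem_Ioi.2 hx), if_pos hx]; push_cast; rfl
  · rw [indicator_of_notMem (by simpa using hx), if_neg hx]; simp

lemma oneSidedExp_neg {a : ℝ} (ha : a < 0) (x : ℝ) :
    oneSidedExp a x = ((if x ≤ 0 then -Real.exp (-a * x) else 0 : ℝ) : ℂ) := by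
  rw [oneSidedExp, if_neg (by simpa using ha.le)]
  by_cases hx : x ≤ 0
  · rw [indicator_of_mem (mem_Iic.2 hx), if_pos hx]; push_cast; rfl
  · rw [indicator_of_notMem (by simpa using hx), if_neg hx]; simp

/-- Here the line Re w = u lies to the right of both poles 0 and b. It lies to the left of both in
`put_oneSided` and between them in `covered_oneSided`. -/
lemma call_oneSided {b u : ℝ} (hb : 0 ≤ b) (hu : b < u) {x : ℝ} (hx : x ≠ 0) :
    ((Real.exp (-u * x) * max (Real.exp (b * x) - 1) 0 : ℝ) : ℂ)
      = oneSidedExp (u - b : ℝ) x - oneSidedExp u x := by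
  rw [oneSidedExp_pos (by linarith), oneSidedExp_pos (by linarith), ← Complex.ofReal_sub]
  congr 1
  rcases lt_or_gt_of_ne hx with h | h
  · rw [if_neg (by linarith), if_neg (by linarith), max_eq_right, mul_zero, sub_zero]
    have := Real.exp_le_one_iff.2 (mul_nonpos_of_nonneg_of_nonpos hb h.le)
    linarith
  · rw [if_pos h, if_pos h, max_eq_left, mul_sub, ← Real.exp_add]
    · ring_nf
    · have := Real.one_le_exp (mul_nonneg hb h.le)
      linarith

lemma put_oneSided {b u : ℝ} (hb : 0 ≤ b) (hu : u < 0) {x : ℝ} (hx : x ≠ 0) :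
    ((Real.exp (-u * x) * max (1 - Real.exp (b * x)) 0 : ℝ) : ℂ)
      = oneSidedExp (u - b : ℝ) x - oneSidedExp u x := by
  rw [oneSidedExp_neg (by linarith), oneSidedExp_neg (by linarith), ← Complex.ofReal_sub]
  congr 1
  rcases lt_or_gt_of_ne hx with h | h
  · rw [if_pos h.le, if_pos h.le, max_eq_left, mul_sub, ← Real.exp_add]
    · ring_nf
    · have := Real.exp_le_one_iff.2 (mul_nonpos_of_nonneg_of_nonpos hb h.le)
      linarith
  · rw [if_neg (by linarith), if_neg (by linarith), max_eq_right, mul_zero, sub_zero]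
    have := Real.one_le_exp (mul_nonneg hb h.le)
    linarith

lemma covered_oneSided {b u : ℝ} (hu : 0 < u) (hb : u < b) {x : ℝ} (hx : x ≠ 0) :
    ((Real.exp (-u * x) * (-min (Real.exp (b * x)) 1) : ℝ) : ℂ)
      = oneSidedExp (u - b : ℝ) x - oneSidedExp u x := by
  rw [oneSidedExp_neg (by linarith), oneSidedExp_pos hu, ← Complex.ofReal_sub]
  congr 1
  have hb0 : 0 ≤ b := by linarith
  rcases lt_or_gt_of_ne hx with h | h
  · rw [if_pos h.le, if_neg (by linarith), min_eq_left, mul_neg, ← Real.exp_add]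
    · ring_nf
    · exact Real.exp_le_one_iff.2 (mul_nonpos_of_nonneg_of_nonpos hb0 h.le)
  · rw [if_neg (by linarith), if_pos h, min_eq_right]
    · ring
    · exact Real.one_le_exp (mul_nonneg hb0 h.le)

/-! ### Elementary second-order estimates with explicit constants. -/

lemma abs_cos_sub_le (y : ℝ) : |Real.cos y - (1 - y ^ 2 / 2)| ≤ y ^ 4 := by
  have h1 := Real.one_sub_sq_div_two_le_cos (x := y)
  rw [abs_of_nonneg (by linarith)]
  rcases le_or_gt |y| 1 with h | h
  · have := (abs_le.1 (Real.cos_bound h)).2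
    have e : |y| ^ 4 = y ^ 4 := by rw [← abs_pow, abs_of_nonneg (by positivity)]
    rw [e] at this
    nlinarith [pow_nonneg (sq_nonneg y) 2, sq_nonneg (y ^ 2)]
  · have h2 : 1 ≤ y ^ 2 := by rw [← sq_abs]; nlinarith
    nlinarith [Real.cos_le_one y]

lemma abs_sin_sub_le (y : ℝ) : |Real.sin y - y| ≤ 2 * |y| ^ 3 := by
  rcases le_or_gt |y| 1 with h | h
  · have h1 := Real.sin_bound h
    have e : Real.sin y - y = (Real.sin y - (y - y ^ 3 / 6)) + (-(y ^ 3 / 6)) := by ring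
    rw [e]
    refine (abs_add_le _ _).trans ?_
    rw [abs_neg, abs_div, abs_pow]
    norm_num
    have h2 : |y| ^ 5 ≤ |y| ^ 3 := pow_le_pow_of_le_one (abs_nonneg y) h (by norm_num)
    have h3 : 0 ≤ |y| ^ 3 := by positivity
    nlinarith
  · have h1 : |Real.sin y - y| ≤ |Real.sin y| + |y| := abs_sub _ _
    have h2 := Real.abs_sin_le_one y
    have h3 : |y| ≤ |y| ^ 3 := le_self_pow₀ h.le (by norm_num)
    linarith

lemma abs_exp_sub_one_sub_le (x : ℝ) : |Real.exp x - 1 - x| ≤ x ^ 2 * Real.exp |x| := by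
  have h := Complex.norm_exp_sub_sum_le_norm_mul_exp (x : ℂ) 2
  simp only [Finset.sum_range_succ, Finset.sum_range_zero, Nat.factorial] at h
  have e : Complex.exp x - (0 + (x : ℂ) ^ 0 / ((1 : ℕ) : ℂ) + (x : ℂ) ^ 1 / (((0 + 1) * 1 : ℕ) : ℂ))
      = ((Real.exp x - 1 - x : ℝ) : ℂ) := by push_cast; simp; ring
  rw [e, Complex.norm_real, Complex.norm_real, Real.norm_eq_abs, Real.norm_eq_abs, sq_abs] at h
  exact h

lemma abs_mul_le_of_le {a b c d : ℝ} (h1 : |a| ≤ c) (h2 : |b| ≤ d) : |a * b| ≤ c * d := by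
  rw [abs_mul]; exact mul_le_mul h1 h2 (abs_nonneg _) ((abs_nonneg _).trans h1)

lemma abs_add_le_of_le {a b c d : ℝ} (h1 : |a| ≤ c) (h2 : |b| ≤ d) : |a + b| ≤ c + d :=
  (abs_add_le _ _).trans (add_le_add h1 h2)

lemma abs_sub_le_of_le {a b c d : ℝ} (h1 : |a| ≤ c) (h2 : |b| ≤ d) : |a - b| ≤ c + d :=
  (abs_sub _ _).trans (add_le_add h1 h2)

lemma abs_le_of_sub {a b c d : ℝ} (h1 : |a - b| ≤ c) (h2 : |b| ≤ d) : |a| ≤ c + d := by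
  have := abs_add_le_of_le h1 h2
  rwa [sub_add_cancel] at this

/-- In this group `s` is √ε, x + iy is the exponent of the saddlepoint integrand without its
Gaussian part, and m + in is the normalised kernel. The leading terms of x and m − 1 have order s²,
those of y and n order s, so the real part of the product has no terms in s or s³. `A` bounds all
coefficients; exp E is kept apart because it grows with t. -/
lemma abs_exp_sub_expansion {s A E x g₁ : ℝ} (hs0 : 0 ≤ s) (hs1 : s ≤ 1) (hA : 1 ≤ A)
    (hx : |x - s ^ 2 * g₁| ≤ A * s ^ 4) (hg : |g₁| ≤ A) (hxE : |x| ≤ E) :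
    |Real.exp x - (1 + s ^ 2 * g₁)| ≤ 5 * A ^ 2 * s ^ 4 * Real.exp E := by
  have hE1 : 1 ≤ Real.exp E := Real.one_le_exp ((abs_nonneg x).trans hxE)
  have hxb : |x| ≤ 2 * A * s ^ 2 := by
    have h1 := abs_le_of_sub hx (abs_mul_le_of_le (abs_of_nonneg (by positivity : 0 ≤ s ^ 2)).le hg)
    have h2 : A * s ^ 4 ≤ A * s ^ 2 := by
      gcongr A * ?_
      exact pow_le_pow_of_le_one hs0 hs1 (by norm_num)
    linarith
  have h1 := abs_exp_sub_one_sub_le x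
  have h2 : x ^ 2 * Real.exp |x| ≤ (2 * A * s ^ 2) ^ 2 * Real.exp E := by
    rw [← sq_abs x]; gcongr
  have h3 := abs_add_le_of_le h1 hx
  have e : Real.exp x - 1 - x + (x - s ^ 2 * g₁) = Real.exp x - (1 + s ^ 2 * g₁) := by ring
  rw [e] at h3
  have h4 : A * s ^ 4 ≤ A ^ 2 * s ^ 4 * Real.exp E := by
    calc A * s ^ 4 ≤ A ^ 2 * s ^ 4 * 1 := by
          rw [mul_one]; gcongr; exact le_self_pow₀ hA (by norm_num)
      _ ≤ _ := by gcongr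
  calc _ ≤ (2 * A * s ^ 2) ^ 2 * Real.exp E + A ^ 2 * s ^ 4 * Real.exp E := by linarith
    _ = _ := by ring

lemma abs_cos_sub_expansion {s A y y₁ : ℝ} (hs0 : 0 ≤ s) (hA : 1 ≤ A)
    (hyb : |y| ≤ 2 * A * s) (hy : |y - s * y₁| ≤ A * s ^ 3) (hy1 : |y₁| ≤ A) :
    |Real.cos y - (1 - s ^ 2 * (y₁ ^ 2 / 2))| ≤ 18 * A ^ 4 * s ^ 4 := by
  have h1 := abs_cos_sub_le y
  have h2 : y ^ 4 ≤ 16 * A ^ 4 * s ^ 4 := by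
    calc y ^ 4 = |y| ^ 4 := by rw [← abs_pow, abs_of_nonneg (by positivity)]
      _ ≤ (2 * A * s) ^ 4 := by gcongr
      _ = _ := by ring
  have h3 := abs_add_le_of_le hyb (abs_mul_le_of_le (abs_of_nonneg hs0).le hy1)
  have h5 : |(y - s * y₁) * (y + s * y₁) / 2| ≤ 3 / 2 * (A ^ 2 * s ^ 4) := by
    rw [abs_div, abs_two]
    calc _ ≤ A * s ^ 3 * (2 * A * s + s * A) / 2 := by
          gcongr; exact abs_mul_le_of_le hy h3
      _ = _ := by ring
  have h6 := abs_sub_le_of_le h1 h5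
  have e : Real.cos y - (1 - y ^ 2 / 2) - ((y - s * y₁) * (y + s * y₁) / 2)
      = Real.cos y - (1 - s ^ 2 * (y₁ ^ 2 / 2)) := by ring
  rw [e] at h6
  have h7 : A ^ 2 * s ^ 4 ≤ A ^ 4 * s ^ 4 := by
    gcongr ?_ * s ^ 4
    exact pow_le_pow_right₀ hA (by norm_num)
  have h8 : 0 ≤ A ^ 4 * s ^ 4 := by positivity
  linarith

lemma abs_sin_mul_sub_expansion {s A y y₁ n n₁ : ℝ} (hs0 : 0 ≤ s) (hA : 1 ≤ A)
    (hyb : |y| ≤ 2 * A * s) (hy : |y - s * y₁| ≤ A * s ^ 3) (hy1 : |y₁| ≤ A)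
    (hnb : |n| ≤ 2 * A * s) (hn : |n + s * n₁| ≤ A * s ^ 3) :
    |Real.sin y * n + s ^ 2 * (y₁ * n₁)| ≤ 35 * A ^ 4 * s ^ 4 := by
  have h1 : |Real.sin y - y| ≤ 16 * A ^ 3 * s ^ 3 := by
    calc _ ≤ 2 * |y| ^ 3 := abs_sin_sub_le y
      _ ≤ 2 * (2 * A * s) ^ 3 := by gcongr
      _ = _ := by ring
  have h2 := abs_add_le_of_le (abs_mul_le_of_le h1 hnb) (abs_add_le_of_le (abs_mul_le_of_le hy hnb)
    (abs_mul_le_of_le (abs_mul_le_of_le (abs_of_nonneg hs0).le hy1) hn))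
  have e : (Real.sin y - y) * n + ((y - s * y₁) * n + s * y₁ * (n + s * n₁))
      = Real.sin y * n + s ^ 2 * (y₁ * n₁) := by ring
  rw [e] at h2
  have h7 : A ^ 2 * s ^ 4 ≤ A ^ 4 * s ^ 4 := by
    gcongr ?_ * s ^ 4
    exact pow_le_pow_right₀ hA (by norm_num)
  calc _ ≤ _ := h2
    _ = 32 * (A ^ 4 * s ^ 4) + 3 * (A ^ 2 * s ^ 4) := by ring
    _ ≤ _ := by linarith

/-- Second order expansion of the real part of `exp (i y) (m + i n)`. -/
lemma abs_rotation_sub_le {s A y m n y₁ m₁ n₁ : ℝ} (hs0 : 0 ≤ s) (hs1 : s ≤ 1) (hA : 1 ≤ A)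
    (hy : |y - s * y₁| ≤ A * s ^ 3) (hy1 : |y₁| ≤ A)
    (hm : |m - (1 - s ^ 2 * m₁)| ≤ A * s ^ 4) (hm1 : |m₁| ≤ A)
    (hn : |n + s * n₁| ≤ A * s ^ 3) (hn1 : |n₁| ≤ A) :
    |Real.cos y * m - Real.sin y * n - (1 + s ^ 2 * (-(y₁ ^ 2 / 2) - m₁ + y₁ * n₁))|
      ≤ 92 * A ^ 5 * s ^ 4 ∧ |Real.cos y * m - Real.sin y * n| ≤ 5 * A := by
  have sabs : |s| ≤ s := (abs_of_nonneg hs0).le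
  have s2abs : |s ^ 2| ≤ s ^ 2 := (abs_of_nonneg (by positivity)).le
  have hs2 : s ^ 2 ≤ 1 := pow_le_one₀ hs0 hs1
  have hs4 : s ^ 4 ≤ 1 := pow_le_one₀ hs0 hs1
  have hs3 : A * s ^ 3 ≤ A * s := by
    gcongr A * ?_
    simpa using pow_le_pow_of_le_one hs0 hs1 (by norm_num : 1 ≤ 3)
  have hAs2 : s ^ 2 * A ≤ A := mul_le_of_le_one_left (by linarith) hs2
  have hAs4 : A * s ^ 4 ≤ A := mul_le_of_le_one_right (by linarith) hs4
  have hAs : A * s ≤ A := mul_le_of_le_one_right (by linarith) hs1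
  have hyb : |y| ≤ 2 * A * s := by
    have := abs_le_of_sub hy (abs_mul_le_of_le sabs hy1)
    linarith
  have hnb : |n| ≤ 2 * A * s := by
    have h1 := abs_sub_le_of_le hn (abs_mul_le_of_le sabs hn1)
    rw [add_sub_cancel_right] at h1
    linarith
  have hmb : |m| ≤ 3 * A := by
    have := abs_le_of_sub hm (abs_sub_le_of_le (abs_one (α := ℝ)).le (abs_mul_le_of_le s2abs hm1))
    linarith
  have r2 := abs_cos_sub_expansion hs0 hA hyb hy hy1
  have r4 := abs_sin_mul_sub_expansion hs0 hA hyb hy hy1 hnb hn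
  have hy2 : |y₁ ^ 2 / 2| ≤ A ^ 2 / 2 := by
    rw [abs_div, abs_two, abs_pow]; gcongr
  have hA2 : 1 ≤ A ^ 2 := one_le_pow₀ hA
  have h0 : |1 - s ^ 2 * (y₁ ^ 2 / 2)| ≤ 2 * A ^ 2 := by
    have h1 := abs_sub_le_of_le (abs_one (α := ℝ)).le (abs_mul_le_of_le s2abs hy2)
    have h2 : s ^ 2 * (A ^ 2 / 2) ≤ A ^ 2 / 2 := mul_le_of_le_one_left (by positivity) hs2
    linarith
  have h1 := abs_sub_le_of_le (abs_add_le_of_le (abs_mul_le_of_le r2 hmb)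
    (abs_add_le_of_le (abs_mul_le_of_le h0 hm) (abs_mul_le_of_le (abs_mul_le_of_le s2abs s2abs)
      (abs_mul_le_of_le hy2 hm1)))) r4
  have e : (Real.cos y - (1 - s ^ 2 * (y₁ ^ 2 / 2))) * m
      + ((1 - s ^ 2 * (y₁ ^ 2 / 2)) * (m - (1 - s ^ 2 * m₁))
        + s ^ 2 * s ^ 2 * (y₁ ^ 2 / 2 * m₁)) - (Real.sin y * n + s ^ 2 * (y₁ * n₁))
      = Real.cos y * m - Real.sin y * n - (1 + s ^ 2 * (-(y₁ ^ 2 / 2) - m₁ + y₁ * n₁)) := by ring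
  rw [e] at h1
  have h7 : A ^ 3 * s ^ 4 ≤ A ^ 5 * s ^ 4 := by
    gcongr ?_ * s ^ 4
    exact pow_le_pow_right₀ hA (by norm_num)
  have h8 : A ^ 4 * s ^ 4 ≤ A ^ 5 * s ^ 4 := by
    gcongr ?_ * s ^ 4
    exact pow_le_pow_right₀ hA (by norm_num)
  have h9 : 0 ≤ A ^ 5 * s ^ 4 := by positivity
  refine ⟨?_, ?_⟩
  · calc _ ≤ _ := h1
      _ = 54 * (A ^ 5 * s ^ 4) + 5 / 2 * (A ^ 3 * s ^ 4) + 35 * (A ^ 4 * s ^ 4) := by ring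
      _ ≤ _ := by linarith
  · have := abs_sub_le_of_le (abs_mul_le_of_le (Real.abs_cos_le_one y) hmb)
      (abs_mul_le_of_le (Real.abs_sin_le_one y) hnb)
    linarith

/-- Second order expansion of the real part of `exp (x + i y) (m + i n)`. -/
lemma abs_exp_mul_sub_le {s A E x y m n g₁ y₁ m₁ n₁ : ℝ} (hs0 : 0 ≤ s) (hs1 : s ≤ 1) (hA : 1 ≤ A)
    (hx : |x - s ^ 2 * g₁| ≤ A * s ^ 4) (hg : |g₁| ≤ A)
    (hy : |y - s * y₁| ≤ A * s ^ 3) (hy1 : |y₁| ≤ A)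
    (hm : |m - (1 - s ^ 2 * m₁)| ≤ A * s ^ 4) (hm1 : |m₁| ≤ A)
    (hn : |n + s * n₁| ≤ A * s ^ 3) (hn1 : |n₁| ≤ A) (hxE : |x| ≤ E) :
    |Real.exp x * (Real.cos y * m - Real.sin y * n)
      - (1 + s ^ 2 * (g₁ - y₁ ^ 2 / 2 - m₁ + y₁ * n₁))| ≤ 213 * A ^ 6 * s ^ 4 * Real.exp E := by
  have hE1 : 1 ≤ Real.exp E := Real.one_le_exp ((abs_nonneg x).trans hxE)
  have s2abs : |s ^ 2| ≤ s ^ 2 := (abs_of_nonneg (by positivity)).le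
  have hs2 : s ^ 2 ≤ 1 := pow_le_one₀ hs0 hs1
  have r1 := abs_exp_sub_expansion hs0 hs1 hA hx hg hxE
  obtain ⟨r6, hbb⟩ := abs_rotation_sub_le hs0 hs1 hA hy hy1 hm hm1 hn hn1
  set b := Real.cos y * m - Real.sin y * n with hb
  set β := -(y₁ ^ 2 / 2) - m₁ + y₁ * n₁ with hβ
  have hβb : |β| ≤ 3 * A ^ 2 := by
    have hy2 : |-(y₁ ^ 2 / 2)| ≤ A ^ 2 / 2 := by
      rw [abs_neg, abs_div, abs_two, abs_pow]; gcongr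
    have h1 := abs_add_le_of_le (abs_sub_le_of_le hy2 hm1) (abs_mul_le_of_le hy1 hn1)
    have : A ≤ A ^ 2 := le_self_pow₀ hA (by norm_num)
    linarith
  have hg1 : |1 + s ^ 2 * g₁| ≤ 2 * A := by
    have h1 := abs_add_le_of_le (abs_one (α := ℝ)).le (abs_mul_le_of_le s2abs hg)
    have h2 : s ^ 2 * A ≤ A := mul_le_of_le_one_left (by linarith) hs2
    linarith
  have h1 := abs_add_le_of_le (abs_mul_le_of_le r1 hbb) (abs_add_le_of_le (abs_mul_le_of_le hg1 r6)
    (abs_mul_le_of_le (abs_mul_le_of_le s2abs s2abs) (abs_mul_le_of_le hg hβb)))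
  have e : (Real.exp x - (1 + s ^ 2 * g₁)) * b + ((1 + s ^ 2 * g₁) * (b - (1 + s ^ 2 * β))
      + s ^ 2 * s ^ 2 * (g₁ * β)) = Real.exp x * b
      - (1 + s ^ 2 * (g₁ - y₁ ^ 2 / 2 - m₁ + y₁ * n₁)) := by rw [hβ]; ring
  rw [e] at h1
  have h7 : A ^ 3 * s ^ 4 ≤ A ^ 6 * s ^ 4 := by
    gcongr ?_ * s ^ 4
    exact pow_le_pow_right₀ hA (by norm_num)
  have h8 : A ^ 6 * s ^ 4 ≤ A ^ 6 * s ^ 4 * Real.exp E :=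
    le_mul_of_one_le_right (by positivity) hE1
  have h9 : A ^ 3 * s ^ 4 * Real.exp E ≤ A ^ 6 * s ^ 4 * Real.exp E := by gcongr
  have h10 : 0 ≤ A ^ 6 * s ^ 4 * Real.exp E := by positivity
  calc _ ≤ _ := h1
    _ = 25 * (A ^ 3 * s ^ 4 * Real.exp E) + 184 * (A ^ 6 * s ^ 4) + 3 * (A ^ 3 * s ^ 4) := by ring
    _ ≤ _ := by linarith

/-- Expansion of the normalised kernel `1 / ((1 + i α) (1 + i β))`. -/
lemma normalised_kernel_expansion {u v q : ℝ} (hu : u ≠ 0) (hv : v ≠ 0) :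
    |((u * v : ℝ) * kernel u v q).re - (1 - ((q / u) ^ 2 + (q / v) ^ 2 + q / u * (q / v)))|
        ≤ 2 * ((q / u) ^ 2 + (q / v) ^ 2) ^ 2 ∧
    |((u * v : ℝ) * kernel u v q).im + (q / u + q / v)|
        ≤ |q / u + q / v| * ((q / u) ^ 2 + (q / v) ^ 2) := by
  set α := q / u with hα
  set β := q / v with hβ
  set d := (1 + α ^ 2) * (1 + β ^ 2) with hd
  have hd1 : 1 + (α ^ 2 + β ^ 2) ≤ d := by rw [hd]; nlinarith [mul_nonneg (sq_nonneg α) (sq_nonneg β)]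
  have hd0 : 0 < d := by positivity
  have hS0 : 0 ≤ α ^ 2 + β ^ 2 := by positivity
  have hN : ((u * v : ℝ) : ℂ) * kernel u v q
      = (((1 - α * β) / d : ℝ) : ℂ) + ((-(α + β) / d : ℝ) : ℂ) * Complex.I := by
    have h1 : (u : ℂ) + q * Complex.I = u * (1 + α * Complex.I) := by
      rw [hα]; push_cast; have : (u : ℂ) ≠ 0 := by exact_mod_cast hu
      field_simp
    have h2 : (v : ℂ) + q * Complex.I = v * (1 + β * Complex.I) := by
      rw [hβ]; push_cast; have : (v : ℂ) ≠ 0 := by exact_mod_cast hv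
      field_simp
    have h3 : (1 : ℂ) + α * Complex.I ≠ 0 := by
      simpa using add_mul_I_ne_zero (u := 1) one_ne_zero α
    have h4 : (1 : ℂ) + β * Complex.I ≠ 0 := by
      simpa using add_mul_I_ne_zero (u := 1) one_ne_zero β
    have hu' : (u : ℂ) ≠ 0 := by exact_mod_cast hu
    have hv' : (v : ℂ) ≠ 0 := by exact_mod_cast hv
    have hd' : (d : ℂ) ≠ 0 := by exact_mod_cast hd0.ne'
    have h5 : (d : ℂ) = (1 + α * Complex.I) * (1 - α * Complex.I) * ((1 + β * Complex.I)
        * (1 - β * Complex.I)) := by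
      have hI := Complex.I_sq
      rw [hd]; push_cast
      linear_combination ((α : ℂ) ^ 2 * (1 + β ^ 2) + (β : ℂ) ^ 2 * (1 - Complex.I ^ 2 * α ^ 2)) * hI
    rw [kernel, h1, h2]
    have h6 : ((u * v : ℝ) : ℂ) * (u * (1 + α * Complex.I) * (v * (1 + β * Complex.I)))⁻¹
        = ((1 + α * Complex.I) * (1 + β * Complex.I))⁻¹ := by
      push_cast; field_simp
    rw [h6, eq_comm]
    refine eq_inv_of_mul_eq_one_left ?_
    push_cast
    have e : (1 - (α : ℂ) * β) / d + -(α + β) / d * Complex.I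
        = (1 - α * Complex.I) * (1 - β * Complex.I) / d := by
      field_simp
      linear_combination (-(α : ℂ) * β) * Complex.I_sq
    rw [e, div_mul_eq_mul_div, div_eq_one_iff_eq hd', h5]
    ring
  have hre : ((u * v : ℝ) * kernel u v q).re = (1 - α * β) / d := by rw [hN]; simp
  have him : ((u * v : ℝ) * kernel u v q).im = -(α + β) / d := by rw [hN]; simp
  have hP : |α * β| ≤ (α ^ 2 + β ^ 2) / 2 := by
    rw [abs_le]; constructor <;> nlinarith [sq_nonneg (α + β), sq_nonneg (α - β)]
  set S := α ^ 2 + β ^ 2 with hS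
  set Q := α * β with hQ
  have hdS : d = 1 + S + Q ^ 2 := by rw [hd, hS, hQ]; ring
  refine ⟨?_, ?_⟩
  · rw [hre]
    have e : (1 - Q) / d - (1 - (S + Q)) = (-Q ^ 2 + S ^ 2 + S * Q ^ 2 + Q * S + Q ^ 3) / d := by
      rw [div_sub' hd0.ne']; congr 1; rw [hdS]; ring
    rw [e, abs_div, abs_of_pos hd0, div_le_iff₀ hd0]
    obtain ⟨hP1, hP2⟩ := abs_le.1 hP
    have hQ2 : Q ^ 2 ≤ S ^ 2 / 4 := by nlinarith
    have hQ3 : |Q * Q ^ 2| ≤ S / 2 * (S ^ 2 / 4) := by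
      rw [abs_mul, abs_of_nonneg (sq_nonneg Q)]; gcongr
    obtain ⟨hQ3a, hQ3b⟩ := abs_le.1 hQ3
    have hQS : |Q * S| ≤ S / 2 * S := by
      rw [abs_mul, abs_of_nonneg hS0]; gcongr
    obtain ⟨hQSa, hQSb⟩ := abs_le.1 hQS
    have hSQ : S * Q ^ 2 ≤ S * (S ^ 2 / 4) := by gcongr
    have hSQ0 : 0 ≤ S * Q ^ 2 := by positivity
    have hQ20 := sq_nonneg Q
    have hbig : 2 * S ^ 2 * (1 + S) ≤ 2 * S ^ 2 * d := by gcongr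
    have hS2 := sq_nonneg S
    have hS3 : 0 ≤ S ^ 3 := by positivity
    rw [abs_le]
    constructor <;> linarith
  · rw [him]
    have e : -(α + β) / d + (α + β) = (α + β) * ((S + Q ^ 2) / d) := by
      rw [hdS]; have : 1 + S + Q ^ 2 ≠ 0 := by rw [← hdS]; exact hd0.ne'
      field_simp; ring
    rw [e, abs_mul]
    refine mul_le_mul_of_nonneg_left ?_ (abs_nonneg _)
    rw [abs_of_nonneg (by positivity), div_le_iff₀ hd0, hdS]
    obtain ⟨hP1, hP2⟩ := abs_le.1 hP
    have hQ2 : Q ^ 2 ≤ S ^ 2 := by nlinarith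
    nlinarith [mul_nonneg hS0 (sq_nonneg Q)]

/-! ### Expansion of the integrand near the saddlepoint. -/

/-- Even and odd parts of the Taylor expansion of a holomorphic function along a vertical line. -/
lemma taylor_vertical {F : ℂ → ℂ} {g : ℝ → ℝ} {u ρ C : ℝ} (hρ : 0 < ρ) (hρ1 : ρ ≤ 2)
    (hF : DifferentiableOn ℂ F (Metric.ball (u : ℂ) ρ))
    (hC : ∀ z ∈ Metric.ball (u : ℂ) ρ, ‖F z‖ ≤ C) (hg : ∀ x : ℝ, |x - u| < ρ → F x = g x)
    {q : ℝ} (hq : |q| ≤ ρ / 4) :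
    |(F (u + q * Complex.I)).re - g u| ≤ 2 * C * (2 / ρ) ^ 6 * |q| ^ 2 ∧
    |(F (u + q * Complex.I)).re - (g u - iteratedDeriv 2 g u / 2 * q ^ 2)|
      ≤ 2 * C * (2 / ρ) ^ 6 * |q| ^ 4 ∧
    |(F (u + q * Complex.I)).re - (g u - iteratedDeriv 2 g u / 2 * q ^ 2
      + iteratedDeriv 4 g u / 24 * q ^ 4)| ≤ 2 * C * (2 / ρ) ^ 6 * |q| ^ 6 ∧
    |(F (u + q * Complex.I)).im| ≤ 2 * C * (2 / ρ) ^ 6 * |q| ^ 1 ∧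
    |(F (u + q * Complex.I)).im - deriv g u * q| ≤ 2 * C * (2 / ρ) ^ 6 * |q| ^ 3 ∧
    |(F (u + q * Complex.I)).im - (deriv g u * q - iteratedDeriv 3 g u / 6 * q ^ 3)|
      ≤ 2 * C * (2 / ρ) ^ 6 * |q| ^ 5 := by
  have hC0 : 0 ≤ C := (norm_nonneg _).trans (hC u (Metric.mem_ball_self hρ))
  have hnorm : ‖(q : ℂ) * Complex.I‖ = |q| := by simp
  have huu : |u - u| < ρ := by simpa
  -- This allows every remainder, of whatever order up to 6, to carry the same constant (2/ρ)^6.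
  have h1ρ : 1 ≤ 2 / ρ := by rw [le_div_iff₀ hρ]; linarith
  have key : ∀ N ≤ 6, ‖F (u + q * Complex.I) - ∑ n ∈ Finset.range N,
      ((iteratedDeriv n g u : ℝ) : ℂ) / n.factorial * (q * Complex.I) ^ n‖
        ≤ 2 * C * (2 / ρ) ^ 6 * |q| ^ N := by
    intro N hN
    have := norm_sub_taylor_le hρ hF hC N (z := q * Complex.I) (by rw [hnorm]; exact hq)
    simp only [iteratedDeriv_ofReal_of_real _ F g hF hg u huu, hnorm] at this
    refine this.trans ?_
    gcongr
  have hI2 := Complex.I_sq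
  have hI3 : Complex.I ^ 3 = -Complex.I := by rw [pow_succ, hI2]; ring
  have hI4 : Complex.I ^ 4 = 1 := Complex.I_pow_four
  have hI5 : Complex.I ^ 5 = Complex.I := by rw [pow_succ, hI4]; ring
  have hre : ∀ N ≤ 6, ∀ a : ℝ, (∑ n ∈ Finset.range N,
      ((iteratedDeriv n g u : ℝ) : ℂ) / n.factorial * (q * Complex.I) ^ n).re = a →
      |(F (u + q * Complex.I)).re - a| ≤ 2 * C * (2 / ρ) ^ 6 * |q| ^ N := by
    intro N hN a ha
    rw [← ha, ← Complex.sub_re]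
    exact (Complex.abs_re_le_norm _).trans (key N hN)
  have him : ∀ N ≤ 6, ∀ a : ℝ, (∑ n ∈ Finset.range N,
      ((iteratedDeriv n g u : ℝ) : ℂ) / n.factorial * (q * Complex.I) ^ n).im = a →
      |(F (u + q * Complex.I)).im - a| ≤ 2 * C * (2 / ρ) ^ 6 * |q| ^ N := by
    intro N hN a ha
    rw [← ha, ← Complex.sub_im]
    exact (Complex.abs_im_le_norm _).trans (key N hN)
  have t0 : ((iteratedDeriv 0 g u : ℝ) : ℂ) / (Nat.factorial 0) * (q * Complex.I) ^ 0
      = ((g u : ℝ) : ℂ) := by simp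
  have t1 : ((iteratedDeriv 1 g u : ℝ) : ℂ) / (Nat.factorial 1) * (q * Complex.I) ^ 1
      = ((deriv g u * q : ℝ) : ℂ) * Complex.I := by simp [iteratedDeriv_one]; ring
  have t2 : ((iteratedDeriv 2 g u : ℝ) : ℂ) / (Nat.factorial 2) * (q * Complex.I) ^ 2
      = ((-(iteratedDeriv 2 g u / 2 * q ^ 2) : ℝ) : ℂ) := by
    rw [mul_pow, hI2]; push_cast [Nat.factorial]; ring
  have t3 : ((iteratedDeriv 3 g u : ℝ) : ℂ) / (Nat.factorial 3) * (q * Complex.I) ^ 3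
      = ((-(iteratedDeriv 3 g u / 6 * q ^ 3) : ℝ) : ℂ) * Complex.I := by
    rw [mul_pow, hI3]; push_cast [Nat.factorial]; ring
  have t4 : ((iteratedDeriv 4 g u : ℝ) : ℂ) / (Nat.factorial 4) * (q * Complex.I) ^ 4
      = ((iteratedDeriv 4 g u / 24 * q ^ 4 : ℝ) : ℂ) := by
    rw [mul_pow, hI4]; push_cast [Nat.factorial]; ring
  have t5 : ((iteratedDeriv 5 g u : ℝ) : ℂ) / (Nat.factorial 5) * (q * Complex.I) ^ 5
      = ((iteratedDeriv 5 g u / 120 * q ^ 5 : ℝ) : ℂ) * Complex.I := by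
    rw [mul_pow, hI5]; push_cast [Nat.factorial]; ring
  refine ⟨hre 2 (by norm_num) _ ?_, hre 4 (by norm_num) _ ?_, hre 6 le_rfl _ ?_, ?_,
    him 3 (by norm_num) _ ?_, him 5 (by norm_num) _ ?_⟩
  · simp only [Finset.sum_range_succ, Finset.sum_range_zero, t0, t1, zero_add, Complex.add_re,
      Complex.ofReal_re, Complex.re_ofReal_mul, Complex.I_re, mul_zero, add_zero]
  · simp only [Finset.sum_range_succ, Finset.sum_range_zero, t0, t1, t2, t3, zero_add,
      Complex.add_re, Complex.ofReal_re, Complex.re_ofReal_mul, Complex.I_re, mul_zero, add_zero]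
    ring
  · simp only [Finset.sum_range_succ, Finset.sum_range_zero, t0, t1, t2, t3, t4, t5, zero_add,
      Complex.add_re, Complex.ofReal_re, Complex.re_ofReal_mul, Complex.I_re, mul_zero, add_zero]
    ring
  · have := him 1 (by norm_num) 0 (by
      simp only [Finset.sum_range_succ, Finset.sum_range_zero, t0, zero_add, Complex.ofReal_im])
    rwa [sub_zero] at this
  · simp only [Finset.sum_range_succ, Finset.sum_range_zero, t0, t1, t2, zero_add,
      Complex.add_im, Complex.ofReal_im, Complex.im_ofReal_mul, Complex.I_im, mul_one, add_zero]
  · simp only [Finset.sum_range_succ, Finset.sum_range_zero, t0, t1, t2, t3, t4, zero_add,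
      Complex.add_im, Complex.ofReal_im, Complex.im_ofReal_mul, Complex.I_im, mul_one, add_zero]
    ring

/-- The coefficient of `ε` in the expansion of the rescaled saddlepoint integrand. -/
noncomputable def secondOrderTerm (Λ₀ Λ₁ : ℝ → ℝ) (u v t : ℝ) : ℝ :=
  iteratedDeriv 4 Λ₀ u / 24 * t ^ 4 - iteratedDeriv 2 Λ₁ u / 2 * t ^ 2
    - (deriv Λ₁ u * t - iteratedDeriv 3 Λ₀ u / 6 * t ^ 3) ^ 2 / 2
    - ((1 / u) ^ 2 + (1 / v) ^ 2 + 1 / u * (1 / v)) * t ^ 2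
    + (deriv Λ₁ u * t - iteratedDeriv 3 Λ₀ u / 6 * t ^ 3) * ((1 / u + 1 / v) * t)

lemma abs_pow_le_one_add_sq_pow (t : ℝ) {j : ℕ} (hj : j ≤ 6) : |t| ^ j ≤ (1 + t ^ 2) ^ 3 := by
  rcases le_or_gt |t| 1 with h | h
  · exact (pow_le_one₀ (abs_nonneg t) h).trans (one_le_pow₀ (by nlinarith [sq_nonneg t]))
  · calc |t| ^ j ≤ |t| ^ 6 := pow_le_pow_right₀ h.le hj
      _ = (t ^ 2) ^ 3 := by rw [← sq_abs]; ring
      _ ≤ _ := by gcongr; linarith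

/-- The normalised saddlepoint integrand on the vertical line through `u`. -/
noncomputable def saddleIntegrand (F : ℝ → ℂ → ℂ) (k u v ε q : ℝ) : ℂ :=
  Complex.exp ((F ε (u + q * Complex.I) - F ε u - k * (q * Complex.I)) / ε)
    * ((u * v : ℝ) * kernel u v q)

/-- `normalised_kernel_expansion` at q = s t. Bounding 1/v by `U` makes it uniform in the second
pole, which moves with ε. -/
lemma kernel_expansion_scaled {u v U s t A : ℝ} (hu : u ≠ 0) (hv : v ≠ 0) (hU : 1 ≤ U)
    (huU : |1 / u| ≤ U) (hvU : |1 / v| ≤ U) (hs : 0 ≤ s) (hA : 8 * U ^ 4 * (1 + t ^ 2) ^ 3 ≤ A) :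
    |((u * v : ℝ) * kernel u v (s * t)).re
        - (1 - s ^ 2 * (((1 / u) ^ 2 + (1 / v) ^ 2 + 1 / u * (1 / v)) * t ^ 2))| ≤ A * s ^ 4 ∧
    |((1 / u) ^ 2 + (1 / v) ^ 2 + 1 / u * (1 / v)) * t ^ 2| ≤ A ∧
    |((u * v : ℝ) * kernel u v (s * t)).im + s * ((1 / u + 1 / v) * t)| ≤ A * s ^ 3 ∧
    |(1 / u + 1 / v) * t| ≤ A := by
  obtain ⟨h1, h2⟩ := normalised_kernel_expansion (q := s * t) hu hv
  set a := 1 / u with ha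
  set b := 1 / v with hb
  have ea : s * t / u = a * (s * t) := by rw [ha]; ring
  have eb : s * t / v = b * (s * t) := by rw [hb]; ring
  rw [ea, eb] at h1 h2
  have hU0 : 0 ≤ U := by linarith
  have hab : |a ^ 2 + b ^ 2| ≤ 2 * U ^ 2 := by
    have := abs_add_le_of_le (abs_mul_le_of_le huU huU) (abs_mul_le_of_le hvU hvU)
    rw [← sq, ← sq] at this
    linarith
  have hab2 : |a ^ 2 + b ^ 2 + a * b| ≤ 3 * U ^ 2 := by
    have := abs_add_le_of_le hab (abs_mul_le_of_le huU hvU)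
    linarith
  have hab1 : |a + b| ≤ 2 * U := by
    have := abs_add_le_of_le huU hvU
    linarith
  have hU2 : U ^ 2 ≤ U ^ 4 := pow_le_pow_right₀ hU (by norm_num)
  have hU3 : U ^ 3 ≤ U ^ 4 := pow_le_pow_right₀ hU (by norm_num)
  have hU1 : U ≤ U ^ 4 := le_self_pow₀ hU (by norm_num)
  have p1 := abs_pow_le_one_add_sq_pow t (j := 1) (by norm_num)
  have p2 := abs_pow_le_one_add_sq_pow t (j := 2) (by norm_num)
  have p3 := abs_pow_le_one_add_sq_pow t (j := 3) (by norm_num)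
  have p4 := abs_pow_le_one_add_sq_pow t (j := 4) (by norm_num)
  have hab0 : 0 ≤ a ^ 2 + b ^ 2 := by positivity
  rw [abs_of_nonneg hab0] at hab
  refine ⟨?_, ?_, ?_, ?_⟩
  · have e : (a * (s * t)) ^ 2 + (b * (s * t)) ^ 2 + a * (s * t) * (b * (s * t))
        = s ^ 2 * ((a ^ 2 + b ^ 2 + a * b) * t ^ 2) := by ring
    rw [e] at h1
    refine h1.trans ?_
    calc 2 * ((a * (s * t)) ^ 2 + (b * (s * t)) ^ 2) ^ 2
        = 2 * (a ^ 2 + b ^ 2) ^ 2 * |t| ^ 4 * s ^ 4 := by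
          have : |t| ^ 4 = t ^ 4 := by rw [← abs_pow, abs_of_nonneg (by positivity)]
          rw [this]; ring
      _ ≤ 2 * (2 * U ^ 2) ^ 2 * (1 + t ^ 2) ^ 3 * s ^ 4 := by gcongr
      _ = 8 * U ^ 4 * (1 + t ^ 2) ^ 3 * s ^ 4 := by ring
      _ ≤ A * s ^ 4 := by gcongr
  · rw [abs_mul, abs_pow]
    calc _ ≤ 3 * U ^ 2 * (1 + t ^ 2) ^ 3 := by gcongr
      _ ≤ 8 * U ^ 4 * (1 + t ^ 2) ^ 3 := by gcongr; norm_num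
      _ ≤ A := hA
  · have e : a * (s * t) + b * (s * t) = s * ((a + b) * t) := by ring
    rw [e] at h2
    refine h2.trans ?_
    calc |s * ((a + b) * t)| * ((a * (s * t)) ^ 2 + (b * (s * t)) ^ 2)
        = |a + b| * (a ^ 2 + b ^ 2) * |t| ^ 3 * s ^ 3 := by
          rw [abs_mul, abs_mul, abs_of_nonneg hs]
          have : |t| ^ 3 = |t| * t ^ 2 := by rw [← sq_abs t]; ring
          rw [this]; ring
      _ ≤ 2 * U * (2 * U ^ 2) * (1 + t ^ 2) ^ 3 * s ^ 3 := by gcongr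
      _ = 4 * U ^ 3 * (1 + t ^ 2) ^ 3 * s ^ 3 := by ring
      _ ≤ 8 * U ^ 4 * (1 + t ^ 2) ^ 3 * s ^ 3 := by gcongr; norm_num
      _ ≤ A * s ^ 3 := by gcongr
  · rw [abs_mul]
    rw [pow_one] at p1
    calc _ ≤ 2 * U * (1 + t ^ 2) ^ 3 := by gcongr
      _ ≤ 8 * U ^ 4 * (1 + t ^ 2) ^ 3 := by gcongr; norm_num
      _ ≤ A := hA

/-- Expansion of the exponent of the saddlepoint integrand in the rescaled variable. -/
lemma LocalExpansion.exponent_expansion {Ω : Type*} [MeasurableSpace Ω] {P : Measure Ω}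
    {Y : ℝ → Ω → ℝ} {D : Set ℝ} {Λ₀ Λ₁ : ℝ → ℝ} {u r B ε₁ : ℝ} {F : ℝ → ℂ → ℂ} {F₀ F₁ : ℂ → ℂ}
    (h : LocalExpansion P Y D Λ₀ Λ₁ u r B ε₁ F F₀ F₁) :
    ∃ ρ > 0, ρ ≤ r ∧ ∃ K ≥ 0, ∀ s t : ℝ, 0 < s → s ^ 2 < ε₁ → |s * t| ≤ ρ →
      let w := (F (s ^ 2) (u + (s * t : ℝ) * Complex.I) - F (s ^ 2) u
        - deriv Λ₀ u * ((s * t : ℝ) * Complex.I)) / (s ^ 2 : ℝ)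
      |w.re + iteratedDeriv 2 Λ₀ u / 2 * t ^ 2 - s ^ 2 * (iteratedDeriv 4 Λ₀ u / 24 * t ^ 4
          - iteratedDeriv 2 Λ₁ u / 2 * t ^ 2)| ≤ K * s ^ 4 * (|t| ^ 6 + |t| ^ 4 + |t| ^ 2) ∧
      |w.im - s * (deriv Λ₁ u * t - iteratedDeriv 3 Λ₀ u / 6 * t ^ 3)|
        ≤ K * s ^ 3 * (|t| ^ 5 + |t| ^ 3 + |t|) := by
  have hr := h.r_pos
  obtain ⟨C₀, hC₀, hF₀⟩ := exists_bound_on_half_ball hr h.diff₀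
  obtain ⟨C₁, hC₁, hF₁⟩ := exists_bound_on_half_ball hr h.diff₁
  have hB := h.B_nonneg
  set ρ := min (r / 2) 2 with hρdef
  have hρ : 0 < ρ := by positivity
  have hρ2 : ρ ≤ 2 := min_le_right _ _
  have hρr : ρ ≤ r / 2 := min_le_left _ _
  set M := (2 / ρ) ^ 6 with hM
  have hM0 : 0 ≤ M := by positivity
  set C := C₀ + C₁ + B with hC
  refine ⟨ρ / 4, by positivity, by linarith, 2 * C * M, by positivity, ?_⟩
  intro s t hs hsε hst w
  have hε : s ^ 2 ∈ Ioo 0 ε₁ := ⟨by positivity, hsε⟩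
  set ε := s ^ 2 with hεdef
  have hε0 : 0 < ε := hε.1
  set q := s * t with hq
  have hsub : Metric.ball (u : ℂ) ρ ⊆ Metric.ball (u : ℂ) r := Metric.ball_subset_ball (by linarith)
  have hsub2 : Metric.ball (u : ℂ) ρ ⊆ Metric.ball (u : ℂ) (r / 2) := Metric.ball_subset_ball hρr
  have hreal : ∀ x : ℝ, |x - u| < ρ → |x - u| < r := fun x hx => by linarith
  have T0 := taylor_vertical hρ hρ2 (h.diff₀.mono hsub) (fun z hz => hF₀ z (hsub2 hz))
    (fun x hx => h.real₀ x (hreal x hx)) hst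
  have T1 := taylor_vertical hρ hρ2 (h.diff₁.mono hsub) (fun z hz => hF₁ z (hsub2 hz))
    (fun x hx => h.real₁ x (hreal x hx)) hst
  -- The remainder is holomorphic and O(ε²), so Cauchy's estimates pass the factor ε² on to its
  -- Taylor bounds, and the lowest orders suffice.
  have T2 := taylor_vertical (F := fun z => F ε z - F₀ z - ε * F₁ z)
    (g := fun x => lmgf P Y ε x - Λ₀ x - ε * Λ₁ x) hρ hρ2
    (((h.diff ε hε).sub h.diff₀).sub (h.diff₁.const_mul _) |>.mono hsub)
    (fun z hz => h.bound ε hε z (hsub hz))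
    (fun x hx => by
      simp only [h.real ε hε x (hreal x hx), h.real₀ x (hreal x hx), h.real₁ x (hreal x hx)]
      push_cast; rfl) hst
  obtain ⟨-, -, a6, -, -, a5⟩ := T0
  obtain ⟨-, b4, -, -, b3, -⟩ := T1
  obtain ⟨c2, -, -, c1, -, -⟩ := T2
  rw [pow_one] at c1
  have huu : |u - u| < r := by simpa
  set z : ℂ := u + q * Complex.I with hz
  -- Subtracting the value at `u` removes the order-zero terms, and Λ₀'(u) removes the linear term
  -- of F₀. After division by ε = s², the errors q⁶, ε q⁴ and ε² q² are each s⁴ times a power of t;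
  -- q⁵, ε q³ and ε² q give s³.
  have hw : w = (((F₀ z - Λ₀ u - deriv Λ₀ u * (q * Complex.I)) + ε * (F₁ z - Λ₁ u)
      + ((F ε z - F₀ z - ε * F₁ z) - (lmgf P Y ε u - Λ₀ u - ε * Λ₁ u : ℝ))) / (ε : ℝ)) := by
    change (F ε z - F ε u - deriv Λ₀ u * (q * Complex.I)) / (ε : ℝ) = _
    rw [h.real ε hε u huu]
    push_cast
    ring
  have hwre : w.re = (((F₀ z).re - Λ₀ u) + ε * ((F₁ z).re - Λ₁ u)
      + ((F ε z - F₀ z - ε * F₁ z).re - (lmgf P Y ε u - Λ₀ u - ε * Λ₁ u))) / ε := by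
    rw [hw, Complex.div_ofReal_re]
    simp only [Complex.add_re, Complex.sub_re, Complex.re_ofReal_mul, Complex.ofReal_re,
      Complex.I_re, mul_zero, sub_zero]
  have hwim : w.im = (((F₀ z).im - deriv Λ₀ u * q) + ε * (F₁ z).im
      + (F ε z - F₀ z - ε * F₁ z).im) / ε := by
    rw [hw, Complex.div_ofReal_im]
    simp only [Complex.add_im, Complex.sub_im, Complex.im_ofReal_mul, Complex.ofReal_im,
      Complex.I_im, mul_one, sub_zero]
  have hεs : ε ^ 2 = s ^ 4 := by rw [hεdef]; ring
  have hqabs : |q| = s * |t| := by rw [hq, abs_mul, abs_of_pos hs]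
  have hC₀C : C₀ ≤ C := by rw [hC]; linarith
  have hC₁C : C₁ ≤ C := by rw [hC]; linarith
  have hBC : B ≤ C := by rw [hC]; linarith
  constructor
  · have h1 := abs_add_le_of_le (abs_add_le_of_le a6
      (abs_mul_le_of_le (abs_of_pos hε0).le b4)) c2
    have e : w.re + iteratedDeriv 2 Λ₀ u / 2 * t ^ 2 - ε * (iteratedDeriv 4 Λ₀ u / 24 * t ^ 4
          - iteratedDeriv 2 Λ₁ u / 2 * t ^ 2)
        = ((F₀ z).re - (Λ₀ u - iteratedDeriv 2 Λ₀ u / 2 * q ^ 2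
            + iteratedDeriv 4 Λ₀ u / 24 * q ^ 4)
          + ε * ((F₁ z).re - (Λ₁ u - iteratedDeriv 2 Λ₁ u / 2 * q ^ 2))
          + ((F ε z - F₀ z - ε * F₁ z).re - (lmgf P Y ε u - Λ₀ u - ε * Λ₁ u))) / ε := by
      rw [hwre, eq_div_iff hε0.ne', sub_mul, add_mul, div_mul_cancel₀ _ hε0.ne', hq, hεdef]
      ring
    rw [e, abs_div, abs_of_pos hε0, div_le_iff₀ hε0]
    refine h1.trans ?_
    rw [hqabs]
    calc _ ≤ 2 * C * M * (s * |t|) ^ 6 + ε * (2 * C * M * (s * |t|) ^ 4)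
          + 2 * (C * ε ^ 2) * M * (s * |t|) ^ 2 := by gcongr
      _ = _ := by rw [hεdef]; ring
  · have h1 := abs_add_le_of_le (abs_add_le_of_le a5
      (abs_mul_le_of_le (abs_of_pos hε0).le b3)) c1
    have e : w.im - s * (deriv Λ₁ u * t - iteratedDeriv 3 Λ₀ u / 6 * t ^ 3)
        = ((F₀ z).im - (deriv Λ₀ u * q - iteratedDeriv 3 Λ₀ u / 6 * q ^ 3)
          + ε * ((F₁ z).im - deriv Λ₁ u * q) + (F ε z - F₀ z - ε * F₁ z).im) / ε := by
      rw [hwim, eq_div_iff hε0.ne', sub_mul, div_mul_cancel₀ _ hε0.ne', hq, hεdef]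
      ring
    rw [e, abs_div, abs_of_pos hε0, div_le_iff₀ hε0]
    refine h1.trans ?_
    rw [hqabs]
    calc _ ≤ 2 * C * M * (s * |t|) ^ 5 + ε * (2 * C * M * (s * |t|) ^ 3)
          + 2 * (C * ε ^ 2) * M * (s * |t|) := by gcongr
      _ = _ := by rw [hεdef]; ring

/-- On |s t| ≤ δ the correction to the Gaussian exponent is at most half of it: each monomial is t²
times factors s² or (s t)², small by the choice of δ and s. -/
lemma abs_exponent_le {K K₁ d₄ e₂ s t δ σ x : ℝ} (hK : 0 ≤ K) (hs0 : 0 < s) (hs1 : s ≤ 1)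
    (hδ0 : 0 < δ) (hδ1 : δ ≤ 1) (hK₁0 : 0 < K₁) (hK₁ : 3 * K + |d₄| + |e₂| ≤ K₁)
    (hδσ : δ ^ 2 ≤ σ / (8 * K₁)) (hsσ : s ^ 2 ≤ σ / (8 * K₁)) (hst : |s * t| ≤ δ)
    (hx : |x - s ^ 2 * (d₄ / 24 * t ^ 4 - e₂ / 2 * t ^ 2)|
      ≤ K * s ^ 4 * (|t| ^ 6 + |t| ^ 4 + |t| ^ 2)) : |x| ≤ σ / 4 * t ^ 2 := by
  have n1 := abs_nonneg d₄
  have n2 := abs_nonneg e₂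
  have hq2 : s ^ 2 * t ^ 2 ≤ δ ^ 2 := by
    rw [← mul_pow, ← sq_abs]; gcongr
  have hq0 : 0 ≤ s ^ 2 * t ^ 2 := by positivity
  have h1 : |s ^ 2 * (d₄ / 24 * t ^ 4 - e₂ / 2 * t ^ 2)| ≤ (|d₄| * δ ^ 2 + |e₂| * s ^ 2) * t ^ 2 := by
    have e : s ^ 2 * (d₄ / 24 * t ^ 4 - e₂ / 2 * t ^ 2)
        = d₄ / 24 * (s ^ 2 * t ^ 2) * t ^ 2 - e₂ / 2 * s ^ 2 * t ^ 2 := by ring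
    have a1 : |d₄ / 24 * (s ^ 2 * t ^ 2) * t ^ 2| ≤ |d₄| * δ ^ 2 * t ^ 2 := by
      rw [abs_mul, abs_mul, abs_of_nonneg hq0, abs_of_nonneg (sq_nonneg t), abs_div]
      have : |(24 : ℝ)| = 24 := by norm_num
      rw [this]; gcongr; linarith
    have a2 : |e₂ / 2 * s ^ 2 * t ^ 2| ≤ |e₂| * s ^ 2 * t ^ 2 := by
      rw [abs_mul, abs_mul, abs_of_nonneg (sq_nonneg t), abs_of_nonneg (sq_nonneg s), abs_div,
        abs_two]
      gcongr; linarith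
    rw [e]
    exact (abs_sub_le_of_le a1 a2).trans (le_of_eq (by ring))
  have h2 := abs_le_of_sub hx h1
  have e2 : K * s ^ 4 * (|t| ^ 6 + |t| ^ 4 + |t| ^ 2)
      = K * ((s ^ 2 * t ^ 2) * (s ^ 2 * t ^ 2) + s ^ 2 * (s ^ 2 * t ^ 2) + s ^ 2 * s ^ 2) * t ^ 2 := by
    have x6 : |t| ^ 6 = t ^ 6 := by rw [← abs_pow, abs_of_nonneg (by positivity)]
    have x4 : |t| ^ 4 = t ^ 4 := by rw [← abs_pow, abs_of_nonneg (by positivity)]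
    rw [x6, x4, sq_abs]; ring
  rw [e2] at h2
  have hs2 : s ^ 2 ≤ 1 := pow_le_one₀ hs0.le hs1
  have hδ2 : δ ^ 2 ≤ 1 := pow_le_one₀ hδ0.le hδ1
  have h3 : (s ^ 2 * t ^ 2) * (s ^ 2 * t ^ 2) + s ^ 2 * (s ^ 2 * t ^ 2) + s ^ 2 * s ^ 2
      ≤ δ ^ 2 * 1 + s ^ 2 * 1 + s ^ 2 * 1 := by
    gcongr <;> linarith
  calc _ ≤ _ := h2
    _ ≤ K * (δ ^ 2 * 1 + s ^ 2 * 1 + s ^ 2 * 1) * t ^ 2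
        + (|d₄| * δ ^ 2 + |e₂| * s ^ 2) * t ^ 2 := by gcongr
    _ = ((K + |d₄|) * δ ^ 2 + (2 * K + |e₂|) * s ^ 2) * t ^ 2 := by ring
    _ ≤ (K₁ * δ ^ 2 + K₁ * s ^ 2) * t ^ 2 := by
        gcongr <;> linarith
    _ ≤ (K₁ * (σ / (8 * K₁)) + K₁ * (σ / (8 * K₁))) * t ^ 2 := by gcongr
    _ = σ / 4 * t ^ 2 := by field_simp; ring

lemma exp_mul_le_of_le {σ t s a M : ℝ}
    (h : a ≤ 213 * (M * (1 + t ^ 2) ^ 3) ^ 6 * s ^ 4 * Real.exp (σ / 4 * t ^ 2)) :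
    Real.exp (-(σ / 2) * t ^ 2) * a
      ≤ 213 * M ^ 6 * s ^ 4 * ((1 + t ^ 2) ^ 18 * Real.exp (-(σ / 4) * t ^ 2)) := by
  have e1 : Real.exp (-(σ / 4) * t ^ 2)
      = Real.exp (-(σ / 2) * t ^ 2) * Real.exp (σ / 4 * t ^ 2) := by
    rw [← Real.exp_add]; ring_nf
  rw [e1]
  refine (mul_le_mul_of_nonneg_left h (Real.exp_pos _).le).trans (le_of_eq ?_)
  generalize Real.exp (-(σ / 2) * t ^ 2) = X
  generalize Real.exp (σ / 4 * t ^ 2) = Z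
  ring

set_option maxHeartbeats 400000 in
/-- Second order pointwise expansion of the rescaled saddlepoint integrand. -/
lemma LocalExpansion.integrand_expansion {Ω : Type*} [MeasurableSpace Ω] {P : Measure Ω}
    {Y : ℝ → Ω → ℝ} {D : Set ℝ} {Λ₀ Λ₁ : ℝ → ℝ} {u r B ε₁ : ℝ} {F : ℝ → ℂ → ℂ} {F₀ F₁ : ℂ → ℂ}
    (h : LocalExpansion P Y D Λ₀ Λ₁ u r B ε₁ F F₀ F₁) (hσ : 0 < iteratedDeriv 2 Λ₀ u)
    (hu : u ≠ 0) {v₀ : ℝ} (hv₀ : 0 < v₀) :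
    ∃ δ > 0, δ ≤ r ∧ ∃ K ≥ 0, ∃ s₁ > 0, ∀ s ∈ Ioo 0 s₁, ∀ v : ℝ, v₀ ≤ |v| → ∀ t : ℝ,
      |s * t| ≤ δ → |(saddleIntegrand F (deriv Λ₀ u) u v (s ^ 2) (s * t)).re
        - Real.exp (-(iteratedDeriv 2 Λ₀ u / 2) * t ^ 2)
          * (1 + s ^ 2 * secondOrderTerm Λ₀ Λ₁ u v t)|
        ≤ K * s ^ 4 * ((1 + t ^ 2) ^ 18 * Real.exp (-(iteratedDeriv 2 Λ₀ u / 4) * t ^ 2)) := by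
  obtain ⟨ρ, hρ, hρr, K, hK, hexp⟩ := h.exponent_expansion
  set σ := iteratedDeriv 2 Λ₀ u with hσdef
  set d₃ := iteratedDeriv 3 Λ₀ u with hd₃
  set d₄ := iteratedDeriv 4 Λ₀ u with hd₄
  set e₁ := deriv Λ₁ u with he₁
  set e₂ := iteratedDeriv 2 Λ₁ u with he₂
  set U := 1 + |1 / u| + 1 / v₀ with hU
  have hU1 : 1 ≤ U := by
    have : 0 < 1 / v₀ := by positivity
    rw [hU]; linarith [abs_nonneg (1 / u)]
  have huU : |1 / u| ≤ U := by
    have : 0 < 1 / v₀ := by positivity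
    rw [hU]; linarith
  set K₁ := 1 + 3 * K + |d₄| + |e₂| + |e₁| + |d₃| + 8 * U ^ 4 with hK₁
  have hU4 : 0 ≤ U ^ 4 := by positivity
  have n1 := abs_nonneg d₄
  have n2 := abs_nonneg e₂
  have n3 := abs_nonneg e₁
  have n4 := abs_nonneg d₃
  have hK₁1 : 1 ≤ K₁ := by rw [hK₁]; linarith
  have hK₁0 : 0 < K₁ := by linarith
  set δ := min (min ρ 1) (√(σ / (8 * K₁))) with hδ
  have hδ0 : 0 < δ := by positivity
  have hδ1 : δ ≤ 1 := (min_le_left _ _).trans (min_le_right _ _)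
  have hδρ : δ ≤ ρ := (min_le_left _ _).trans (min_le_left _ _)
  have hδσ : δ ^ 2 ≤ σ / (8 * K₁) := by
    calc δ ^ 2 ≤ √(σ / (8 * K₁)) ^ 2 := by gcongr; exact min_le_right _ _
      _ = _ := Real.sq_sqrt (by positivity)
  set s₁ := min (min 1 (√ε₁)) (√(σ / (8 * K₁))) with hs₁
  have hε₁ := h.ε_pos
  refine ⟨δ, hδ0, hδρ.trans hρr, 213 * K₁ ^ 6, by positivity, s₁, by positivity, ?_⟩
  intro s hs v hv t hst
  have hs0 := hs.1
  have hs1 : s ≤ 1 := (hs.2.le.trans (min_le_left _ _)).trans (min_le_left _ _)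
  have hsε : s ^ 2 < ε₁ := by
    rw [← Real.lt_sqrt hs0.le]
    exact (hs.2.trans_le (min_le_left _ _)).trans_le (min_le_right _ _)
  have hsσ : s ^ 2 ≤ σ / (8 * K₁) := by
    calc s ^ 2 ≤ √(σ / (8 * K₁)) ^ 2 := by gcongr; exact hs.2.le.trans (min_le_right _ _)
      _ = _ := Real.sq_sqrt (by positivity)
  have hv0 : v ≠ 0 := by rintro rfl; simp at hv; linarith
  have hvU : |1 / v| ≤ U := by
    rw [abs_div, abs_one]
    have : 1 / |v| ≤ 1 / v₀ := one_div_le_one_div_of_le hv₀ hv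
    rw [hU]; linarith [abs_nonneg (1 / u)]
  obtain ⟨hx, hy⟩ := hexp s t hs0 hsε (hst.trans hδρ)
  set w := (F (s ^ 2) (u + (s * t : ℝ) * Complex.I) - F (s ^ 2) u
        - deriv Λ₀ u * ((s * t : ℝ) * Complex.I)) / (s ^ 2 : ℝ) with hw
  set T := (1 + t ^ 2) ^ 3 with hT
  have hT1 : 1 ≤ T := one_le_pow₀ (by nlinarith [sq_nonneg t])
  have p1 := abs_pow_le_one_add_sq_pow t (j := 1) (by norm_num)
  have p2 := abs_pow_le_one_add_sq_pow t (j := 2) (by norm_num)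
  have p3 := abs_pow_le_one_add_sq_pow t (j := 3) (by norm_num)
  have p4 := abs_pow_le_one_add_sq_pow t (j := 4) (by norm_num)
  have p5 := abs_pow_le_one_add_sq_pow t (j := 5) (by norm_num)
  have p6 := abs_pow_le_one_add_sq_pow t (j := 6) (by norm_num)
  rw [pow_one] at p1
  -- The coefficients are bounded by powers of |t| up to the sixth, so a multiple of (1 + t²)³
  -- dominates them all. Its sixth power in `abs_exp_mul_sub_le` is the source of (1 + t²)^18.
  set A := K₁ * T with hA
  have hA1 : 1 ≤ A := one_le_mul_of_one_le_of_one_le hK₁1 hT1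
  have hT0 : 0 ≤ T := by linarith
  have h3K : 3 * K * T ≤ A := by
    rw [hA]; gcongr; rw [hK₁]; linarith
  obtain ⟨k1, k2, k3, k4⟩ := kernel_expansion_scaled (s := s) (t := t) (A := A) hu hv0 hU1 huU hvU
    hs0.le (by rw [hA]; gcongr; rw [hK₁]; linarith)
  have hg1 : |d₄ / 24 * t ^ 4 - e₂ / 2 * t ^ 2| ≤ A := by
    have h1 : |d₄ / 24 * t ^ 4| ≤ |d₄| * T := by
      rw [abs_mul, abs_pow, abs_div]
      have : |(24 : ℝ)| = 24 := by norm_num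
      rw [this]; gcongr; linarith
    have h2 : |e₂ / 2 * t ^ 2| ≤ |e₂| * T := by
      rw [abs_mul, abs_pow, abs_div, abs_two]; gcongr; linarith
    calc _ ≤ |d₄| * T + |e₂| * T := abs_sub_le_of_le h1 h2
      _ = (|d₄| + |e₂|) * T := by ring
      _ ≤ A := by rw [hA]; gcongr; rw [hK₁]; linarith
  have hy1 : |e₁ * t - d₃ / 6 * t ^ 3| ≤ A := by
    have h1 : |e₁ * t| ≤ |e₁| * T := by rw [abs_mul]; gcongr
    have h2 : |d₃ / 6 * t ^ 3| ≤ |d₃| * T := by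
      rw [abs_mul, abs_pow, abs_div]
      have : |(6 : ℝ)| = 6 := by norm_num
      rw [this]; gcongr; linarith
    calc _ ≤ |e₁| * T + |d₃| * T := abs_sub_le_of_le h1 h2
      _ = (|e₁| + |d₃|) * T := by ring
      _ ≤ A := by rw [hA]; gcongr; rw [hK₁]; linarith
  have hx' : |w.re + σ / 2 * t ^ 2 - s ^ 2 * (d₄ / 24 * t ^ 4 - e₂ / 2 * t ^ 2)| ≤ A * s ^ 4 := by
    refine hx.trans ?_
    calc _ ≤ K * s ^ 4 * (T + T + T) := by gcongr
      _ = 3 * K * T * s ^ 4 := by ring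
      _ ≤ A * s ^ 4 := by gcongr
  have hy' : |w.im - s * (e₁ * t - d₃ / 6 * t ^ 3)| ≤ A * s ^ 3 := by
    refine hy.trans ?_
    calc _ ≤ K * s ^ 3 * (T + T + T) := by gcongr
      _ = 3 * K * T * s ^ 3 := by ring
      _ ≤ A * s ^ 3 := by gcongr
  have hxE : |w.re + σ / 2 * t ^ 2| ≤ σ / 4 * t ^ 2 :=
    abs_exponent_le hK hs0 hs1 hδ0 hδ1 hK₁0 (by rw [hK₁]; linarith) hδσ hsσ hst hx
  have main := abs_exp_mul_sub_le hs0.le hs1 hA1 hx' hg1 hy' hy1 k1 k2 k3 k4 hxE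
  have hΦ : (saddleIntegrand F (deriv Λ₀ u) u v (s ^ 2) (s * t)).re
      = Real.exp (-(σ / 2) * t ^ 2) * (Real.exp (w.re + σ / 2 * t ^ 2)
        * (Real.cos w.im * ((u * v : ℝ) * kernel u v (s * t)).re
          - Real.sin w.im * ((u * v : ℝ) * kernel u v (s * t)).im)) := by
    rw [saddleIntegrand, ← hw, Complex.mul_re, Complex.exp_re, Complex.exp_im, ← mul_assoc,
      ← Real.exp_add]
    have : -(σ / 2) * t ^ 2 + (w.re + σ / 2 * t ^ 2) = w.re := by ring
    rw [this]; ring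
  rw [hΦ, ← mul_sub, abs_mul, abs_of_pos (Real.exp_pos _)]
  exact exp_mul_le_of_le main

/-! ### Exponential smallness away from the real axis. -/

/-- The moment generating functions are uniformly exponentially smaller than `exp (l / ε)` on the
part `S` of the vertical line through `u`. -/
def SmallerThan {Ω : Type*} [MeasurableSpace Ω] (P : Measure Ω) (Y : ℝ → Ω → ℝ) (u l : ℝ)
    (S : Set ℝ) : Prop :=
  ∃ η > 0, ∃ C : ℝ, ∃ ε₁ > 0, ∀ ε ∈ Ioo 0 ε₁, ∀ q ∈ S,
    ‖cmgf P Y ε ⟨u, q⟩‖ ≤ Real.exp ((l - η) / ε + C)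

section

variable {Ω : Type*} [MeasurableSpace Ω] {P : Measure Ω} {Y : ℝ → Ω → ℝ}

lemma SmallerThan.mono {u l : ℝ} {S T : Set ℝ} (h : SmallerThan P Y u l T) (hST : S ⊆ T) :
    SmallerThan P Y u l S := by
  obtain ⟨η, hη, C, ε₁, hε₁, h⟩ := h
  exact ⟨η, hη, C, ε₁, hε₁, fun ε hε q hq => h ε hε q (hST hq)⟩

lemma SmallerThan.union {u l : ℝ} {S T : Set ℝ} (hS : SmallerThan P Y u l S)
    (hT : SmallerThan P Y u l T) : SmallerThan P Y u l (S ∪ T) := by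
  obtain ⟨η, hη, C, ε₁, hε₁, h⟩ := hS
  obtain ⟨η', hη', C', ε₁', hε₁', h'⟩ := hT
  refine ⟨min η η', lt_min hη hη', max C C', min ε₁ ε₁', lt_min hε₁ hε₁', ?_⟩
  intro ε hε q hq
  have hε0 : 0 < ε := hε.1
  rcases hq with hq | hq
  · refine (h ε ⟨hε.1, hε.2.trans_le (min_le_left _ _)⟩ q hq).trans ?_
    gcongr
    · exact min_le_left _ _
    · exact le_max_left _ _
  · refine (h' ε ⟨hε.1, hε.2.trans_le (min_le_right _ _)⟩ q hq).trans ?_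
    gcongr
    · exact min_le_right _ _
    · exact le_max_right _ _

lemma norm_cmgf_eq_exp {ε : ℝ} (hε : 0 < ε) {w : ℂ} (hw : cmgf P Y ε w ≠ 0) :
    ‖cmgf P Y ε w‖ = Real.exp (reLmgf P Y ε w / ε) := by
  rw [reLmgf, mul_div_cancel_left₀ _ hε.ne', Real.exp_log (norm_pos_iff.2 hw)]

lemma TailControl.exists_ball {D : Set ℝ} {L : ℂ → ℝ} (hL : TailControl P Y D L) {w : ℂ}
    (hw : w.re ∈ interior D \ {0}) : ∃ ε₁ > 0, ∃ ρ > 0, ∃ C > 0, ∀ ε ∈ Ioo 0 ε₁,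
      ∀ z ∈ Metric.ball w ρ, cmgf P Y ε z ≠ 0 ∧ |reLmgf P Y ε z - L z| ≤ C * ε := by
  obtain ⟨hne, hO⟩ := hL.limit w hw
  obtain ⟨C, hC, hO⟩ := hO.exists_pos
  obtain ⟨ε₁, hε₁, ρ, hρ, h⟩ := eventually_prod_nhdsGT (hne.and hO.bound)
  refine ⟨ε₁, hε₁, ρ, hρ, C, hC, fun ε hε z hz => ?_⟩
  obtain ⟨h1, h2⟩ := h ε hε z hz
  simp only [Real.norm_eq_abs, abs_of_pos hε.1] at h2
  exact ⟨h1, h2⟩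

/-- No continuity of `L` is assumed, so the gap at `q₀` is carried to its neighbours by `reLmgf` at
one fixed ε with C ε ≤ g/8. This function is continuous and within g/8 of `L` on the ball; the three
errors g/8 leave more than half of the gap. -/
lemma TailControl.smallerThan_nhds [IsProbabilityMeasure P] {D : Set ℝ} {Λ₀ Λ₁ Λ₂ : ℝ → ℝ}
    (hA : Assumptions P Y D Λ₀ Λ₁ Λ₂) {L : ℂ → ℝ} (hL : TailControl P Y D L) {u : ℝ}
    (hu : u ∈ interior D \ {0}) {q₀ : ℝ} (hq₀ : q₀ ≠ 0) :
    ∃ S ∈ 𝓝 q₀, SmallerThan P Y u (L ⟨u, 0⟩) S := by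
  obtain ⟨ε₀, hε₀, hdom, -⟩ := hA.smooth
  obtain ⟨ε₁, hε₁, ρ, hρ, C, hC, h⟩ := hL.exists_ball (w := ⟨u, q₀⟩) hu
  have hgap := hL.unique_max u hu q₀ hq₀
  set g := L ⟨u, 0⟩ - L ⟨u, q₀⟩ with hg
  have hg0 : 0 < g := by linarith
  set ε := min (min ε₀ ε₁) (g / (8 * C)) / 2 with hε
  have hmin : 0 < min (min ε₀ ε₁) (g / (8 * C)) := by positivity
  have hε0 : 0 < ε := by positivity
  have hεlt : ε < min (min ε₀ ε₁) (g / (8 * C)) := by rw [hε]; linarith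
  have hεa : ε < ε₀ := (hεlt.trans_le (min_le_left _ _)).trans_le (min_le_left _ _)
  have hεb : ε < ε₁ := (hεlt.trans_le (min_le_left _ _)).trans_le (min_le_right _ _)
  have hεc : C * ε ≤ g / 8 := by
    have := (hεlt.trans_le (min_le_right _ _)).le
    rw [le_div_iff₀ (by positivity)] at this
    linarith
  have hvert : Continuous fun q : ℝ => (⟨u, q⟩ : ℂ) := by
    have : (fun q : ℝ => (⟨u, q⟩ : ℂ)) = fun q : ℝ => (u : ℂ) + q * Complex.I := by
      ext q; exact Complex.mk_eq_add_mul_I u q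
    rw [this]; fun_prop
  have hball₀ : (⟨u, q₀⟩ : ℂ) ∈ Metric.ball (⟨u, q₀⟩ : ℂ) ρ := Metric.mem_ball_self hρ
  obtain ⟨hne₀, hb₀⟩ := h ε ⟨hε0, hεb⟩ _ hball₀
  have hcont : ContinuousAt (fun q : ℝ => reLmgf P Y ε ⟨u, q⟩) q₀ := by
    have h1 : ContinuousAt (cmgf P Y ε) ⟨u, q₀⟩ :=
      (hasDerivAt_cmgf hε0 isOpen_interior (hdom ε ⟨hε0, hεa⟩) hu.1).continuousAt
    have h2 : ContinuousAt (fun q : ℝ => cmgf P Y ε ⟨u, q⟩) q₀ :=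
      ContinuousAt.comp (f := fun q : ℝ => (⟨u, q⟩ : ℂ)) h1 hvert.continuousAt
    exact (h2.norm.log (norm_ne_zero_iff.2 hne₀)).const_mul ε
  have hev : ∀ᶠ q in 𝓝 q₀, reLmgf P Y ε ⟨u, q⟩ < reLmgf P Y ε ⟨u, q₀⟩ + g / 8 :=
    hcont.eventually_lt continuousAt_const (by linarith)
  have hev2 : ∀ᶠ q in 𝓝 q₀, (⟨u, q⟩ : ℂ) ∈ Metric.ball (⟨u, q₀⟩ : ℂ) ρ :=
    hvert.continuousAt.eventually (Metric.ball_mem_nhds _ hρ)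
  refine ⟨_, hev.and hev2, g / 2, by positivity, C, ε₁, hε₁, ?_⟩
  rintro ε' hε' q ⟨hq1, hq2⟩
  obtain ⟨hne, hb⟩ := h ε' hε' _ hq2
  obtain ⟨-, hb'⟩ := h ε ⟨hε0, hεb⟩ _ hq2
  have hε'0 : 0 < ε' := hε'.1
  rw [norm_cmgf_eq_exp hε'0 hne]
  refine Real.exp_le_exp.2 ?_
  rw [div_add' _ _ _ hε'0.ne']
  gcongr
  rw [abs_le] at hb hb' hb₀
  linarith [hb.2, hb'.1, hb₀.2]

/-- Away from the real axis, the moment generating function on a vertical line is uniformly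
exponentially smaller than on the real axis. -/
lemma TailControl.exists_bound [IsProbabilityMeasure P] {D : Set ℝ} {Λ₀ Λ₁ Λ₂ : ℝ → ℝ}
    (hA : Assumptions P Y D Λ₀ Λ₁ Λ₂) {L : ℂ → ℝ} (hL : TailControl P Y D L) {u : ℝ}
    (hu : u ∈ interior D \ {0}) {δ : ℝ} (hδ : 0 < δ) :
    ∃ η > 0, ∃ C > 0, ∃ ε₁ > 0, ∀ ε ∈ Ioo 0 ε₁, ∀ q : ℝ, δ ≤ |q| →
      ‖cmgf P Y ε (u + q * Complex.I)‖ ≤ C * Real.exp (-η / ε) * ‖cmgf P Y ε u‖ := by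
  obtain ⟨g, hg, R, haway⟩ := hL.away u hu
  obtain ⟨ε₂, hε₂, p₀, hp₀, M, hupper⟩ := hL.upper u hu
  set l := L ⟨u, 0⟩ with hl
  -- Far out compactness is unavailable; the gap of `away` and the one-sided bound `upper` replace
  -- it.
  have hfar : SmallerThan P Y u l {q | max R p₀ ≤ |q|} := by
    refine ⟨g, hg, M, ε₂, hε₂, fun ε hε q hq => ?_⟩
    have hε0 : 0 < ε := hε.1
    by_cases hne : cmgf P Y ε ⟨u, q⟩ = 0
    · rw [hne, norm_zero]; positivity
    have h1 := haway q ((le_max_left _ _).trans hq)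
    have h2 := hupper q ((le_max_right _ _).trans hq) ε ⟨hε.1, hε.2.le⟩ hne
    rw [norm_cmgf_eq_exp hε0 hne]
    refine Real.exp_le_exp.2 ?_
    rw [div_add' _ _ _ hε0.ne']
    gcongr
    linarith
  have hcomp : IsCompact (Icc (-(max R p₀)) (max R p₀) ∩ {q | δ ≤ |q|}) :=
    isCompact_Icc.inter_right (isClosed_le continuous_const continuous_abs)
  have hnear : SmallerThan P Y u l (Icc (-(max R p₀)) (max R p₀) ∩ {q | δ ≤ |q|}) := by
    refine hcomp.induction_on ⟨1, one_pos, 0, 1, one_pos, by simp⟩ (fun _ _ h1 h2 => h2.mono h1)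
      (fun _ _ h1 h2 => h1.union h2) ?_
    intro q hq
    have hq0 : q ≠ 0 := by
      rintro rfl
      have := hq.2
      simp only [mem_ofPred_eq, abs_zero] at this
      linarith
    obtain ⟨S, hS, h⟩ := hL.smallerThan_nhds hA hu hq0
    exact ⟨S, mem_nhdsWithin_of_mem_nhds hS, h⟩
  have hall : SmallerThan P Y u l {q | δ ≤ |q|} := (hnear.union hfar).mono fun q hq => by
    rcases le_total (|q|) (max R p₀) with h | h
    · exact Or.inl ⟨abs_le.1 h, hq⟩
    · exact Or.inr h
  obtain ⟨η, hη, C, ε₁, hε₁, h⟩ := hall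
  -- At q = 0 the two-sided local estimate bounds exp(l/ε) by exp(C') times the moment generating
  -- function at `u`, so the latter can serve as reference.
  obtain ⟨ε₃, hε₃, ρ, hρ, C', hC', hball⟩ := hL.exists_ball (w := (u : ℂ)) (by simpa using hu)
  refine ⟨η, hη, Real.exp (C + C'), Real.exp_pos _, min ε₁ ε₃, lt_min hε₁ hε₃, ?_⟩
  intro ε hε q hq
  have hε0 : 0 < ε := hε.1
  obtain ⟨hne, hb⟩ := hball ε ⟨hε.1, hε.2.trans_le (min_le_right _ _)⟩ _ (Metric.mem_ball_self hρ)
  rw [norm_cmgf_eq_exp hε0 hne, ← Real.exp_add, ← Real.exp_add, ← Complex.mk_eq_add_mul_I]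
  refine (h ε ⟨hε.1, hε.2.trans_le (min_le_left _ _)⟩ q hq).trans (Real.exp_le_exp.2 ?_)
  have hlu : L (u : ℂ) = l := rfl
  rw [abs_le, hlu] at hb
  have h1 : l / ε - C' ≤ reLmgf P Y ε u / ε := by
    rw [div_sub' hε0.ne', div_le_div_iff_of_pos_right hε0]
    linarith [hb.1]
  have h2 : (l - η) / ε = l / ε + -η / ε := by ring
  linarith

end

/-! ### Gaussian moments and the coefficient of ε. -/

lemma integrable_pow_mul_exp {b : ℝ} (hb : 0 < b) (n : ℕ) :
    Integrable fun t : ℝ => t ^ n * Real.exp (-b * t ^ 2) := by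
  have := integrable_rpow_mul_exp_neg_mul_sq hb (s := n) (by have := n.cast_nonneg (α := ℝ); linarith)
  simpa only [Real.rpow_natCast] using this

/-- Integration by parts: the derivative of t^(n+1) exp(−b t²) has integral zero. -/
lemma integral_pow_add_two_mul_exp {b : ℝ} (hb : 0 < b) (n : ℕ) :
    ∫ t : ℝ, t ^ (n + 2) * Real.exp (-b * t ^ 2)
      = (n + 1) / (2 * b) * ∫ t : ℝ, t ^ n * Real.exp (-b * t ^ 2) := by
  have hd : ∀ t : ℝ, HasDerivAt (fun t : ℝ => t ^ (n + 1) * Real.exp (-b * t ^ 2))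
      ((n + 1) * (t ^ n * Real.exp (-b * t ^ 2))
        - 2 * b * (t ^ (n + 2) * Real.exp (-b * t ^ 2))) t := by
    intro t
    have h1 : HasDerivAt (fun t : ℝ => t ^ (n + 1)) ((n + 1 : ℕ) * t ^ n) t := by
      simpa using hasDerivAt_pow (n + 1) t
    have h2 : HasDerivAt (fun t : ℝ => Real.exp (-b * t ^ 2))
        (Real.exp (-b * t ^ 2) * (-b * (2 * t))) t := by
      have := (hasDerivAt_pow 2 t).const_mul (-b)
      simpa using this.exp
    refine (h1.mul h2).congr_deriv ?_
    push_cast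
    ring
  have i1 := (integrable_pow_mul_exp hb n).const_mul ((n : ℝ) + 1)
  have i2 := (integrable_pow_mul_exp hb (n + 2)).const_mul (2 * b)
  have h0 := integral_eq_zero_of_hasDerivAt_of_integrable hd (i1.sub i2)
    (integrable_pow_mul_exp hb (n + 1))
  rw [integral_sub i1 i2, integral_const_mul, integral_const_mul] at h0
  rw [div_mul_eq_mul_div, eq_div_iff (by positivity)]
  linarith

/-- The Gaussian average of `secondOrderTerm`. -/
noncomputable def saddleCoeff (Λ₀ Λ₁ : ℝ → ℝ) (u v : ℝ) : ℝ :=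
  iteratedDeriv 4 Λ₀ u / (8 * iteratedDeriv 2 Λ₀ u ^ 2)
    - (iteratedDeriv 2 Λ₁ u + deriv Λ₁ u ^ 2) / (2 * iteratedDeriv 2 Λ₀ u)
    + deriv Λ₁ u * iteratedDeriv 3 Λ₀ u / (2 * iteratedDeriv 2 Λ₀ u ^ 2)
    - 5 * iteratedDeriv 3 Λ₀ u ^ 2 / (24 * iteratedDeriv 2 Λ₀ u ^ 3)
    - iteratedDeriv 3 Λ₀ u * (1 / u + 1 / v) / (2 * iteratedDeriv 2 Λ₀ u ^ 2)
    + deriv Λ₁ u * (1 / u + 1 / v) / iteratedDeriv 2 Λ₀ u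
    - ((1 / u) ^ 2 + (1 / v) ^ 2 + 1 / u * (1 / v)) / iteratedDeriv 2 Λ₀ u

/-- Sorted by powers of t, only the moments of order 2, 4 and 6 are needed. -/
lemma exp_mul_secondOrderTerm (Λ₀ Λ₁ : ℝ → ℝ) (u v t E : ℝ) :
    E * secondOrderTerm Λ₀ Λ₁ u v t =
      (-(iteratedDeriv 2 Λ₁ u + deriv Λ₁ u ^ 2) / 2
        - ((1 / u) ^ 2 + (1 / v) ^ 2 + 1 / u * (1 / v)) + deriv Λ₁ u * (1 / u + 1 / v))
          * (t ^ 2 * E)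
      + (iteratedDeriv 4 Λ₀ u / 24 + deriv Λ₁ u * iteratedDeriv 3 Λ₀ u / 6
        - iteratedDeriv 3 Λ₀ u / 6 * (1 / u + 1 / v)) * (t ^ 4 * E)
      + (-iteratedDeriv 3 Λ₀ u ^ 2 / 72) * (t ^ 6 * E) := by
  rw [secondOrderTerm]
  ring

lemma integrable_exp_mul_secondOrderTerm (Λ₀ Λ₁ : ℝ → ℝ) {b : ℝ} (u v : ℝ)
    (hb : 0 < b) :
    Integrable fun t : ℝ => Real.exp (-b * t ^ 2) * secondOrderTerm Λ₀ Λ₁ u v t := by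
  simp_rw [exp_mul_secondOrderTerm]
  exact (((integrable_pow_mul_exp hb 2).const_mul _).add
    ((integrable_pow_mul_exp hb 4).const_mul _)).add ((integrable_pow_mul_exp hb 6).const_mul _)

lemma integrable_exp_mul_one_add (Λ₀ Λ₁ : ℝ → ℝ) {b : ℝ} (u v s : ℝ)
    (hb : 0 < b) :
    Integrable fun t : ℝ => Real.exp (-b * t ^ 2) * (1 + s ^ 2 * secondOrderTerm Λ₀ Λ₁ u v t) := by
  refine ((integrable_exp_neg_mul_sq hb).add
    ((integrable_exp_mul_secondOrderTerm Λ₀ Λ₁ u v hb).const_mul (s ^ 2))).congr ?_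
  exact Eventually.of_forall fun t => by simp only [Pi.add_apply]; ring

lemma integral_exp_mul_one_add {Λ₀ Λ₁ : ℝ → ℝ} {u v s : ℝ} (hσ : 0 < iteratedDeriv 2 Λ₀ u) :
    ∫ t : ℝ, Real.exp (-(iteratedDeriv 2 Λ₀ u / 2) * t ^ 2)
        * (1 + s ^ 2 * secondOrderTerm Λ₀ Λ₁ u v t)
      = √(2 * Real.pi / iteratedDeriv 2 Λ₀ u) * (1 + s ^ 2 * saddleCoeff Λ₀ Λ₁ u v) := by
  have hb : 0 < iteratedDeriv 2 Λ₀ u / 2 := by positivity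
  have m0 := integral_gaussian (iteratedDeriv 2 Λ₀ u / 2)
  have e0 : Real.pi / (iteratedDeriv 2 Λ₀ u / 2) = 2 * Real.pi / iteratedDeriv 2 Λ₀ u := by
    field_simp
  rw [e0] at m0
  have m2 := integral_pow_add_two_mul_exp hb 0
  have m4 := integral_pow_add_two_mul_exp hb 2
  have m6 := integral_pow_add_two_mul_exp hb 4
  simp only [pow_zero, one_mul, zero_add] at m2
  norm_num only at m2 m4 m6
  rw [m0] at m2
  rw [m2] at m4
  rw [m4] at m6
  have i2 := integrable_pow_mul_exp hb 2
  have i4 := integrable_pow_mul_exp hb 4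
  have i6 := integrable_pow_mul_exp hb 6
  have hS : ∫ t : ℝ, Real.exp (-(iteratedDeriv 2 Λ₀ u / 2) * t ^ 2) * secondOrderTerm Λ₀ Λ₁ u v t
      = √(2 * Real.pi / iteratedDeriv 2 Λ₀ u) * saddleCoeff Λ₀ Λ₁ u v := by
    simp_rw [exp_mul_secondOrderTerm]
    rw [integral_add (by exact (i2.const_mul _).add (i4.const_mul _)) (i6.const_mul _),
      integral_add (i2.const_mul _) (i4.const_mul _), integral_const_mul, integral_const_mul,
      integral_const_mul, m2, m4, m6, saddleCoeff]
    generalize √(2 * Real.pi / iteratedDeriv 2 Λ₀ u) = G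
    generalize 1 / u = x
    generalize 1 / v = y
    field_simp
    ring
  have e : ∀ t : ℝ, Real.exp (-(iteratedDeriv 2 Λ₀ u / 2) * t ^ 2)
        * (1 + s ^ 2 * secondOrderTerm Λ₀ Λ₁ u v t)
      = Real.exp (-(iteratedDeriv 2 Λ₀ u / 2) * t ^ 2)
        + s ^ 2 * (Real.exp (-(iteratedDeriv 2 Λ₀ u / 2) * t ^ 2)
          * secondOrderTerm Λ₀ Λ₁ u v t) := fun t => by ring
  simp_rw [e]
  rw [integral_add (integrable_exp_neg_mul_sq hb)
    ((integrable_exp_mul_secondOrderTerm Λ₀ Λ₁ u v hb).const_mul _), integral_const_mul, m0, hS]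
  ring

/-- The Gaussian average accounts for all of Υ except Λ₂, which comes from the moment generating
function at `u`; see `oneAddApprox_mgf`. -/
lemma add_saddleCoeff_eq_upsilon {Λ₀ Λ₁ Λ₂ : ℝ → ℝ} {u b : ℝ} (hσ : iteratedDeriv 2 Λ₀ u ≠ 0)
    (hu : u ≠ 0) (hv : u - b ≠ 0) :
    Λ₂ u + saddleCoeff Λ₀ Λ₁ u (u - b) = upsilon Λ₀ Λ₁ Λ₂ b u := by
  simp only [saddleCoeff, upsilon]
  generalize iteratedDeriv 2 Λ₀ u = σ at *
  generalize iteratedDeriv 3 Λ₀ u = τ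
  generalize iteratedDeriv 4 Λ₀ u = κ
  generalize deriv Λ₁ u = a
  generalize iteratedDeriv 2 Λ₁ u = a₂
  field_simp
  ring

/-! ### Laplace's method. -/

/-- The integrand of the contour integral, normalised to be `1` on the real axis. -/
noncomputable def normIntegrand {Ω : Type*} [MeasurableSpace Ω] (P : Measure Ω) (Y : ℝ → Ω → ℝ)
    (k u v ε q : ℝ) : ℂ :=
  cmgf P Y ε (u + q * Complex.I) / cmgf P Y ε u * Complex.exp (-(k * (q * Complex.I)) / ε)
    * ((u * v : ℝ) * kernel u v q)

lemma abs_secondOrderTerm_le (Λ₀ Λ₁ : ℝ → ℝ) {u v₀ : ℝ} (hv₀ : 0 < v₀) :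
    ∃ M ≥ 0, ∀ v t : ℝ, v₀ ≤ |v| → |secondOrderTerm Λ₀ Λ₁ u v t| ≤ M * (1 + t ^ 2) ^ 6 := by
  set d₃ := iteratedDeriv 3 Λ₀ u with hd₃
  set d₄ := iteratedDeriv 4 Λ₀ u with hd₄
  set e₁ := deriv Λ₁ u with he₁
  set e₂ := iteratedDeriv 2 Λ₁ u with he₂
  have hv₀' : 0 < 1 / v₀ := by positivity
  set U := |1 / u| + 1 / v₀ with hU
  have hU0 : 0 ≤ U := by positivity
  set m := |e₁| + |d₃| with hm
  have hm0 : 0 ≤ m := by positivity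
  refine ⟨|d₄| + |e₂| + m ^ 2 + 3 * U ^ 2 + 2 * m * U, by positivity, fun v t hv => ?_⟩
  have huU : |1 / u| ≤ U := by rw [hU]; linarith
  have hvU : |1 / v| ≤ U := by
    rw [abs_div, abs_one]
    have : 1 / |v| ≤ 1 / v₀ := one_div_le_one_div_of_le hv₀ hv
    rw [hU]; linarith [abs_nonneg (1 / u)]
  rw [secondOrderTerm, ← hd₃, ← hd₄, ← he₁, ← he₂]
  generalize 1 / u = a at *
  generalize 1 / v = b at *
  have p1 := abs_pow_le_one_add_sq_pow t (j := 1) (by norm_num)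
  have p2 := abs_pow_le_one_add_sq_pow t (j := 2) (by norm_num)
  have p3 := abs_pow_le_one_add_sq_pow t (j := 3) (by norm_num)
  have p4 := abs_pow_le_one_add_sq_pow t (j := 4) (by norm_num)
  rw [pow_one] at p1
  have hT1 : 1 ≤ (1 + t ^ 2) ^ 3 := one_le_pow₀ (by nlinarith [sq_nonneg t])
  have hT2 : (1 + t ^ 2) ^ 6 = (1 + t ^ 2) ^ 3 * (1 + t ^ 2) ^ 3 := by ring
  rw [hT2]
  generalize (1 + t ^ 2) ^ 3 = T at *
  have hT0 : 0 ≤ T := by linarith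
  have hTT : T ≤ T * T := le_mul_of_one_le_left hT0 hT1
  have q1 : |d₄ / 24 * t ^ 4| ≤ |d₄| * T := by
    rw [abs_mul, abs_pow, abs_div]
    have : |(24 : ℝ)| = 24 := by norm_num
    rw [this]; gcongr; linarith [abs_nonneg d₄]
  have q2 : |e₂ / 2 * t ^ 2| ≤ |e₂| * T := by
    rw [abs_mul, abs_pow, abs_div, abs_two]; gcongr; linarith [abs_nonneg e₂]
  have q3 : |e₁ * t - d₃ / 6 * t ^ 3| ≤ m * T := by
    have h1 : |e₁ * t| ≤ |e₁| * T := by rw [abs_mul]; gcongr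
    have h2 : |d₃ / 6 * t ^ 3| ≤ |d₃| * T := by
      rw [abs_mul, abs_pow, abs_div]
      have : |(6 : ℝ)| = 6 := by norm_num
      rw [this]; gcongr; linarith [abs_nonneg d₃]
    rw [hm, add_mul]
    exact abs_sub_le_of_le h1 h2
  generalize e₁ * t - d₃ / 6 * t ^ 3 = p at *
  have q4 : |p ^ 2 / 2| ≤ m ^ 2 * (T * T) := by
    rw [abs_div, abs_pow, abs_two]
    have : |p| ^ 2 ≤ (m * T) ^ 2 := by gcongr
    nlinarith [sq_nonneg |p|]
  have q5 : |(a ^ 2 + b ^ 2 + a * b) * t ^ 2| ≤ 3 * U ^ 2 * T := by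
    have := abs_add_le_of_le (abs_add_le_of_le (abs_mul_le_of_le huU huU)
      (abs_mul_le_of_le hvU hvU)) (abs_mul_le_of_le huU hvU)
    rw [abs_mul, abs_pow]
    gcongr
    simp only [← sq] at this
    linarith
  have q6 : |p * ((a + b) * t)| ≤ m * T * (2 * U * T) := by
    rw [abs_mul, abs_mul]
    gcongr
    have := abs_add_le_of_le huU hvU
    linarith
  have := abs_add_le_of_le (abs_sub_le_of_le (abs_sub_le_of_le (abs_sub_le_of_le q1 q2) q4) q5) q6
  refine this.trans ?_
  calc _ ≤ |d₄| * (T * T) + |e₂| * (T * T) + m ^ 2 * (T * T) + 3 * U ^ 2 * (T * T)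
        + m * T * (2 * U * T) := by gcongr
    _ = _ := by ring

/-- Away from the saddlepoint the Gaussian main term is itself an error: |s t| ≥ δ gives 1 ≤ (s
t)^4/δ^4, so a factor s⁴ is bought with powers of t. The exponent 18 is that of
`LocalExpansion.integrand_expansion`. -/
lemma gaussian_tail_le {σ δ s t x M : ℝ} (hσ : 0 < σ) (hδ : 0 < δ) (hs0 : 0 < s) (hs1 : s ≤ 1)
    (hst : δ ≤ |s * t|) (hM : 0 ≤ M) (hx : |x| ≤ M * (1 + t ^ 2) ^ 6) :
    |Real.exp (-(σ / 2) * t ^ 2) * (1 + s ^ 2 * x)|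
      ≤ (1 + M) / δ ^ 4 * s ^ 4 * ((1 + t ^ 2) ^ 18 * Real.exp (-(σ / 4) * t ^ 2)) := by
  rw [abs_mul, abs_of_pos (Real.exp_pos _)]
  have h1 : Real.exp (-(σ / 2) * t ^ 2) ≤ Real.exp (-(σ / 4) * t ^ 2) := by
    refine Real.exp_le_exp.2 ?_
    have : 0 ≤ σ * t ^ 2 := by positivity
    linarith
  have ht1 : 1 ≤ 1 + t ^ 2 := by linarith [sq_nonneg t]
  have h2 : |1 + s ^ 2 * x| ≤ (1 + M) * (1 + t ^ 2) ^ 6 := by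
    have a1 : |s ^ 2 * x| ≤ 1 * (M * (1 + t ^ 2) ^ 6) :=
      abs_mul_le_of_le (by rw [abs_of_nonneg (by positivity)]; exact pow_le_one₀ hs0.le hs1) hx
    have a2 : |(1 : ℝ)| ≤ (1 + t ^ 2) ^ 6 := by rw [abs_one]; exact one_le_pow₀ ht1
    linarith [abs_add_le_of_le a2 a1]
  have h3 : 1 ≤ 1 / δ ^ 4 * s ^ 4 * (1 + t ^ 2) ^ 12 := by
    rw [div_mul_eq_mul_div, one_mul, div_mul_eq_mul_div, le_div_iff₀ (by positivity), one_mul]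
    calc δ ^ 4 ≤ |s * t| ^ 4 := by gcongr
      _ = s ^ 4 * (t ^ 2) ^ 2 := by rw [abs_mul, abs_of_pos hs0, ← sq_abs t]; ring
      _ ≤ s ^ 4 * (1 + t ^ 2) ^ 2 := by gcongr; linarith
      _ ≤ s ^ 4 * (1 + t ^ 2) ^ 12 := by gcongr; norm_num
  calc _ ≤ Real.exp (-(σ / 4) * t ^ 2) * ((1 + M) * (1 + t ^ 2) ^ 6) * 1 := by
        rw [mul_one]; gcongr
    _ ≤ Real.exp (-(σ / 4) * t ^ 2) * ((1 + M) * (1 + t ^ 2) ^ 6)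
        * (1 / δ ^ 4 * s ^ 4 * (1 + t ^ 2) ^ 12) := by gcongr
    _ = _ := by generalize Real.exp (-(σ / 4) * t ^ 2) = X; ring

section

variable {Ω : Type*} [MeasurableSpace Ω] {P : Measure Ω} {Y : ℝ → Ω → ℝ} {D : Set ℝ}
  {Λ₀ Λ₁ Λ₂ : ℝ → ℝ} {u r B ε₁ : ℝ} {F : ℝ → ℂ → ℂ} {F₀ F₁ : ℂ → ℂ}

/-- Inside the ball the quotient of moment generating functions is the exponential of a difference
of logarithms. `normIntegrand` makes sense on the whole line, where no logarithm is available. -/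
lemma LocalExpansion.normIntegrand_eq (h : LocalExpansion P Y D Λ₀ Λ₁ u r B ε₁ F F₀ F₁) {ε : ℝ}
    (hε : ε ∈ Ioo 0 ε₁) (k v : ℝ) {q : ℝ} (hq : |q| < r) :
    normIntegrand P Y k u v ε q = saddleIntegrand F k u v ε q := by
  have hmem : (u : ℂ) + q * Complex.I ∈ Metric.ball (u : ℂ) r := by
    rw [Metric.mem_ball, dist_eq_norm]; simpa using hq
  rw [normIntegrand, saddleIntegrand, ← h.exp_eq ε hε _ hmem,
    ← h.exp_eq ε hε _ (Metric.mem_ball_self h.r_pos), ← Complex.exp_sub, ← Complex.exp_add]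
  congr 2
  ring

lemma norm_mul_kernel_le {v₀ V : ℝ} (hu : u ≠ 0) (hv₀ : 0 < v₀) :
    ∃ C > 0, ∀ v q : ℝ, v₀ ≤ |v| → |v| ≤ V → ‖((u * v : ℝ) : ℂ) * kernel u v q‖
      ≤ C * (1 + q ^ 2)⁻¹ := by
  have hu2 : 0 < u ^ 2 := by positivity
  set m := min 1 (min (u ^ 2) (v₀ ^ 2)) with hm
  have hm0 : 0 < m := by positivity
  refine ⟨|u| * |V| * m⁻¹ + 1, by positivity, fun v q hv hV => ?_⟩
  have hv2 : v₀ ^ 2 ≤ v ^ 2 := by rw [← sq_abs v]; gcongr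
  have hk := norm_kernel_le (u := u) (v := v) hm0 (min_le_left _ _)
    ((min_le_right _ _).trans (min_le_left _ _))
    (((min_le_right _ _).trans (min_le_right _ _)).trans hv2) q
  rw [norm_mul, Complex.norm_real, Real.norm_eq_abs, abs_mul]
  have hVa : |v| ≤ |V| := hV.trans (le_abs_self V)
  calc _ ≤ |u| * |V| * (m⁻¹ * (1 + q ^ 2)⁻¹) := by gcongr
    _ = |u| * |V| * m⁻¹ * (1 + q ^ 2)⁻¹ := by ring
    _ ≤ _ := by gcongr; linarith

lemma norm_cmgf_vertical_le (ε q : ℝ) :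
    ‖cmgf P Y ε (u + q * Complex.I)‖ ≤ ‖cmgf P Y ε u‖ := by
  refine (norm_cmgf_le P Y ε _).trans ?_
  rw [cmgf_ofReal, Complex.norm_real]
  simpa using le_abs_self _

lemma norm_exp_neg_mul_I_div (k ε q : ℝ) :
    ‖Complex.exp (-(k * (q * Complex.I)) / ε)‖ = 1 := by
  have : -((k : ℂ) * (q * Complex.I)) / ε = ((-(k * q) / ε : ℝ) : ℂ) * Complex.I := by
    push_cast; ring
  rw [this, Complex.norm_exp_ofReal_mul_I]

lemma norm_normIntegrand_le {k v ε q : ℝ} :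
    ‖normIntegrand P Y k u v ε q‖ ≤ ‖((u * v : ℝ) : ℂ) * kernel u v q‖ := by
  rw [normIntegrand, norm_mul, norm_mul, norm_exp_neg_mul_I_div, mul_one, norm_div]
  exact mul_le_of_le_one_left (norm_nonneg _)
    (div_le_one_of_le₀ (norm_cmgf_vertical_le ε q) (norm_nonneg _))

lemma LocalExpansion.integrable_normIntegrand [IsProbabilityMeasure P]
    (h : LocalExpansion P Y D Λ₀ Λ₁ u r B ε₁ F F₀ F₁) (hu : u ≠ 0) {ε : ℝ}
    (hε : ε ∈ Ioo 0 ε₁) (k : ℝ) {v : ℝ} (hv : v ≠ 0) :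
    Integrable (normIntegrand P Y k u v ε) := by
  have hc : Continuous fun q : ℝ => cmgf P Y ε (u + q * Complex.I) := by
    rw [continuous_iff_continuousAt]
    intro q
    have hmem : ((u : ℂ) + q * Complex.I).re ∈ interior D := by
      simpa using h.mem_int u (Metric.mem_ball_self h.r_pos)
    have h1 := (hasDerivAt_cmgf hε.1 isOpen_interior (h.sub_dom ε hε) hmem).continuousAt
    exact ContinuousAt.comp (f := fun q : ℝ => (u : ℂ) + q * Complex.I) h1 (by fun_prop)
  refine Integrable.mono (((integrable_kernel hu hv).const_mul ((u * v : ℝ) : ℂ))) ?_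
    (Eventually.of_forall fun q => norm_normIntegrand_le)
  have := continuous_kernel hu hv
  unfold normIntegrand
  exact Continuous.aestronglyMeasurable (by fun_prop)

/-- For |s t| < δ this is the local expansion. Beyond, integrand and Gaussian are small separately,
by `TailControl.exists_bound` and `gaussian_tail_le`. The window v₀ ≤ |v| ≤ V provides uniformity in
the moving pole. -/
lemma LocalExpansion.normIntegrand_expansion [IsProbabilityMeasure P]
    (hA : Assumptions P Y D Λ₀ Λ₁ Λ₂) (h : LocalExpansion P Y D Λ₀ Λ₁ u r B ε₁ F F₀ F₁)
    (hu : u ≠ 0) {v₀ V : ℝ} (hv₀ : 0 < v₀) :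
    ∃ K ≥ 0, ∃ η > 0, ∃ C ≥ 0, ∃ s₁ > 0, ∀ s ∈ Ioo 0 s₁, ∀ v : ℝ, v₀ ≤ |v| → |v| ≤ V → ∀ t : ℝ,
      |(normIntegrand P Y (deriv Λ₀ u) u v (s ^ 2) (s * t)).re
        - Real.exp (-(iteratedDeriv 2 Λ₀ u / 2) * t ^ 2)
          * (1 + s ^ 2 * secondOrderTerm Λ₀ Λ₁ u v t)|
        ≤ K * s ^ 4 * ((1 + t ^ 2) ^ 18 * Real.exp (-(iteratedDeriv 2 Λ₀ u / 4) * t ^ 2))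
          + C * Real.exp (-η / s ^ 2) * (1 + (s * t) ^ 2)⁻¹ := by
  obtain ⟨L, hL⟩ := hA.tail
  have hσ := h.second_deriv_pos hA.strictConvex
  have huD : u ∈ interior D := by simpa using h.mem_int u (Metric.mem_ball_self h.r_pos)
  obtain ⟨δ, hδ, hδr, K, hK, s₁, hs₁, hnear⟩ := h.integrand_expansion hσ hu hv₀
  obtain ⟨η, hη, C, hC, ε₂, hε₂, hfar⟩ := hL.exists_bound hA ⟨huD, hu⟩ hδ
  obtain ⟨C', hC', hker⟩ := norm_mul_kernel_le (u := u) (V := V) hu hv₀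
  obtain ⟨M, hM, hsot⟩ := abs_secondOrderTerm_le Λ₀ Λ₁ (u := u) hv₀
  have hε₁ := h.ε_pos
  refine ⟨max K ((1 + M) / δ ^ 4), le_max_of_le_left hK, η, hη, C * C', by positivity,
    min (min s₁ 1) (min (√ε₁) (√ε₂)), by positivity, fun s hs v hv hV t => ?_⟩
  have hs0 : 0 < s := hs.1
  have hs1 : s < s₁ := (hs.2.trans_le (min_le_left _ _)).trans_le (min_le_left _ _)
  have hs2 : s < 1 := (hs.2.trans_le (min_le_left _ _)).trans_le (min_le_right _ _)
  have hs3 : s ^ 2 < ε₁ := by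
    rw [← Real.lt_sqrt hs0.le]
    exact (hs.2.trans_le (min_le_right _ _)).trans_le (min_le_left _ _)
  have hs4 : s ^ 2 < ε₂ := by
    rw [← Real.lt_sqrt hs0.le]
    exact (hs.2.trans_le (min_le_right _ _)).trans_le (min_le_right _ _)
  have hs20 : 0 < s ^ 2 := by positivity
  rcases lt_or_ge |s * t| δ with hst | hst
  · rw [h.normIntegrand_eq ⟨hs20, hs3⟩ _ _ (hst.trans_le hδr)]
    refine (hnear s ⟨hs0, hs1⟩ v hv t hst.le).trans ?_
    have : 0 ≤ C * C' * Real.exp (-η / s ^ 2) * (1 + (s * t) ^ 2)⁻¹ := by positivity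
    refine le_add_of_le_of_nonneg ?_ this
    gcongr
    exact le_max_left _ _
  · have h1 := gaussian_tail_le hσ hδ hs0 hs2.le hst hM (hsot v t hv)
    have h2 : |(normIntegrand P Y (deriv Λ₀ u) u v (s ^ 2) (s * t)).re|
        ≤ C * C' * Real.exp (-η / s ^ 2) * (1 + (s * t) ^ 2)⁻¹ := by
      refine (Complex.abs_re_le_norm _).trans ?_
      rw [normIntegrand, norm_mul, norm_mul, norm_exp_neg_mul_I_div, mul_one, norm_div]
      have h3 : ‖cmgf P Y (s ^ 2) (u + (s * t : ℝ) * Complex.I)‖ / ‖cmgf P Y (s ^ 2) u‖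
          ≤ C * Real.exp (-η / s ^ 2) :=
        div_le_of_le_mul₀ (norm_nonneg _) (by positivity) (hfar _ ⟨hs20, hs4⟩ _ hst)
      calc _ ≤ C * Real.exp (-η / s ^ 2) * (C' * (1 + (s * t) ^ 2)⁻¹) :=
            mul_le_mul h3 (hker v _ hv hV) (norm_nonneg _) (by positivity)
        _ = _ := by ring
    refine (abs_sub_le_of_le h2 h1).trans ?_
    rw [add_comm]
    gcongr
    exact le_max_right _ _

lemma integrable_one_add_sq_pow_mul_exp {b : ℝ} (hb : 0 < b) (n : ℕ) :
    Integrable fun t : ℝ => (1 + t ^ 2) ^ n * Real.exp (-b * t ^ 2) := by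
  simp_rw [add_comm (1 : ℝ), add_pow, one_pow, mul_one, ← pow_mul, Finset.sum_mul]
  refine integrable_finsetSum _ fun i _ => ?_
  refine ((integrable_pow_mul_exp hb (2 * i)).const_mul (n.choose i : ℝ)).congr ?_
  exact Eventually.of_forall fun t => by ring

/-- Laplace's method for the contour integral, uniformly in the second pole of the kernel. -/
lemma LocalExpansion.integral_expansion [IsProbabilityMeasure P]
    (hA : Assumptions P Y D Λ₀ Λ₁ Λ₂) (h : LocalExpansion P Y D Λ₀ Λ₁ u r B ε₁ F F₀ F₁)
    (hu : u ≠ 0) {v₀ V : ℝ} (hv₀ : 0 < v₀) :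
    ∃ K ≥ 0, ∃ s₁ > 0, ∀ s ∈ Ioo 0 s₁, ∀ v : ℝ, v₀ ≤ |v| → |v| ≤ V →
      |(∫ q, normIntegrand P Y (deriv Λ₀ u) u v (s ^ 2) q).re
        - s * (√(2 * Real.pi / iteratedDeriv 2 Λ₀ u) * (1 + s ^ 2 * saddleCoeff Λ₀ Λ₁ u v))|
        ≤ K * s ^ 5 := by
  have hσ := h.second_deriv_pos hA.strictConvex
  obtain ⟨K, hK, η, hη, C, hC, s₁, hs₁, hmain⟩ := h.normIntegrand_expansion hA hu (V := V) hv₀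
  set G := ∫ t : ℝ, (1 + t ^ 2) ^ 18 * Real.exp (-(iteratedDeriv 2 Λ₀ u / 4) * t ^ 2) with hG
  have hG0 : 0 ≤ G := integral_nonneg fun t => by positivity
  have hGi := integrable_one_add_sq_pow_mul_exp (b := iteratedDeriv 2 Λ₀ u / 4) (by positivity) 18
  have hε₁ := h.ε_pos
  refine ⟨K * G + C * (6 / η ^ 3) * Real.pi, by positivity, min (min s₁ (√ε₁)) 1, by positivity,
    fun s hs v hv hV => ?_⟩
  have hs0 : 0 < s := hs.1
  have hs1 : s < s₁ := (hs.2.trans_le (min_le_left _ _)).trans_le (min_le_left _ _)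
  have hs2 : s < 1 := hs.2.trans_le (min_le_right _ _)
  have hs3 : s ^ 2 < ε₁ := by
    rw [← Real.lt_sqrt hs0.le]
    exact (hs.2.trans_le (min_le_left _ _)).trans_le (min_le_right _ _)
  have hs20 : 0 < s ^ 2 := by positivity
  have hv0 : v ≠ 0 := by rintro rfl; simp at hv; linarith
  have hint := h.integrable_normIntegrand hu ⟨hs20, hs3⟩ (deriv Λ₀ u) hv0
  set g : ℝ → ℝ := fun q => (normIntegrand P Y (deriv Λ₀ u) u v (s ^ 2) q).re with hg
  have hgi : Integrable g := hint.re
  -- The substitution q = s t contributes the leading factor s and turns the error s⁴ into s⁵.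
  have e1 : (∫ q, normIntegrand P Y (deriv Λ₀ u) u v (s ^ 2) q).re = s * ∫ t, g (s * t) := by
    rw [Measure.integral_comp_mul_left, abs_of_pos (inv_pos.2 hs0), smul_eq_mul,
      mul_inv_cancel_left₀ hs0.ne']
    exact (integral_re hint).symm
  have hgs : Integrable fun t => g (s * t) := hgi.comp_mul_left' hs0.ne'
  have hmi := integrable_exp_mul_one_add Λ₀ Λ₁ u v s (b := iteratedDeriv 2 Λ₀ u / 2) (by positivity)
  have hci : Integrable fun t : ℝ => (1 + (s * t) ^ 2)⁻¹ :=
    integrable_inv_one_add_sq.comp_mul_left' hs0.ne'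
  have hcv : ∫ t : ℝ, (1 + (s * t) ^ 2)⁻¹ = s⁻¹ * Real.pi := by
    rw [Measure.integral_comp_mul_left (fun q : ℝ => (1 + q ^ 2)⁻¹), abs_of_pos (inv_pos.2 hs0),
      smul_eq_mul, integral_univ_inv_one_add_sq]
  rw [e1, ← mul_sub, ← integral_exp_mul_one_add hσ, ← integral_sub hgs hmi, abs_mul,
    abs_of_pos hs0]
  have hb : |∫ t, (g (s * t) - Real.exp (-(iteratedDeriv 2 Λ₀ u / 2) * t ^ 2)
        * (1 + s ^ 2 * secondOrderTerm Λ₀ Λ₁ u v t))|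
      ≤ K * s ^ 4 * G + C * Real.exp (-η / s ^ 2) * (s⁻¹ * Real.pi) := by
    rw [← Real.norm_eq_abs, hG, ← hcv, ← integral_const_mul, ← integral_const_mul,
      ← integral_add (hGi.const_mul _) (hci.const_mul _)]
    exact norm_integral_le_of_norm_le ((hGi.const_mul _).add (hci.const_mul _))
      (Eventually.of_forall fun t => hmain s ⟨hs0, hs1⟩ v hv hV t)
  -- From the cubic term of the exponential series. The power s⁶ is ample, since the integral of (1
  -- + (s t)²)⁻¹ costs only s⁻¹.
  have hexp : Real.exp (-η / s ^ 2) ≤ 6 / η ^ 3 * s ^ 6 := by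
    have hx : 0 ≤ η / s ^ 2 := by positivity
    have h1 := Real.pow_div_factorial_le_exp _ hx 3
    have h3 : (Nat.factorial 3 : ℝ) = 6 := by norm_num [Nat.factorial]
    rw [h3] at h1
    have h2 : Real.exp (-η / s ^ 2) = (Real.exp (η / s ^ 2))⁻¹ := by
      rw [← Real.exp_neg, neg_div]
    rw [h2]
    calc _ ≤ ((η / s ^ 2) ^ 3 / 6)⁻¹ := inv_anti₀ (by positivity) h1
      _ = _ := by field_simp
  calc _ ≤ s * (K * s ^ 4 * G + C * (6 / η ^ 3 * s ^ 6) * (s⁻¹ * Real.pi)) := by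
        refine mul_le_mul_of_nonneg_left (hb.trans ?_) hs0.le
        gcongr
    _ = K * G * s ^ 5 + C * (6 / η ^ 3) * Real.pi * s ^ 5 * s := by field_simp
    _ ≤ K * G * s ^ 5 + C * (6 / η ^ 3) * Real.pi * s ^ 5 * 1 := by gcongr
    _ = _ := by ring

end

/-! ### Calculus of correction factors, and the Legendre transform. -/

/-- `A ε = 1 + a ε + O(ε ^ 2)` with `a ε = O(ε)`, as `ε ↓ 0`. -/
def OneAddApprox (A a : ℝ → ℝ) : Prop :=
  (fun ε => A ε - (1 + a ε)) =O[𝓝[>] 0] (fun ε : ℝ => ε ^ 2) ∧ a =O[𝓝[>] 0] (fun ε : ℝ => ε)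

lemma isBigO_sq_self : (fun ε : ℝ => ε ^ 2) =O[𝓝[>] 0] (fun ε : ℝ => ε) := by
  refine IsBigO.of_bound 1 ?_
  filter_upwards [Ioo_mem_nhdsGT (show (0 : ℝ) < 1 by norm_num)] with ε hε
  rw [one_mul, Real.norm_of_nonneg (by positivity), Real.norm_of_nonneg hε.1.le, sq]
  exact mul_le_of_le_one_left hε.1.le hε.2.le

lemma isBigO_self_one : (fun ε : ℝ => ε) =O[𝓝[>] 0] (fun _ : ℝ => (1 : ℝ)) :=
  ((continuous_id.tendsto (0 : ℝ)).mono_left nhdsWithin_le_nhds).isBigO_one ℝ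

lemma OneAddApprox.mul {A a B b : ℝ → ℝ} (hA : OneAddApprox A a) (hB : OneAddApprox B b) :
    OneAddApprox (fun ε => A ε * B ε) (fun ε => a ε + b ε) := by
  obtain ⟨hA, ha⟩ := hA
  obtain ⟨hB, hb⟩ := hB
  refine ⟨?_, ha.add hb⟩
  have hab : (fun ε => a ε * b ε) =O[𝓝[>] 0] (fun ε : ℝ => ε ^ 2) := by
    simpa only [sq] using ha.mul hb
  have hB1 : B =O[𝓝[>] 0] (fun _ : ℝ => (1 : ℝ)) := by
    have h1 := ((hB.trans isBigO_sq_self).trans isBigO_self_one).add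
      ((isBigO_refl (fun _ : ℝ => (1 : ℝ)) _).add (hb.trans isBigO_self_one))
    simpa using h1
  have ha1 : (fun ε => 1 + a ε) =O[𝓝[>] 0] (fun _ : ℝ => (1 : ℝ)) :=
    (isBigO_refl (fun _ : ℝ => (1 : ℝ)) _).add (ha.trans isBigO_self_one)
  have h1 := hA.mul hB1
  have h2 := ha1.mul hB
  simp only [mul_one, one_mul] at h1 h2
  refine ((h1.add h2).add hab).congr_left fun ε => ?_
  ring

lemma OneAddApprox.congr_right {A a b : ℝ → ℝ} (h : OneAddApprox A a)
    (hab : (fun ε => a ε - b ε) =O[𝓝[>] 0] (fun ε : ℝ => ε ^ 2)) : OneAddApprox A b := by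
  refine ⟨(h.1.add hab).congr_left fun ε => by ring, ?_⟩
  exact (h.2.sub (hab.trans isBigO_sq_self)).congr_left fun ε => by ring

lemma oneAddApprox_exp {x : ℝ → ℝ} (hx : x =O[𝓝[>] 0] (fun ε : ℝ => ε)) :
    OneAddApprox (fun ε => Real.exp (x ε)) x := by
  refine ⟨?_, hx⟩
  have h0 : Tendsto x (𝓝[>] 0) (𝓝 0) :=
    hx.trans_tendsto ((continuous_id.tendsto (0 : ℝ)).mono_left nhdsWithin_le_nhds)
  have h1 : (fun ε => Real.exp (x ε) - (1 + x ε)) =O[𝓝[>] 0] (fun ε => x ε ^ 2) := by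
    refine IsBigO.of_bound 1 ?_
    filter_upwards [h0.eventually (Metric.ball_mem_nhds 0 one_pos)] with ε hε
    rw [Real.dist_eq, sub_zero] at hε
    have := Real.abs_exp_sub_one_sub_id_le hε.le
    rw [one_mul, Real.norm_eq_abs, Real.norm_of_nonneg (sq_nonneg _), ← sub_sub]
    exact this
  exact h1.trans (hx.pow 2)

/-- The error is exactly (β − c)²/((u − c)(u − β)), and u − β stays away from 0. -/
lemma oneAddApprox_inv_sub {β : ℝ → ℝ} {c u : ℝ} (huc : u - c ≠ 0)
    (hβ : (fun ε => β ε - c) =O[𝓝[>] 0] (fun ε : ℝ => ε)) :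
    OneAddApprox (fun ε => (u - c) / (u - β ε)) (fun ε => (β ε - c) / (u - c)) := by
  have h0 : Tendsto β (𝓝[>] 0) (𝓝 c) := by
    have := hβ.trans_tendsto ((continuous_id.tendsto (0 : ℝ)).mono_left nhdsWithin_le_nhds)
    simpa using this.add_const c
  have hne : ∀ᶠ ε in 𝓝[>] (0 : ℝ), u - β ε ≠ 0 := (h0.const_sub u).eventually_ne huc
  have hβ' : (fun ε => (β ε - c) / (u - c)) =O[𝓝[>] 0] (fun ε : ℝ => ε) := by
    simpa only [div_eq_inv_mul] using hβ.const_mul_left (u - c)⁻¹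
  refine ⟨?_, hβ'⟩
  have hinv : (fun ε => (u - β ε)⁻¹) =O[𝓝[>] 0] (fun _ : ℝ => (1 : ℝ)) :=
    ((h0.const_sub u).inv₀ huc).isBigO_one ℝ
  have h1 := (hβ'.mul hβ).mul hinv
  simp only [mul_one, ← sq] at h1
  refine h1.congr' ?_ EventuallyEq.rfl
  filter_upwards [hne] with ε hε
  field_simp
  ring

/-- This factor corrects `coeffBar`, whose pole is at c, to the exact prefactor with pole at β = ε
f(ε). For c = 0 `coeffBar` retains f(ε), so nothing is divided by β, which may vanish. -/
lemma oneAddApprox_prefactor {β : ℝ → ℝ} {c u : ℝ} (hc : 0 ≤ c) (huc : u - c ≠ 0)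
    (hβ : (fun ε => β ε - c) =O[𝓝[>] 0] (fun ε : ℝ => ε)) :
    OneAddApprox (fun ε => (if 0 < c then β ε * (u - c) / c else u) / (u - β ε))
      (fun ε => if 0 < c then u * (β ε - c) / ((u - c) * c) else β ε / u) := by
  have h := oneAddApprox_inv_sub huc hβ
  split_ifs with hc0
  · have h1 : OneAddApprox (fun ε => β ε / c) (fun ε => (β ε - c) / c) := by
      refine ⟨?_, ?_⟩
      · refine (isBigO_zero _ _).congr_left fun ε => ?_
        field_simp
        ring
      · simpa only [div_eq_inv_mul] using hβ.const_mul_left c⁻¹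
    have h2 := h1.mul h
    have e1 : (fun ε => β ε / c * ((u - c) / (u - β ε)))
        = fun ε => β ε * (u - c) / c / (u - β ε) := by
      ext ε; ring
    have e2 : (fun ε => (β ε - c) / c + (β ε - c) / (u - c))
        = fun ε => u * (β ε - c) / ((u - c) * c) := by
      ext ε; field_simp; ring
    rwa [e1, e2] at h2
  · obtain rfl : c = 0 := le_antisymm (not_lt.1 hc0) hc
    simpa only [sub_zero] using h

/-- A convex function lies above its tangents, so the supremum is attained at the saddlepoint. -/
lemma legendre_eq {D : Set ℝ} {Λ₀ : ℝ → ℝ} (hconv : StrictConvexOn ℝ (interior D) Λ₀)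
    (hd : DifferentiableOn ℝ Λ₀ (interior D)) {u : ℝ} (hu : u ∈ interior D) :
    legendre D Λ₀ (deriv Λ₀ u) = u * deriv Λ₀ u - Λ₀ u := by
  refine IsGreatest.csSup_eq ⟨⟨u, hu, rfl⟩, ?_⟩
  rintro _ ⟨x, hx, rfl⟩
  have hdu : DifferentiableAt ℝ Λ₀ u := hd.differentiableAt (isOpen_interior.mem_nhds hu)
  rcases lt_trichotomy x u with h | rfl | h
  · have := hconv.convexOn.slope_le_deriv hx hu h hdu
    rw [slope_def_field, div_le_iff₀ (by linarith)] at this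
    simp only
    linarith
  · exact le_rfl
  · have := hconv.convexOn.deriv_le_slope hu hx h hdu
    rw [slope_def_field, le_div_iff₀ (by linarith)] at this
    simp only
    linarith

/-! ### Assembly of the expansion. -/

section

variable {Ω : Type*} [MeasurableSpace Ω] {P : Measure Ω} {Y : ℝ → Ω → ℝ} {D : Set ℝ}
  {Λ₀ Λ₁ Λ₂ : ℝ → ℝ} {u : ℝ}

lemma exp_lmgf_div [IsProbabilityMeasure P] {ε x : ℝ} (hε : ε ≠ 0) (hx : x ∈ dom P Y ε) :
    cmgf P Y ε x = (Real.exp (lmgf P Y ε x / ε) : ℝ) := by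
  rw [cmgf_ofReal, lmgf, mul_div_cancel_left₀ _ hε, Real.exp_log (mgf_pos_of_mem_dom hx)]

/-- The expectation of a payoff in terms of the normalised contour integral. -/
lemma expectation_payoff_eq [IsProbabilityMeasure P] {ε k b : ℝ} (hε : ε ≠ 0)
    (hY : AEMeasurable (Y ε) P) (hu : u ≠ 0) (hv : u - b ≠ 0) (hdom : u ∈ dom P Y ε) {g : ℝ → ℝ}
    (hgc : Continuous g)
    (hgx : ∀ x : ℝ, x ≠ 0 → ((Real.exp (-u * x) * g x : ℝ) : ℂ)
      = oneSidedExp (u - b : ℝ) x - oneSidedExp u x) :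
    Integrable (fun ω => g ((Y ε ω - k) / ε)) P ∧
    ∫ ω, g ((Y ε ω - k) / ε) ∂P = b / (2 * Real.pi * (u * (u - b)))
      * Real.exp ((lmgf P Y ε u - u * k) / ε)
      * (∫ q, normIntegrand P Y k u (u - b) ε q).re := by
  have hint : Integrable (fun ω => Real.exp (u * ((Y ε ω - k) / ε))) P := by
    have h1 : Integrable (fun ω => Real.exp (u / ε * Y ε ω)) P := hdom
    refine (h1.mul_const (Real.exp (-(u * k / ε)))).congr (Eventually.of_forall fun ω => ?_)
    simp only [← Real.exp_add]
    congr 1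
    field_simp
    ring
  obtain ⟨h1, h2⟩ := expectation_payoff (X := fun ω => (Y ε ω - k) / ε)
    ((hY.sub_const k).div_const ε) hu hv hgc hgx hint
  refine ⟨h1, ?_⟩
  have hεC : (ε : ℂ) ≠ 0 := Complex.ofReal_ne_zero.2 hε
  have huC : (u : ℂ) ≠ 0 := Complex.ofReal_ne_zero.2 hu
  have hvC : ((u - b : ℝ) : ℂ) ≠ 0 := Complex.ofReal_ne_zero.2 hv
  have hcm := exp_lmgf_div hε hdom
  have e : ∀ p : ℝ, (∫ ω, Complex.exp ((u + p * Complex.I) * ((Y ε ω - k) / ε : ℝ)) ∂P)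
      * kernel u (u - b) p = ((Real.exp ((lmgf P Y ε u - u * k) / ε) / (u * (u - b)) : ℝ) : ℂ)
        * normIntegrand P Y k u (u - b) ε p := by
    intro p
    have e1 : ∫ ω, Complex.exp ((u + p * Complex.I) * ((Y ε ω - k) / ε : ℝ)) ∂P
        = cmgf P Y ε (u + p * Complex.I) * Complex.exp (-(u + p * Complex.I) * k / ε) := by
      rw [cmgf, ← integral_mul_const]
      congr 1; ext ω
      rw [← Complex.exp_add]
      congr 1
      push_cast
      ring
    have e2 : Complex.exp (-(u + p * Complex.I) * k / ε)
        = Complex.exp (-(k * (p * Complex.I)) / ε) * Complex.exp (-(u * k) / ε) := by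
      rw [← Complex.exp_add]; congr 1; ring
    have e3 : ((Real.exp ((lmgf P Y ε u - u * k) / ε) : ℝ) : ℂ)
        = cmgf P Y ε u * Complex.exp (-(u * k) / ε) := by
      rw [hcm]
      push_cast
      rw [← Complex.exp_add]; congr 1; ring
    have hne : cmgf P Y ε u ≠ 0 := by
      rw [hcm]; exact Complex.ofReal_ne_zero.2 (Real.exp_pos _).ne'
    rw [e1, e2, normIntegrand, Complex.ofReal_div, e3, Complex.ofReal_mul]
    field_simp
  rw [integral_congr_ae (Eventually.of_forall e), integral_const_mul] at h2
  have h3 := congrArg Complex.re h2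
  rw [Complex.ofReal_re] at h3
  rw [h3]
  have e4 : (b : ℂ) / (2 * Real.pi) * (((Real.exp ((lmgf P Y ε u - u * k) / ε) / (u * (u - b))
      : ℝ) : ℂ) * ∫ q, normIntegrand P Y k u (u - b) ε q)
      = ((b / (2 * Real.pi) * (Real.exp ((lmgf P Y ε u - u * k) / ε) / (u * (u - b))) : ℝ) : ℂ)
        * ∫ q, normIntegrand P Y k u (u - b) ε q := by
    push_cast; ring
  rw [e4, Complex.re_ofReal_mul]
  have hpi := Real.pi_pos
  field_simp

/-- Since `LocalExpansion.integral_expansion` is uniform in v, it applies with v = u − β ε varying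
with ε. Replacing v by u − c in the coefficient changes it by O(ε), hence the product with ε by
O(ε²). -/
lemma oneAddApprox_contour [IsProbabilityMeasure P] (hA : Assumptions P Y D Λ₀ Λ₁ Λ₂)
    (hu : u ∈ interior D) (hu0 : u ≠ 0) {c : ℝ} (huc : u - c ≠ 0) {β : ℝ → ℝ}
    (hβ : (fun ε => β ε - c) =O[𝓝[>] 0] (fun ε : ℝ => ε)) :
    0 < iteratedDeriv 2 Λ₀ u ∧
    OneAddApprox (fun ε => (∫ q, normIntegrand P Y (deriv Λ₀ u) u (u - β ε) ε q).re
        / (√ε * √(2 * Real.pi / iteratedDeriv 2 Λ₀ u)))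
      (fun ε => saddleCoeff Λ₀ Λ₁ u (u - c) * ε) := by
  obtain ⟨r, B, ε₁, F, F₀, F₁, h⟩ := exists_localExpansion hA hu hu0
  have hσ := h.second_deriv_pos hA.strictConvex
  refine ⟨hσ, ?_⟩
  have huc' : 0 < |u - c| := abs_pos.2 huc
  obtain ⟨K, hK, s₁, hs₁, hmain⟩ := h.integral_expansion hA hu0 (v₀ := |u - c| / 2)
    (V := 2 * |u - c|) (by positivity)
  set G := √(2 * Real.pi / iteratedDeriv 2 Λ₀ u) with hG
  have hG0 : 0 < G := by have := Real.pi_pos; positivity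
  have h0 : Tendsto β (𝓝[>] 0) (𝓝 c) := by
    have := hβ.trans_tendsto ((continuous_id.tendsto (0 : ℝ)).mono_left nhdsWithin_le_nhds)
    simpa using this.add_const c
  have hv : Tendsto (fun ε => u - β ε) (𝓝[>] 0) (𝓝 (u - c)) := h0.const_sub u
  have hlo : ∀ᶠ ε in 𝓝[>] (0 : ℝ), |u - c| / 2 ≤ |u - β ε| :=
    hv.abs.eventually_const_le (by linarith)
  have hhi : ∀ᶠ ε in 𝓝[>] (0 : ℝ), |u - β ε| ≤ 2 * |u - c| :=
    hv.abs.eventually_le_const (by linarith)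
  have hβε : OneAddApprox (fun ε => (∫ q, normIntegrand P Y (deriv Λ₀ u) u (u - β ε) ε q).re
        / (√ε * G)) (fun ε => saddleCoeff Λ₀ Λ₁ u (u - β ε) * ε) ∧
      (fun ε => saddleCoeff Λ₀ Λ₁ u (u - β ε) * ε - saddleCoeff Λ₀ Λ₁ u (u - c) * ε)
        =O[𝓝[>] 0] (fun ε : ℝ => ε ^ 2) := by
    have hdiff : DifferentiableAt ℝ (saddleCoeff Λ₀ Λ₁ u) (u - c) := by
      unfold saddleCoeff
      fun_prop (disch := assumption)
    have hO := hdiff.isBigO_sub.comp_tendsto hv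
    have hO' : (fun ε => saddleCoeff Λ₀ Λ₁ u (u - β ε) - saddleCoeff Λ₀ Λ₁ u (u - c))
        =O[𝓝[>] 0] (fun ε : ℝ => ε) := by
      refine hO.trans (hβ.neg_left.congr_left fun ε => ?_)
      simp only [Function.comp]
      ring
    refine ⟨⟨?_, ?_⟩, ?_⟩
    · refine IsBigO.of_bound (K / G) ?_
      filter_upwards [hlo, hhi, Ioo_mem_nhdsGT (show (0 : ℝ) < s₁ ^ 2 by positivity)]
        with ε h1 h2 hε
      have hε0 := hε.1
      have hs : √ε ∈ Ioo 0 s₁ := ⟨Real.sqrt_pos.2 hε0, (Real.sqrt_lt' hs₁).2 hε.2⟩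
      have hm := hmain _ hs _ h1 h2
      have hs2 : √ε ^ 2 = ε := Real.sq_sqrt hε0.le
      have hs5 : √ε ^ 5 = √ε * ε ^ 2 := by
        calc √ε ^ 5 = √ε * (√ε ^ 2) ^ 2 := by ring
          _ = _ := by rw [hs2]
      rw [hs2, hs5] at hm
      have hsG : 0 < √ε * G := mul_pos hs.1 hG0
      rw [Real.norm_eq_abs, Real.norm_of_nonneg (by positivity), div_sub' hsG.ne', abs_div,
        abs_of_pos hsG, div_le_iff₀ hsG]
      refine le_trans (le_of_eq ?_) (hm.trans (le_of_eq ?_))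
      · congr 1; ring
      · field_simp
    · have hb : (fun ε => saddleCoeff Λ₀ Λ₁ u (u - β ε)) =O[𝓝[>] 0] (fun _ : ℝ => (1 : ℝ)) :=
        (hdiff.continuousAt.tendsto.comp hv).isBigO_one ℝ
      simpa using hb.mul (isBigO_refl (fun ε : ℝ => ε) _)
    · refine (hO'.mul (isBigO_refl (fun ε : ℝ => ε) _)).congr (fun ε => ?_) (fun ε => ?_)
      · ring
      · ring
  exact hβε.1.congr_right hβε.2

/-- The cubic error of the expansion at `u` becomes quadratic after division by ε. This is where Λ₂
enters the result. -/
lemma oneAddApprox_mgf (hA : Assumptions P Y D Λ₀ Λ₁ Λ₂) (hu : u ∈ interior D) :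
    OneAddApprox (fun ε => Real.exp ((lmgf P Y ε u - Λ₀ u) / ε - Λ₁ u)) (fun ε => Λ₂ u * ε) := by
  have h := hA.expansion u hu
  have h1 : (fun ε => (lmgf P Y ε u - Λ₀ u) / ε - Λ₁ u - Λ₂ u * ε)
      =O[𝓝[>] 0] (fun ε : ℝ => ε ^ 2) := by
    refine (h.mul (isBigO_refl (fun ε : ℝ => ε⁻¹) _)).congr' ?_ ?_
    · filter_upwards [self_mem_nhdsWithin] with ε hε
      have hε0 : ε ≠ 0 := (mem_Ioi.1 hε).ne'
      field_simp
      ring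
    · filter_upwards [self_mem_nhdsWithin] with ε hε
      have hε0 : ε ≠ 0 := (mem_Ioi.1 hε).ne'
      field_simp
  refine (oneAddApprox_exp ?_).congr_right h1
  have h2 := (h1.trans isBigO_sq_self).add ((isBigO_refl (fun ε : ℝ => ε) _).const_mul_left (Λ₂ u))
  exact h2.congr_left fun ε => by ring

lemma sqrt_div_mul_sqrt {σ : ℝ} (hσ : 0 < σ) :
    √(2 * Real.pi / σ) * √(2 * Real.pi * σ) = 2 * Real.pi := by
  have hpi := Real.pi_pos
  rw [← Real.sqrt_mul (by positivity)]
  have : 2 * Real.pi / σ * (2 * Real.pi * σ) = (2 * Real.pi) ^ 2 := by field_simp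
  rw [this, Real.sqrt_sq (by positivity)]

lemma coeffBar_mul_prefactor {f : ℝ → ℝ} {c ε : ℝ} (hε : 0 < ε) (hu : u ≠ 0)
    (huc : u - c ≠ 0) (hc : 0 ≤ c) :
    coeffBar Λ₀ f c u ε * ((if 0 < c then ε * f ε * (u - c) / c else u) / (u - ε * f ε))
      = ε * f ε * √ε / (u * (u - ε * f ε) * √(2 * Real.pi * iteratedDeriv 2 Λ₀ u)) := by
  rw [coeffBar]
  split_ifs with hc0
  · generalize √(2 * Real.pi * iteratedDeriv 2 Λ₀ u) = S
    rw [div_mul_div_comm, mul_div_assoc', div_div]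
    rw [show c * √ε * (ε * f ε * (u - c)) = (c * (u - c)) * (ε * f ε * √ε) by ring,
      show c * (u * (u - c) * S * (u - ε * f ε)) = (c * (u - c)) * (u * (u - ε * f ε) * S) by ring,
      mul_div_mul_left _ _ (mul_ne_zero hc0.ne' huc)]
  · obtain rfl : c = 0 := le_antisymm (not_lt.1 hc0) hc
    have h32 : ε ^ (3 / 2 : ℝ) = ε * √ε := by
      rw [Real.sqrt_eq_rpow, ← Real.rpow_one_add' hε.le (by norm_num)]
      norm_num
    rw [h32, sub_zero, div_mul_div_comm]
    rw [show ε * √ε * f ε * u = u * (ε * f ε * √ε) by ring,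
      show u * u * √(2 * Real.pi * iteratedDeriv 2 Λ₀ u) * (u - ε * f ε)
        = u * (u * (u - ε * f ε) * √(2 * Real.pi * iteratedDeriv 2 Λ₀ u)) by ring,
      mul_div_mul_left _ _ hu]

/-- The expansion of option prices, for any payoff with the given bilateral Laplace transform. -/
lemma hasExpansion_of_payoff [IsProbabilityMeasure P] (hY : ∀ ε : ℝ, 0 < ε → AEMeasurable (Y ε) P)
    (hA : Assumptions P Y D Λ₀ Λ₁ Λ₂) {f : ℝ → ℝ} {c k : ℝ} (hc : 0 ≤ c)
    (hfc : (fun ε : ℝ => ε * f ε - c) =O[𝓝[>] 0] (fun ε : ℝ => ε))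
    (hu : u ∈ interior D) (huk : deriv Λ₀ u = k) (hu0 : u ≠ 0) (huc : u - c ≠ 0)
    {X : ℝ → Ω → ℝ} {g : ℝ → ℝ → ℝ} (hgc : ∀ b, Continuous (g b))
    (hgx : ∀ᶠ ε in 𝓝[>] (0 : ℝ), ∀ x : ℝ, x ≠ 0 →
      ((Real.exp (-u * x) * g (ε * f ε) x : ℝ) : ℂ)
        = oneSidedExp (u - ε * f ε : ℝ) x - oneSidedExp u x)
    (hX : ∀ ε > 0, ∀ ω, X ε ω = Real.exp (k * f ε) * g (ε * f ε) ((Y ε ω - k) / ε)) :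
    HasExpansion P X D Λ₀ Λ₁ Λ₂ f c k u := by
  obtain ⟨hσ, hcont⟩ := oneAddApprox_contour hA hu hu0 huc hfc
  have hpre := oneAddApprox_prefactor hc huc hfc
  have hmgf := oneAddApprox_mgf hA hu
  have hprod := (hpre.mul hmgf).mul hcont
  have hv : Tendsto (fun ε => u - ε * f ε) (𝓝[>] 0) (𝓝 (u - c)) := by
    have := hfc.trans_tendsto ((continuous_id.tendsto (0 : ℝ)).mono_left nhdsWithin_le_nhds)
    have := this.add_const c
    simp only [sub_add_cancel, zero_add] at this
    exact this.const_sub u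
  obtain ⟨ε₀, hε₀, hdom, -⟩ := hA.smooth
  have hE : ∀ᶠ ε in 𝓝[>] (0 : ℝ), 0 < ε ∧ Integrable (X ε) P ∧
      ∫ ω, X ε ω ∂P = Real.exp (k * f ε) * (ε * f ε / (2 * Real.pi * (u * (u - ε * f ε)))
        * Real.exp ((lmgf P Y ε u - u * k) / ε)
        * (∫ q, normIntegrand P Y k u (u - ε * f ε) ε q).re) := by
    filter_upwards [hgx, hv.eventually_ne huc, Ioo_mem_nhdsGT hε₀] with ε h1 h2 hε
    obtain ⟨h3, h4⟩ := expectation_payoff_eq (k := k) hε.1.ne' (hY ε hε.1) hu0 h2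
      (hdom ε hε hu) (hgc _) h1
    have h5 : X ε = fun ω => Real.exp (k * f ε) * g (ε * f ε) ((Y ε ω - k) / ε) :=
      funext (hX ε hε.1)
    rw [h5, integral_const_mul, h4]
    exact ⟨hε.1, h3.const_mul _, rfl⟩
  -- `R` is taken to be the exact product of the three correction factors minus `coeff`. The
  -- identity then holds exactly, and only the size of `R` requires an estimate.
  refine ⟨hE.mono fun ε h => h.2.1, fun ε => (if 0 < c then ε * f ε * (u - c) / c else u)
      / (u - ε * f ε) * Real.exp ((lmgf P Y ε u - Λ₀ u) / ε - Λ₁ u)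
      * ((∫ q, normIntegrand P Y (deriv Λ₀ u) u (u - ε * f ε) ε q).re
        / (√ε * √(2 * Real.pi / iteratedDeriv 2 Λ₀ u))) - coeff Λ₀ Λ₁ Λ₂ f c u ε, ?_, ?_⟩
  · refine hprod.1.congr_left fun ε => ?_
    rw [coeff, ← add_saddleCoeff_eq_upsilon hσ.ne' hu0 huc]
    ring
  · filter_upwards [hE] with ε hεE
    obtain ⟨hε, -, h⟩ := hεE
    rw [add_sub_cancel, h, huk]
    have hleg := legendre_eq hA.strictConvex hA.essentiallySmooth.differentiable hu
    rw [huk] at hleg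
    have e1 : Real.exp (-legendre D Λ₀ k / ε + k * f ε + Λ₁ u)
        * Real.exp ((lmgf P Y ε u - Λ₀ u) / ε - Λ₁ u)
        = Real.exp (k * f ε) * Real.exp ((lmgf P Y ε u - u * k) / ε) := by
      rw [← Real.exp_add, ← Real.exp_add, hleg]
      congr 1
      ring
    have e2 := coeffBar_mul_prefactor (Λ₀ := Λ₀) (f := f) hε hu0 huc hc
    have hs := sqrt_div_mul_sqrt hσ
    have hpi := Real.pi_pos
    have hse := Real.sqrt_pos.2 hε
    have hS1 : 0 < √(2 * Real.pi / iteratedDeriv 2 Λ₀ u) := by positivity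
    have hS2 : 0 < √(2 * Real.pi * iteratedDeriv 2 Λ₀ u) := by positivity
    generalize (∫ q, normIntegrand P Y k u (u - ε * f ε) ε q).re = J
    generalize √(2 * Real.pi / iteratedDeriv 2 Λ₀ u) = S₁ at *
    generalize √(2 * Real.pi * iteratedDeriv 2 Λ₀ u) = S₂ at *
    calc _ = (Real.exp (-legendre D Λ₀ k / ε + k * f ε + Λ₁ u)
        * Real.exp ((lmgf P Y ε u - Λ₀ u) / ε - Λ₁ u))
        * (coeffBar Λ₀ f c u ε * ((if 0 < c then ε * f ε * (u - c) / c else u) / (u - ε * f ε)))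
        * (J / (√ε * S₁)) := by ring
      _ = Real.exp (k * f ε) * Real.exp ((lmgf P Y ε u - u * k) / ε)
        * (ε * f ε * √ε / (u * (u - ε * f ε) * S₂)) * (J / (√ε * S₁)) := by rw [e1, e2]
      _ = Real.exp (k * f ε) * Real.exp ((lmgf P Y ε u - u * k) / ε)
        * (ε * f ε * J / ((S₁ * S₂) * (u * (u - ε * f ε)))) := by
          rw [mul_assoc, div_mul_div_comm]
          congr 1
          rw [show ε * f ε * √ε * J = √ε * (ε * f ε * J) by ring,
            show u * (u - ε * f ε) * S₂ * (√ε * S₁) = √ε * (S₁ * S₂ * (u * (u - ε * f ε))) by ring,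
            mul_div_mul_left _ _ hse.ne']
      _ = _ := by rw [hs]; ring

end

end OptionAsymp

/-- As Λ₀' is strictly increasing, the three conditions on k say u > c, u < 0 and 0 < u < c; in
particular u differs from 0 and c. Since ε f(ε) ≥ 0 tends to c, for small ε the line Re w = u has
the corresponding position relative to the poles 0 and ε f(ε), and this position selects the payoff.
-/
theorem theorem2p3 {Ω : Type*} [MeasurableSpace Ω] (P : MeasureTheory.Measure Ω)
    [MeasureTheory.IsProbabilityMeasure P] (Y : ℝ → Ω → ℝ)
    (hY : ∀ ε : ℝ, 0 < ε → AEMeasurable (Y ε) P)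
    (D : Set ℝ) (Λ₀ Λ₁ Λ₂ : ℝ → ℝ) (hA : OptionAsymp.Assumptions P Y D Λ₀ Λ₁ Λ₂)
    (f : ℝ → ℝ) (hf : ∀ ε : ℝ, 0 < ε → 0 ≤ f ε) (c : ℝ) (hc : 0 ≤ c) (hcD : c ∈ interior D)
    (hfc : (fun ε : ℝ => f ε * ε - c) =O[𝓝[>] 0] (fun ε : ℝ => ε))
    (k u : ℝ) (hu : u ∈ interior D) (huk : deriv Λ₀ u = k) :
    (deriv Λ₀ c < k →
      OptionAsymp.HasExpansion P
        (fun ε ω => max (Real.exp (Y ε ω * f ε) - Real.exp (k * f ε)) 0)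
        D Λ₀ Λ₁ Λ₂ f c k u) ∧
    (k < deriv Λ₀ 0 →
      OptionAsymp.HasExpansion P
        (fun ε ω => max (Real.exp (k * f ε) - Real.exp (Y ε ω * f ε)) 0)
        D Λ₀ Λ₁ Λ₂ f c k u) ∧
    (deriv Λ₀ 0 < k ∧ k < deriv Λ₀ c →
      OptionAsymp.HasExpansion P
        (fun ε ω => -min (Real.exp (Y ε ω * f ε)) (Real.exp (k * f ε)))
        D Λ₀ Λ₁ Λ₂ f c k u) := by
  simp only [mul_comm (f _)] at hfc
  have hmono : StrictMonoOn (deriv Λ₀) (interior D) := hA.strictConvex.strictMonoOn_deriv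
    fun x hx => hA.essentiallySmooth.differentiable.differentiableAt (isOpen_interior.mem_nhds hx)
  have hβ : Tendsto (fun ε => ε * f ε) (𝓝[>] 0) (𝓝 c) := by
    have := hfc.trans_tendsto ((continuous_id.tendsto (0 : ℝ)).mono_left nhdsWithin_le_nhds)
    simpa using this.add_const c
  have hpos : ∀ᶠ ε in 𝓝[>] (0 : ℝ), 0 ≤ ε * f ε := by
    filter_upwards [self_mem_nhdsWithin] with ε hε
    exact mul_nonneg (le_of_lt hε) (hf ε hε)
  have hexp : ∀ ε > 0, ∀ y : ℝ, Real.exp (y * f ε)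
      = Real.exp (k * f ε) * Real.exp (ε * f ε * ((y - k) / ε)) := fun ε hε y => by
    rw [← Real.exp_add]
    congr 1
    field_simp
    ring
  have hEp : ∀ ε, 0 ≤ Real.exp (k * f ε) := fun ε => (Real.exp_pos _).le
  refine ⟨fun hk => ?_, fun hk => ?_, fun hk => ?_⟩
  · rw [← huk, hmono.lt_iff_lt hcD hu] at hk
    refine OptionAsymp.hasExpansion_of_payoff hY hA hc hfc hu huk (by linarith) (by linarith)
      (g := fun b x => max (Real.exp (b * x) - 1) 0) (fun b => by fun_prop) ?_ fun ε hε ω => ?_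
    · filter_upwards [hpos, hβ.eventually_lt_const hk] with ε h0 h1 x hx
      exact OptionAsymp.call_oneSided h0 h1 hx
    · rw [hexp ε hε (Y ε ω), mul_max_of_nonneg _ _ (hEp ε), mul_zero, mul_sub, mul_one]
  · rw [← huk, hmono.lt_iff_lt hu hA.zero_mem] at hk
    refine OptionAsymp.hasExpansion_of_payoff hY hA hc hfc hu huk (by linarith) (by linarith)
      (g := fun b x => max (1 - Real.exp (b * x)) 0) (fun b => by fun_prop) ?_ fun ε hε ω => ?_
    · filter_upwards [hpos] with ε h0 x hx
      exact OptionAsymp.put_oneSided h0 hk hx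
    · rw [hexp ε hε (Y ε ω), mul_max_of_nonneg _ _ (hEp ε), mul_zero, mul_sub, mul_one]
  · rw [← huk, hmono.lt_iff_lt hA.zero_mem hu, hmono.lt_iff_lt hu hcD] at hk
    refine OptionAsymp.hasExpansion_of_payoff hY hA hc hfc hu huk (by linarith) (by linarith)
      (g := fun b x => -min (Real.exp (b * x)) 1) (fun b => by fun_prop) ?_ fun ε hε ω => ?_
    · filter_upwards [hβ.eventually_const_lt hk.2] with ε h1 x hx
      exact OptionAsymp.covered_oneSided hk.1 h1 hx
    · rw [hexp ε hε (Y ε ω), mul_neg, mul_min_of_nonneg _ _ (hEp ε), mul_one]
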